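/- Let $M$ be a connected smooth manifold (Hausdorff, second countable, finite-dimensional, without boundary) and let $\nabla$ be a smooth connection on $M$, i.e. on $TM$ (torsion is allowed). Let $W$ be the bundle of symmetric elements of $T^*M\otimes T^*M$ with the connection, again denoted $\nabla$, induced by the Leibniz rule, and let $R$ be the curvature of this connection on $W$. For a subset $V\subseteq W$ that meets each fibre $W_x$ in a linear subspace, let $\mathcal S(V)$ be the set of all $v\in V$ through which there passes a smooth local section of $W$ with values in $V$. For such a subset $W'$ with $\mathcal S(W')=W'$ let $\ker\alpha_{W'}$ be the set of all $w\in W'_x$, $x\in M$, for which there is a smooth local section $X$ of $W$ near $x$ with values in $W'$, $X(x)=w$ and $(\nabla_uX)(x)\in W'_x$ for all $u\in T_xM$ (the kernel of the second fundamental 1-form of $W'$). Put $$V^{(0)}=\{w\in W: R(\cdot,\cdot)w=0\},\qquad W^{(i)}=\mathcal S(V^{(i)}),\qquad V^{(i+1)}=\ker\alpha_{W^{(i)}}.$$ The decreasing sequence $W^{(0)}\supseteq W^{(1)}\supseteq\cdots$ becomes stationary; let $\widetilde W$ be its terminal member, i.e. $\widetilde W=W^{(k)}$ where $W^{(l)}=W^{(k)}$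 for all $l\ge k$. The connection $\nabla$ is called regular if $\widetilde W$ is a vector bundle over $M$, i.e. if it has a smooth frame near each point, and metric if there is a smooth Riemannian metric $g$ on $M$ with $\nabla g=0$ (a parallel metric). For $n\ge 0$ let $H^1(M,\mathcal G_n)$ be the first Čech cohomology set of the constant sheaf of sections in $GL(n,\mathbb R)$: the direct limit, over the open covers $\{U_\alpha\}$ of $M$, of the sets of families of locally constant functions $t_{\alpha\beta}:U_\alpha\cap U_\beta\to GL(n,\mathbb R)$ with $t_{\alpha\gamma}^{-1}t_{\alpha\beta}t_{\beta\gamma}=1$, modulo $t'_{\alpha\beta}=b_\alpha^{-1}t_{\alpha\beta}b_\beta$ with locally constant $b_\alpha:U_\alpha\to GL(n,\mathbb R)$. For $m\le n$ the embedding $GL(m,\mathbb R)\to GL(n,\mathbb R)$, $A\mapsto\begin{pmatrix}I_{n-m}&0\\0&A\end{pmatrix}$, induces a map $H^1(M,\mathcal G_m)\to H^1(M,\mathcal G_n)$. The rank of $\sigma\in H^1(M,\mathcal G_n)$ is $n-m$, where $m$ is the least non-negative integer such that $\sigma$ lies in the image of $H^1(M,\mathcal G_m)$. Theorem. Suppose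 that $\nabla$ is regular and metric. Then $\widetilde W$ has a constant rank $n$, and there is exactly one class $\tau\in H^1(M,\mathcal G_n)$ that is represented by the cocycles $t$ arising from the open covers $\{U_\alpha\}$ of $M$ with frames $(h_{\alpha1},\dots,h_{\alpha n})$ of parallel sections of $\widetilde W$ over $U_\alpha$ through $h_{\alpha i}=\sum_{j}(t_{\alpha\beta})_{ij}h_{\beta j}$ on $U_\alpha\cap U_\beta$. Let $W_S$ be the subbundle of $W$ generated by the global parallel sections of $W$, and $W_M$ the subbundle generated by the parallel metrics on $M$. Then $$\operatorname{rank}W_M=\operatorname{rank}W_S=\operatorname{rank}\tau .$$ -/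

import Mathlib

open Bundle FiberBundle Set TopologicalSpace
open scoped Manifold ContDiff Topology

namespace MetricConnection

noncomputable section

set_option linter.unusedSectionVars false

universe u

/-! ### The connection induced on bilinear forms -/

section Induced

/-- Shortcut instance, only to speed up instance search. -/
instance continuousAdd_dual {X : Type*} [AddCommGroup X] [Module ℝ X] [TopologicalSpace X] :
    ContinuousAdd (X →L[ℝ] ℝ) := inferInstance

variable {E : Type*} [NormedAddCommGroup E] [NormedSpace ℝ E]
  {H : Type*} [TopologicalSpace H] {I : ModelWithCorners ℝ E H}
  {M : Type*} [TopologicalSpace M] [ChartedSpace H M]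
  {F : Type*} [NormedAddCommGroup F] [NormedSpace ℝ F]
  {V : M → Type*} [TopologicalSpace (TotalSpace F V)]
  [∀ x, AddCommGroup (V x)] [∀ x, Module ℝ (V x)] [∀ x : M, TopologicalSpace (V x)]
  [∀ x, IsTopologicalAddGroup (V x)] [∀ x, ContinuousSMul ℝ (V x)]
  [FiberBundle F V] [VectorBundle ℝ F V]
  (cov : CovariantDerivative I F V)
  {h : ∀ x : M, V x →L[ℝ] V x →L[ℝ] ℝ} {x : M}

/-- `(∇_u h)(Y, Z) = u (h(Y, Z)) - h(∇_u Y, Z) - h(Y, ∇_u Z)` at the point `x`. -/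
def leibnizForm (h : ∀ x : M, V x →L[ℝ] V x →L[ℝ] ℝ) (x : M) (u : TangentSpace I x)
    (Y Z : ∀ x : M, V x) : ℝ :=
  mvfderiv I (fun y ↦ h y (Y y) (Z y)) x u - h x (cov Y x u) (Z x) - h x (Y x) (cov Z x u)

theorem mdifferentiableAt_eval
    (hh : MDifferentiableAt I (I.prod 𝓘(ℝ, F →L[ℝ] F →L[ℝ] ℝ))
      (fun y ↦ TotalSpace.mk' (F →L[ℝ] F →L[ℝ] ℝ) y (h y)) x)
    {Y Z : ∀ x : M, V x} (hY : MDiffAt (T% Y) x) (hZ : MDiffAt (T% Z) x) :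
    MDiffAt (fun y ↦ h y (Y y) (Z y)) x := by
  have : MDifferentiableAt I (I.prod 𝓘(ℝ))
      (fun m ↦ TotalSpace.mk' ℝ (E := Bundle.Trivial M ℝ) m (h m (Y m) (Z m))) x := by
    apply MDifferentiableAt.clm_bundle_apply₂ (F₁ := F) (F₂ := F)
    · exact hh
    · exact hY
    · exact hZ
  simp only [mdifferentiableAt_totalSpace] at this
  exact this.2

theorem leibnizForm_tensorial_left
    (hh : MDifferentiableAt I (I.prod 𝓘(ℝ, F →L[ℝ] F →L[ℝ] ℝ))
      (fun y ↦ TotalSpace.mk' (F →L[ℝ] F →L[ℝ] ℝ) y (h y)) x)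
    (u : TangentSpace I x) (Z : ∀ x : M, V x) (hZ : MDiffAt (T% Z) x) :
    TensorialAt I F (leibnizForm cov h x u · Z) x where
  smul hf hY := by
    simp [leibnizForm, mvfderiv_fun_mul hf (mdifferentiableAt_eval hh hY hZ),
      cov.isCovariantDerivativeOn.leibniz hY hf]
    ring
  add hY hY' := by
    simp [leibnizForm, mvfderiv_fun_add (mdifferentiableAt_eval hh hY hZ)
      (mdifferentiableAt_eval hh hY' hZ), cov.isCovariantDerivativeOn.add hY hY']
    ring

theorem leibnizForm_tensorial_right
    (hh : MDifferentiableAt I (I.prod 𝓘(ℝ, F →L[ℝ] F →L[ℝ] ℝ))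
      (fun y ↦ TotalSpace.mk' (F →L[ℝ] F →L[ℝ] ℝ) y (h y)) x)
    (u : TangentSpace I x) (Y : ∀ x : M, V x) (hY : MDiffAt (T% Y) x) :
    TensorialAt I F (leibnizForm cov h x u Y ·) x where
  smul hf hZ := by
    simp [leibnizForm, mvfderiv_fun_mul hf (mdifferentiableAt_eval hh hY hZ),
      cov.isCovariantDerivativeOn.leibniz hZ hf]
    ring
  add hZ hZ' := by
    simp [leibnizForm, mvfderiv_fun_add (mdifferentiableAt_eval hh hY hZ)
      (mdifferentiableAt_eval hh hY hZ'), cov.isCovariantDerivativeOn.add hZ hZ']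
    ring

variable [FiniteDimensional ℝ E] [FiniteDimensional ℝ F] [ContMDiffVectorBundle 1 F V I]

/-- The covariant derivative at `x` of a field of bilinear forms that is differentiable at `x`. -/
def bilinCovAt
    (hh : MDifferentiableAt I (I.prod 𝓘(ℝ, F →L[ℝ] F →L[ℝ] ℝ))
      (fun y ↦ TotalSpace.mk' (F →L[ℝ] F →L[ℝ] ℝ) y (h y)) x) :
    TangentSpace I x →L[ℝ] V x →L[ℝ] V x →L[ℝ] ℝ :=
  haveI : FiniteDimensional ℝ (TangentSpace I x) := inferInstanceAs (FiniteDimensional ℝ E)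
  haveI : T2Space (TangentSpace I x) := inferInstanceAs (T2Space E)
  LinearMap.toContinuousLinearMap
    { toFun u := TensorialAt.mkHom₂ (leibnizForm cov h x u) x
        (leibnizForm_tensorial_left cov hh u) (leibnizForm_tensorial_right cov hh u)
      map_add' u v := by
        ext y z
        simp only [add_apply, TensorialAt.mkHom₂_apply_eq_extend, leibnizForm, map_add]
        ring
      map_smul' c u := by
        ext y z
        simp only [smul_apply, TensorialAt.mkHom₂_apply_eq_extend, leibnizForm, map_smul,
          smul_eq_mul, RingHom.id_apply]
        ring }

theorem bilinCovAt_apply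
    (hh : MDifferentiableAt I (I.prod 𝓘(ℝ, F →L[ℝ] F →L[ℝ] ℝ))
      (fun y ↦ TotalSpace.mk' (F →L[ℝ] F →L[ℝ] ℝ) y (h y)) x)
    (u : TangentSpace I x) {Y Z : ∀ x : M, V x}
    (hY : MDiffAt (T% Y) x) (hZ : MDiffAt (T% Z) x) :
    bilinCovAt cov hh u (Y x) (Z x) = leibnizForm cov h x u Y Z :=
  TensorialAt.mkHom₂_apply (leibnizForm_tensorial_left cov hh u)
    (leibnizForm_tensorial_right cov hh u) hY hZ

theorem bilinCovAt_extend
    (hh : MDifferentiableAt I (I.prod 𝓘(ℝ, F →L[ℝ] F →L[ℝ] ℝ))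
      (fun y ↦ TotalSpace.mk' (F →L[ℝ] F →L[ℝ] ℝ) y (h y)) x)
    (u : TangentSpace I x) (v w : V x) :
    bilinCovAt cov hh u v w = leibnizForm cov h x u (extend F v) (extend F w) := rfl

open Classical in
/-- The connection on the bundle of bilinear forms on `V` induced by a connection on `V` through
the Leibniz rule. (A connection in Mathlib's sense also assigns a value, without meaning, to fields
that are not differentiable at the point; here it is `0`.) -/
def bilinCov : CovariantDerivative I (F →L[ℝ] F →L[ℝ] ℝ)
    (fun x : M ↦ V x →L[ℝ] V x →L[ℝ] ℝ) where
  toFun h x :=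
    if hh : MDifferentiableAt I (I.prod 𝓘(ℝ, F →L[ℝ] F →L[ℝ] ℝ))
      (fun y ↦ TotalSpace.mk' (F →L[ℝ] F →L[ℝ] ℝ) y (h y)) x
    then bilinCovAt cov hh else 0
  isCovariantDerivativeOnUniv :=
  { add := by
      intro h h' x hh hh' _
      have hs := mdifferentiableAt_add_section hh hh'
      rw [dif_pos hh, dif_pos hh', dif_pos hs]
      ext u y z
      have hy : MDiffAt (T% (extend F y)) x := mdifferentiableAt_extend ..
      have hz : MDiffAt (T% (extend F z)) x := mdifferentiableAt_extend ..
      simp only [add_apply, bilinCovAt_extend, leibnizForm, Pi.add_apply,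
        mvfderiv_fun_add (mdifferentiableAt_eval hh hy hz) (mdifferentiableAt_eval hh' hy hz)]
      ring
    leibniz := by
      intro h g x hh hg _
      have hs := hg.smul_section hh
      rw [dif_pos hh, dif_pos hs]
      ext u y z
      have hy : MDiffAt (T% (extend F y)) x := mdifferentiableAt_extend ..
      have hz : MDiffAt (T% (extend F z)) x := mdifferentiableAt_extend ..
      have := mvfderiv_fun_mul hg (mdifferentiableAt_eval hh hy hz)
      simp [bilinCovAt_extend, leibnizForm, this]
      ring }

end Induced

/-! ### The derived flag of a connection on a vector bundle

A subset of the total space of a vector bundle is given by its fibres `W' x ⊆ V x`. -/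

section Flag

variable {E : Type*} [NormedAddCommGroup E] [NormedSpace ℝ E]
  {H : Type*} [TopologicalSpace H] {I : ModelWithCorners ℝ E H}
  {M : Type*} [TopologicalSpace M] [ChartedSpace H M] [IsManifold I ∞ M]
  {F : Type*} [NormedAddCommGroup F] [NormedSpace ℝ F]
  {V : M → Type*} [TopologicalSpace (TotalSpace F V)]
  [∀ x, AddCommGroup (V x)] [∀ x, Module ℝ (V x)] [∀ x : M, TopologicalSpace (V x)]
  [∀ x, IsTopologicalAddGroup (V x)] [∀ x, ContinuousSMul ℝ (V x)]
  [FiberBundle F V] [VectorBundle ℝ F V]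

variable (I F) in
/-- The section `X` (of which only the values on `U` matter) is smooth on `U`. -/
def SmoothOn (X : ∀ x : M, V x) (U : Set M) : Prop :=
  ContMDiffOn I (I.prod 𝓘(ℝ, F)) ∞ (fun x ↦ TotalSpace.mk' F x (X x)) U

variable (I F) in
/-- `S(W')`: the elements of `W'` through which there passes a smooth local section with values
in `W'`. -/
def sectionCore (W' : ∀ x : M, Set (V x)) (x : M) : Set (V x) :=
  {w | ∃ (U : Opens M) (X : ∀ y : M, V y), x ∈ U ∧ SmoothOn I F X U ∧
    (∀ y ∈ U, X y ∈ W' y) ∧ X x = w}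

variable (I F) in
/-- `X 0, …, X (n - 1)` is a smooth frame of `W'` over `U`. -/
structure IsFrameOn (W' : ∀ x : M, Set (V x)) {n : ℕ} (X : Fin n → ∀ x : M, V x) (U : Set M) :
    Prop where
  smoothOn : ∀ i, SmoothOn I F (X i) U
  linearIndependent : ∀ x ∈ U, LinearIndependent ℝ (fun i ↦ X i x)
  span_eq : ∀ x ∈ U, (Submodule.span ℝ (range fun i ↦ X i x) : Set (V x)) = W' x

variable (I F) in
/-- `W'` is a (smooth) vector bundle over a neighbourhood of `x`. -/
def IsBundleAt (W' : ∀ x : M, Set (V x)) (x : M) : Prop :=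
  ∃ (U : Opens M) (n : ℕ) (X : Fin n → ∀ y : M, V y), x ∈ U ∧ IsFrameOn I F W' X U

variable (D : CovariantDerivative I F V)

/-- The curvature `R(u, v) w = ∇_u ∇_v w - ∇_v ∇_u w - ∇_[u, v] w` at `x`, computed by means of
extensions of `u`, `v`, `w` to local sections that are smooth near `x`. -/
def curvature {x : M} (u v : TangentSpace I x) (w : V x) : V x :=
  D (fun y ↦ D (extend F w) y (extend E v y)) x u
    - D (fun y ↦ D (extend F w) y (extend E u y)) x v
    - D (extend F w) x (VectorField.mlieBracket I (extend E u) (extend E v) x)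

/-- The elements of `W` that are annihilated by the curvature. -/
def curvatureKer (W : ∀ x : M, Set (V x)) (x : M) : Set (V x) :=
  {w | w ∈ W x ∧ ∀ u v : TangentSpace I x, curvature D u v w = 0}

/-- The kernel of the second fundamental 1-form `α : W' → (W / W') ⊗ T*M` of `W'`, where
`α(X x) = ∇X(x) mod W'` for local sections `X` of `W'`: the elements `w` of `W'` through which
there passes a smooth local section `X` of `W'` with `∇_u X ∈ W'` at the point, for all `u`. -/
def secondFormKer (W' : ∀ x : M, Set (V x)) (x : M) : Set (V x) :=
  {w | ∃ (U : Opens M) (X : ∀ y : M, V y), x ∈ U ∧ SmoothOn I F X U ∧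
    (∀ y ∈ U, X y ∈ W' y) ∧ X x = w ∧ ∀ u : TangentSpace I x, D X x u ∈ W' x}

/-- The derived flag `W⁽⁰⁾ ⊇ W⁽¹⁾ ⊇ …` of the connection `D` on the bundle `W`. -/
def flag (W : ∀ x : M, Set (V x)) : ℕ → ∀ x : M, Set (V x)
  | 0 => sectionCore I F (curvatureKer D W)
  | i + 1 => sectionCore I F (secondFormKer D (flag W i))

/-- The terminal subset `W̃` of the derived flag: the member at which the flag has become
stationary. -/
def terminal (W : ∀ x : M, Set (V x)) (x : M) : Set (V x) :=
  {w | ∃ k, (∀ l ≥ k, flag D W l = flag D W k) ∧ w ∈ flag D W k x}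

/-- The value of `terminal`: it is `W⁽ᵏ⁾` for each `k` from which on the flag is stationary. -/
theorem terminal_eq (W : ∀ x : M, Set (V x)) {k : ℕ} (hk : ∀ l ≥ k, flag D W l = flag D W k) :
    terminal D W = flag D W k := by
  funext x
  ext w
  refine ⟨?_, fun hw ↦ ⟨k, hk, hw⟩⟩
  rintro ⟨j, hj, hw⟩
  rcases le_total j k with h | h
  · rwa [hj k h]
  · rwa [← hk j h]

/-- The section `X` of `V` is parallel on `U`. -/
def ParallelOn (X : ∀ x : M, V x) (U : Set M) : Prop :=
  ∀ x ∈ U, D X x = 0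

end Flag

/-! ### The first cohomology set of the constant sheaf of sections in `GL(n, ℝ)` -/

section Cohomology

/-- An open cover of `M`. -/
structure OpenCover (M : Type u) [TopologicalSpace M] : Type (u + 1) where
  Index : Type u
  set : Index → Opens M
  exists_mem : ∀ x, ∃ α, x ∈ set α

variable {M : Type u} [TopologicalSpace M] {n : ℕ}

/-- A 1-cocycle of the cover `𝒰` with coefficients in the constant sheaf of sections in
`GL(n, ℝ)`. -/
structure Cocycle (𝒰 : OpenCover M) (n : ℕ) where
  val : ∀ α β : 𝒰.Index,
    LocallyConstant (𝒰.set α ⊓ 𝒰.set β : Opens M) (Matrix.GeneralLinearGroup (Fin n) ℝ)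
  delta_eq_one : ∀ α β γ x (hα : x ∈ 𝒰.set α) (hβ : x ∈ 𝒰.set β) (hγ : x ∈ 𝒰.set γ),
    (val α γ ⟨x, hα, hγ⟩)⁻¹ * val α β ⟨x, hα, hβ⟩ * val β γ ⟨x, hβ, hγ⟩ = 1

/-- Two 1-cocycles of the same cover are cohomologous: `a'_{αβ} = b_α⁻¹ a_{αβ} b_β`. -/
def Cocycle.Cohomologous {𝒰 : OpenCover M} (a a' : Cocycle 𝒰 n) : Prop :=
  ∃ b : ∀ α, LocallyConstant (𝒰.set α) (Matrix.GeneralLinearGroup (Fin n) ℝ),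
    ∀ α β x (hα : x ∈ 𝒰.set α) (hβ : x ∈ 𝒰.set β),
      a'.val α β ⟨x, hα, hβ⟩ = (b α ⟨x, hα⟩)⁻¹ * a.val α β ⟨x, hα, hβ⟩ * b β ⟨x, hβ⟩

/-- Restriction of a locally constant function to a smaller open set. -/
def restrictLC {G : Type*} {A B : Opens M} (h : B ≤ A) (f : LocallyConstant A G) :
    LocallyConstant B G :=
  f.comap ⟨Set.inclusion h, continuous_inclusion h⟩

/-- `𝒱` refines `𝒰` through the map `ρ` of the indices. -/
def OpenCover.RefinesBy (𝒱 𝒰 : OpenCover M) (ρ : 𝒱.Index → 𝒰.Index) : Prop :=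
  ∀ α, 𝒱.set α ≤ 𝒰.set (ρ α)

/-- The image of a cocycle of `𝒰` in the cocycles of a refinement `𝒱`. -/
def Cocycle.refine {𝒱 𝒰 : OpenCover M} {ρ : 𝒱.Index → 𝒰.Index} (hρ : 𝒱.RefinesBy 𝒰 ρ)
    (a : Cocycle 𝒰 n) : Cocycle 𝒱 n where
  val α β := restrictLC (inf_le_inf (hρ α) (hρ β)) (a.val (ρ α) (ρ β))
  delta_eq_one α β γ x hα hβ hγ :=
    a.delta_eq_one (ρ α) (ρ β) (ρ γ) x (hρ α hα) (hρ β hβ) (hρ γ hγ)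

/-- Two cocycles, of two covers, become cohomologous on a common refinement of the covers. -/
def SameClass (a b : Σ 𝒰 : OpenCover M, Cocycle 𝒰 n) : Prop :=
  ∃ (𝒱 : OpenCover M) (ρ : 𝒱.Index → a.1.Index) (ρ' : 𝒱.Index → b.1.Index)
    (hρ : 𝒱.RefinesBy a.1 ρ) (hρ' : 𝒱.RefinesBy b.1 ρ'),
    (a.2.refine hρ).Cohomologous (b.2.refine hρ')

theorem sameClass_equivalence : Equivalence (SameClass (M := M) (n := n)) where
  refl a := ⟨a.1, id, id, fun _ ↦ le_rfl, fun _ ↦ le_rfl, fun _ ↦ 1, fun α β x hα hβ ↦ by simp⟩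
  symm := by
    rintro a b ⟨𝒱, ρ, ρ', hρ, hρ', c, hc⟩
    refine ⟨𝒱, ρ', ρ, hρ', hρ, fun α ↦ (c α)⁻¹, fun α β x hα hβ ↦ ?_⟩
    rw [hc α β x hα hβ]
    simp [mul_assoc]
  trans := by
    rintro a b d ⟨𝒱, ρ, σ, hρ, hσ, c, hc⟩ ⟨𝒱', σ', τ, hσ', hτ, c', hc'⟩
    refine ⟨⟨𝒱.Index × 𝒱'.Index, fun p ↦ 𝒱.set p.1 ⊓ 𝒱'.set p.2, fun x ↦ ?_⟩,
      fun p ↦ ρ p.1, fun p ↦ τ p.2, fun p ↦ inf_le_left.trans (hρ p.1),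
      fun p ↦ inf_le_right.trans (hτ p.2), fun p ↦
        restrictLC inf_le_left (c p.1) *
        restrictLC (inf_le_inf (hσ p.1) (hσ' p.2)) (b.2.val (σ p.1) (σ' p.2)) *
        restrictLC inf_le_right (c' p.2), ?_⟩
    · obtain ⟨α, hα⟩ := 𝒱.exists_mem x
      obtain ⟨β, hβ⟩ := 𝒱'.exists_mem x
      exact ⟨(α, β), hα, hβ⟩
    · rintro ⟨α, α'⟩ ⟨β, β'⟩ x ⟨hα, hα'⟩ ⟨hβ, hβ'⟩
      have h1 := hc α β x hα hβ
      have h2 := hc' α' β' x hα' hβ'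
      have h3 := b.2.delta_eq_one (σ α) (σ' α') (σ' β') x (hσ α hα) (hσ' α' hα') (hσ' β' hβ')
      have h4 := b.2.delta_eq_one (σ α) (σ β) (σ' β') x (hσ α hα) (hσ β hβ) (hσ' β' hβ')
      rw [mul_assoc, inv_mul_eq_one] at h3 h4
      change d.2.val (τ α') (τ β') ⟨x, hτ α' hα', hτ β' hβ'⟩ =
        (c α ⟨x, hα⟩ * b.2.val (σ α) (σ' α') ⟨x, hσ α hα, hσ' α' hα'⟩ * c' α' ⟨x, hα'⟩)⁻¹ *
        a.2.val (ρ α) (ρ β) ⟨x, hρ α hα, hρ β hβ⟩ *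
        (c β ⟨x, hβ⟩ * b.2.val (σ β) (σ' β') ⟨x, hσ β hβ, hσ' β' hβ'⟩ * c' β' ⟨x, hβ'⟩)
      change b.2.val (σ α) (σ β) ⟨x, hσ α hα, hσ β hβ⟩ =
        (c α ⟨x, hα⟩)⁻¹ * a.2.val (ρ α) (ρ β) ⟨x, hρ α hα, hρ β hβ⟩ * c β ⟨x, hβ⟩ at h1
      change d.2.val (τ α') (τ β') ⟨x, hτ α' hα', hτ β' hβ'⟩ =
        (c' α' ⟨x, hα'⟩)⁻¹ * b.2.val (σ' α') (σ' β') ⟨x, hσ' α' hα', hσ' β' hβ'⟩ *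
          c' β' ⟨x, hβ'⟩ at h2
      have h5 := inv_mul_eq_iff_eq_mul.mpr (h4.symm.trans h3)
      rw [h2, ← h5, h1]
      simp only [mul_inv_rev, mul_assoc]

variable (M n) in
/-- `H¹(M, 𝒢_n)`: the direct limit, over the open covers of `M`, of the sets of cohomology classes
of 1-cocycles with coefficients in the constant sheaf of sections in `GL(n, ℝ)`. -/
def H1 : Type (u + 1) :=
  Quotient (⟨SameClass, sameClass_equivalence⟩ : Setoid (Σ 𝒰 : OpenCover M, Cocycle 𝒰 n))

/-- The class of a cocycle in `H¹(M, 𝒢_n)`. -/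
def Cocycle.toH1 {𝒰 : OpenCover M} (a : Cocycle 𝒰 n) : H1 M n :=
  Quotient.mk _ ⟨𝒰, a⟩

/-- The embedding `GL(m, ℝ) → GL(n, ℝ)` that sends `A` to the block diagonal matrix with the
blocks `1` (of size `n - m`) and `A`. -/
def embedGL {m n : ℕ} (h : m ≤ n) :
    Matrix.GeneralLinearGroup (Fin m) ℝ →* Matrix.GeneralLinearGroup (Fin n) ℝ :=
  Units.map
    { toFun A := Matrix.reindex (finSumFinEquiv.trans (finCongr (Nat.sub_add_cancel h)))
        (finSumFinEquiv.trans (finCongr (Nat.sub_add_cancel h)))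
        (Matrix.fromBlocks (1 : Matrix (Fin (n - m)) (Fin (n - m)) ℝ) 0 0 A)
      map_one' := by
        rw [Matrix.fromBlocks_one, Matrix.reindex_apply, Matrix.submatrix_one_equiv]
      map_mul' A B := by
        simp only [Matrix.reindex_apply]
        rw [Matrix.submatrix_mul_equiv, Matrix.fromBlocks_multiply]
        simp }

/-- The image of a cocycle under `embedGL`. -/
def Cocycle.embed {m n : ℕ} (h : m ≤ n) {𝒰 : OpenCover M} (a : Cocycle 𝒰 m) : Cocycle 𝒰 n where
  val α β := (a.val α β).map (embedGL h)
  delta_eq_one α β γ x hα hβ hγ := by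
    have := congrArg (embedGL h) (a.delta_eq_one α β γ x hα hβ hγ)
    rwa [map_mul, map_mul, map_inv, map_one] at this

/-- The map `H¹(M, 𝒢_m) → H¹(M, 𝒢_n)` induced by `embedGL`. -/
def H1.embed {m n : ℕ} (h : m ≤ n) : H1 M m → H1 M n :=
  Quotient.map (fun a ↦ ⟨a.1, a.2.embed h⟩) (by
    rintro a b ⟨𝒱, ρ, ρ', hρ, hρ', c, hc⟩
    refine ⟨𝒱, ρ, ρ', hρ, hρ', fun α ↦ (c α).map (embedGL h), fun α β x hα hβ ↦ ?_⟩
    have := congrArg (embedGL h) (hc α β x hα hβ)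
    rw [map_mul, map_mul, map_inv] at this
    exact this)

/-- The rank of `σ ∈ H¹(M, 𝒢_n)`: it is `n - m`, where `m ≤ n` is least such that `σ` lies in the
image of `H¹(M, 𝒢_m)`. -/
def H1.rank (σ : H1 M n) : ℕ :=
  n - sInf {m | ∃ h : m ≤ n, σ ∈ range (H1.embed (M := M) h)}

end Cohomology

/-! ### The class of a flat bundle -/

section FlatClass

variable {E : Type*} [NormedAddCommGroup E] [NormedSpace ℝ E]
  {H : Type*} [TopologicalSpace H] {I : ModelWithCorners ℝ E H}
  {M : Type u} [TopologicalSpace M] [ChartedSpace H M] [IsManifold I ∞ M]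
  {F : Type*} [NormedAddCommGroup F] [NormedSpace ℝ F]
  {V : M → Type*} [TopologicalSpace (TotalSpace F V)]
  [∀ x, AddCommGroup (V x)] [∀ x, Module ℝ (V x)] [∀ x : M, TopologicalSpace (V x)]
  [∀ x, IsTopologicalAddGroup (V x)] [∀ x, ContinuousSMul ℝ (V x)]
  [FiberBundle F V] [VectorBundle ℝ F V]

/-- `τ ∈ H¹(M, 𝒢_n)` is a class of the flat bundle `(W', D)`: there are an open cover and frames
`h_α` of `W'` on its members, consisting of parallel sections, such that `τ` is the class of the
cocycle `t` with `h_{α i} = ∑ j, (t_{αβ})_{ij} h_{β j}`. -/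
def IsFlatClass (D : CovariantDerivative I F V) (W' : ∀ x : M, Set (V x)) {n : ℕ} (τ : H1 M n) :
    Prop :=
  ∃ (𝒰 : OpenCover M) (h : 𝒰.Index → Fin n → ∀ x : M, V x) (t : Cocycle 𝒰 n),
    (∀ α, IsFrameOn I F W' (h α) (𝒰.set α)) ∧
    (∀ α i, ParallelOn D (h α i) (𝒰.set α)) ∧
    (∀ α β x (hα : x ∈ 𝒰.set α) (hβ : x ∈ 𝒰.set β) (i : Fin n),
      h α i x = ∑ j, (t.val α β ⟨x, hα, hβ⟩ : Matrix (Fin n) (Fin n) ℝ) i j • h β j x) ∧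
    t.toH1 = τ

end FlatClass

/-! ### Connections on a manifold -/

section Manifold

variable {E : Type*} [NormedAddCommGroup E] [NormedSpace ℝ E] [FiniteDimensional ℝ E]
  {M : Type u} [TopologicalSpace M] [ChartedSpace E M] [IsManifold 𝓘(ℝ, E) ∞ M]

variable (E) in
/-- The bilinear forms on the tangent space at `x`. -/
abbrev BilinForms (x : M) : Type _ :=
  TangentSpace 𝓘(ℝ, E) x →L[ℝ] TangentSpace 𝓘(ℝ, E) x →L[ℝ] ℝ

variable (E) in
/-- The bundle `W` of the symmetric elements of `T*M ⊗ T*M`. -/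
def symForms (x : M) : Set (BilinForms E x) :=
  {w | ∀ u v, w u v = w v u}

variable (cov : CovariantDerivative 𝓘(ℝ, E) E (TangentSpace 𝓘(ℝ, E) : M → Type _))

/-- The connection on `T*M ⊗ T*M` induced by a connection on `M`. -/
def tensorCov : CovariantDerivative 𝓘(ℝ, E) (E →L[ℝ] E →L[ℝ] ℝ)
    (fun x : M ↦ BilinForms E x) :=
  bilinCov cov

/-- `W̃`, the terminal subset of the derived flag of the bundle of symmetric bilinear forms. -/
def terminalForms (x : M) : Set (BilinForms E x) :=
  terminal (tensorCov cov) (symForms E) x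

/-- The connection is regular: `W̃` is a vector bundle over `M`. -/
def IsRegular : Prop :=
  ∀ x, IsBundleAt 𝓘(ℝ, E) (E →L[ℝ] E →L[ℝ] ℝ) (terminalForms cov) x

/-- `g` is a parallel (Riemannian) metric on `M`. -/
def IsParallelMetric
    (g : ContMDiffRiemannianMetric 𝓘(ℝ, E) ∞ E (TangentSpace 𝓘(ℝ, E) : M → Type _)) : Prop :=
  ParallelOn (tensorCov cov) g.inner univ

/-- The connection is metric: there is a parallel metric on `M`. -/
def IsMetric : Prop :=
  ∃ g, IsParallelMetric cov g

/-- The fibre at `x` of `W_S`, the bundle generated by the global parallel sections of `W`. -/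
def parallelSectionSpan (x : M) : Submodule ℝ (BilinForms E x) :=
  Submodule.span ℝ {w | ∃ s : ∀ y : M, BilinForms E y,
    SmoothOn 𝓘(ℝ, E) (E →L[ℝ] E →L[ℝ] ℝ) s univ ∧ (∀ y, s y ∈ symForms E y) ∧
    ParallelOn (tensorCov cov) s univ ∧ s x = w}

/-- The fibre at `x` of `W_M`, the bundle generated by the parallel metrics on `M`. -/
def parallelMetricSpan (x : M) : Submodule ℝ (BilinForms E x) :=
  Submodule.span ℝ {w | ∃ g, IsParallelMetric cov g ∧ g.inner x = w}

end Manifold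

end

end MetricConnection

/-! The terminal subset `W̃` lies in the kernel of the curvature, and since the flag has stopped
there, its second fundamental form vanishes. Where `W̃` is a bundle, the connection therefore
restricts to it and is flat, so that `W̃` has local frames of parallel sections
(`exists_parallel_frame`). The analytic core is the local solvability of a flat system `dA = αA`
(`exists_solution_of_flat`), obtained by integrating along rays.

A parallel metric `g` enters through the pairing `tr (g⁻¹ S g⁻¹ S')`, a scalar product on symmetric
forms that is locally constant on pairs of parallel sections (`metricPairing_eventually_const`).
Hence a parallel section of `W̃` that vanishes at one point of a connected open set vanishes on all
of it. Three things follow: transition matrices of parallel frames are locally constant, which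
yields `τ` and its uniqueness; evaluation at a point is injective on global parallel sections of
`W̃`; and the orthogonal complement in `W̃` of independent global parallel sections has parallel
frames as well.

Let `r` be the dimension of the space of global parallel sections of `W̃`. If `τ` comes from
`GL(m)`, then, after a locally constant change of frames, the first `n - m` members of the frames
agree on overlaps and glue to independent global sections, so `n - m ≤ r`
(`exists_sections_of_embed`). Conversely, `r` independent global sections, completed by parallel
frames of their orthogonal complement, have block diagonal transition matrices with an identity
block of size `r` (`exists_embed_of_sections`); without the complement they would only be block
triangular. So `τ` has rank `r` (`finrank_globalSections`).

A global parallel section of `W` is annihilated by the curvature and survives each step of the flag,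
hence lies in `W̃` (`curvature_eq_zero_of_parallel`, `mem_flag_of_parallel`). Thus `r` is the rank
of `W_S`. Finally `W_M = W_S` (`parallelMetricSpan_eq`): a parallel section `s` has constant norm on
the connected manifold, so `g + εs` is positive definite everywhere for one small `ε ≠ 0`, and `s`
is a combination of the parallel metrics `g + εs` and `g`. -/

namespace MetricConnection

noncomputable section

set_option linter.unusedSectionVars false

universe u

/-! ### Flat systems of linear differential equations -/

section FlatSystem

variable {E : Type*} [NormedAddCommGroup E] [NormedSpace ℝ E]
  {𝒜 : Type*} [NormedRing 𝒜] [NormedAlgebra ℝ 𝒜]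

/-- A linear differential equation on `[0, 1]` with small coefficient has a solution. -/
theorem exists_linear_ode_solution [CompleteSpace 𝒜] {c : ℝ → 𝒜} (hc : ContinuousOn c (Icc 0 1))
    {κ : ℝ} (hκ : κ * (1 + ‖(1 : 𝒜)‖) ≤ 1) (hb : ∀ t ∈ Icc (0 : ℝ) 1, ‖c t‖ ≤ κ) :
    ∃ y : ℝ → 𝒜, y 0 = 1 ∧ ∀ t ∈ Icc (0 : ℝ) 1, HasDerivWithinAt y (c t * y t) (Icc 0 1) t := by
  have h0 : (0 : ℝ) ∈ Icc (0 : ℝ) 1 := by simp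
  have hκ0 : 0 ≤ κ := (norm_nonneg _).trans (hb 0 h0)
  have hκ1 : κ ≤ 1 := by nlinarith [norm_nonneg (1 : 𝒜)]
  -- On the unit ball around `1` one has `‖x‖ ≤ 1 + ‖1‖`, so `hκ` bounds the field by `1` and a
  -- solution cannot leave this ball within unit time.
  have key : IsPicardLindelof (fun t y ↦ c t * y) (⟨0, h0⟩ : Icc (0 : ℝ) 1) (1 : 𝒜) 1 0 1 1 := by
    refine ⟨fun t ht ↦ ?_, fun x _ ↦ hc.mul continuousOn_const, fun t ht x hx ↦ ?_, by simp⟩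
    · refine LipschitzOnWith.of_dist_le_mul fun x _ y _ ↦ ?_
      rw [dist_eq_norm, dist_eq_norm, ← mul_sub]
      refine (norm_mul_le _ _).trans ?_
      exact mul_le_mul_of_nonneg_right ((hb t ht).trans hκ1) (norm_nonneg _)
    · rw [mem_closedBall_iff_norm] at hx
      have : ‖x‖ ≤ 1 + ‖(1 : 𝒜)‖ := by
        calc ‖x‖ = ‖(x - 1) + 1‖ := by simp
          _ ≤ ‖x - 1‖ + ‖(1 : 𝒜)‖ := norm_add_le _ _
          _ ≤ _ := by simpa using hx
      calc ‖c t * x‖ ≤ ‖c t‖ * ‖x‖ := norm_mul_le _ _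
        _ ≤ κ * (1 + ‖(1 : 𝒜)‖) := by gcongr; exact hb t ht
        _ ≤ _ := by simpa using hκ
  simpa using key.exists_eq_forall_mem_Icc_hasDerivWithinAt₀

/-- Along rays, the transport of a flat system depends on the end point through the system. -/
theorem hasFDerivAt_radial_transport {α : E → E →L[ℝ] 𝒜} {z₀ : E} {δ : ℝ}
    (hd : ∀ z ∈ Metric.ball z₀ δ, DifferentiableAt ℝ α z) {C K₁ K₂ : ℝ}
    (hC : ∀ z ∈ Metric.ball z₀ δ, ‖α z‖ ≤ C) (hCδ : C * δ ≤ 1)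
    (hK₁ : ∀ z ∈ Metric.ball z₀ δ, ∀ z' ∈ Metric.ball z₀ δ, ‖α z - α z'‖ ≤ K₁ * ‖z - z'‖)
    (hK₂ : ∀ z ∈ Metric.ball z₀ δ, ∀ z' ∈ Metric.ball z₀ δ,
      ‖fderiv ℝ α z - fderiv ℝ α z'‖ ≤ K₂ * ‖z - z'‖)
    (hflat : ∀ z ∈ Metric.ball z₀ δ, ∀ u v,
      fderiv ℝ α z u v - fderiv ℝ α z v u = α z u * α z v - α z v * α z u)
    {y : E → ℝ → 𝒜} (hy0 : ∀ z ∈ Metric.ball z₀ δ, y z 0 = 1)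
    (hy : ∀ z ∈ Metric.ball z₀ δ, ∀ t ∈ Icc (0 : ℝ) 1,
      HasDerivWithinAt (y z) (α (z₀ + t • (z - z₀)) (z - z₀) * y z t) (Icc 0 1) t)
    {z : E} (hz : z ∈ Metric.ball z₀ δ) :
    HasFDerivAt (fun z ↦ y z 1) ((ContinuousLinearMap.mul ℝ 𝒜).flip (y z 1) ∘L α z) z := by
  have hδ : 0 < δ := Metric.pos_of_mem_ball hz
  have hmem : ∀ z ∈ Metric.ball z₀ δ, ∀ t ∈ Icc (0 : ℝ) 1,
      z₀ + t • (z - z₀) ∈ Metric.ball z₀ δ := by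
    intro z hz t ht
    have := (convex_ball z₀ δ).add_smul_sub_mem (Metric.mem_ball_self hδ) hz ht
    simpa using this
  have hK1' : 0 ≤ |K₁| := abs_nonneg _
  have hC0 : 0 ≤ C := (norm_nonneg _).trans (hC z hz)
  obtain ⟨Y, hY⟩ : ∃ Y, ∀ t ∈ Icc (0 : ℝ) 1, ‖y z t‖ ≤ Y :=
    isCompact_Icc.exists_bound_of_continuousOn (fun t ht ↦ (hy z hz t ht).continuousWithinAt)
  have hY0 : 0 ≤ Y := (norm_nonneg _).trans (hY 0 (by simp))
  have hzδ : ‖z - z₀‖ ≤ δ := by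
    rw [mem_ball_iff_norm] at hz; exact hz.le
  -- the remainder
  set N : ℝ := (|K₂| * δ + |K₁|) * Y + (|K₁| * δ + C) * C * Y with hN
  have main : ∀ h : E, z + h ∈ Metric.ball z₀ δ →
      ‖y (z + h) 1 - y z 1 - α z h * y z 1‖ ≤ gronwallBound 0 1 (N * ‖h‖ ^ 2) 1 := by
    intro h hzh
    let p : ℝ → E := fun t ↦ z₀ + t • (z - z₀)
    let q : ℝ → E := fun t ↦ z₀ + t • (z + h - z₀)
    have hpq : ∀ t, q t = p t + t • h := by
      intro t; simp only [p, q]; module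
    have hp : ∀ t ∈ Icc (0 : ℝ) 1, p t ∈ Metric.ball z₀ δ := fun t ht ↦ hmem z hz t ht
    have hq : ∀ t ∈ Icc (0 : ℝ) 1, q t ∈ Metric.ball z₀ δ := fun t ht ↦ hmem _ hzh t ht
    let c : ℝ → 𝒜 := fun t ↦ α (p t) (z - z₀)
    let c' : ℝ → 𝒜 := fun t ↦ α (q t) (z + h - z₀)
    -- At `t = 1` this is the error of the claimed linear approximation. It vanishes at `t = 0`, and
    -- flatness will give `η' = c' η + O(‖h‖²)`, so that Gronwall's inequality applies.
    let η : ℝ → 𝒜 := fun t ↦ y (z + h) t - y z t - (t • α (p t) h) * y z t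
    let β : ℝ → 𝒜 := fun t ↦ α (p t) h + t • fderiv ℝ α (p t) (z - z₀) h
    let η' : ℝ → 𝒜 := fun t ↦ c' t * y (z + h) t - c t * y z t -
      (β t * y z t + (t • α (p t) h) * (c t * y z t))
    have hη : ∀ t ∈ Icc (0 : ℝ) 1, HasDerivWithinAt η (η' t) (Icc 0 1) t := by
      intro t ht
      have hp' : HasDerivAt p (z - z₀) t := by
        simpa [p] using ((hasDerivAt_id t).smul_const (z - z₀)).const_add z₀
      have hαp : HasDerivAt (fun t ↦ α (p t)) (fderiv ℝ α (p t) (z - z₀)) t :=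
        (hd _ (hp t ht)).hasFDerivAt.comp_hasDerivAt t hp'
      have hαh : HasDerivAt (fun t ↦ α (p t) h) (fderiv ℝ α (p t) (z - z₀) h) t := by
        simpa using hαp.clm_apply (hasDerivAt_const t h)
      have hβ : HasDerivAt (fun t ↦ t • α (p t) h) (β t) t := by
        have := (hasDerivAt_id t).smul hαh
        refine this.congr_deriv ?_
        simp [β, add_comm]
      exact ((hy _ hzh t ht).sub (hy z hz t ht)).sub (hβ.hasDerivWithinAt.mul (hy z hz t ht))
    have hη0 : η 0 = 0 := by simp [η, hy0 z hz, hy0 _ hzh]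
    have hbound : ∀ t ∈ Icc (0 : ℝ) 1, ‖η' t‖ ≤ 1 * ‖η t‖ + N * ‖h‖ ^ 2 := by
      intro t ht
      have ht1 : |t| ≤ 1 := by rw [abs_of_nonneg ht.1]; exact ht.2
      have hK2 : ‖α (q t) - α (p t) - fderiv ℝ α (p t) (t • h)‖ ≤ |K₂| * ‖h‖ ^ 2 := by
        have hseg : segment ℝ (p t) (q t) ⊆ Metric.ball z₀ δ :=
          (convex_ball z₀ δ).segment_subset (hp t ht) (hq t ht)
        have := Convex.norm_image_sub_le_of_norm_fderiv_le' (f := α) (φ := fderiv ℝ α (p t))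
          (C := |K₂| * ‖h‖) (s := segment ℝ (p t) (q t)) (x := p t) (y := q t)
          (fun x hx ↦ hd x (hseg hx)) (fun x hx ↦ ?_) (convex_segment _ _)
          (left_mem_segment _ _ _) (right_mem_segment _ _ _)
        · have hqp : q t - p t = t • h := by rw [hpq]; abel
          rw [hqp] at this
          refine this.trans ?_
          rw [norm_smul, Real.norm_eq_abs, sq, mul_assoc]
          gcongr
          nlinarith [norm_nonneg h]
        · refine (hK₂ x (hseg hx) _ (hp t ht)).trans ?_
          have hxp : ‖x - p t‖ ≤ ‖h‖ := by
            obtain ⟨a, ha, rfl⟩ := (segment_eq_image' ℝ (p t) (q t)) ▸ hx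
            rw [hpq]
            have : p t + a • (p t + t • h - p t) - p t = (a * t) • h := by module
            rw [this, norm_smul, Real.norm_eq_abs, abs_mul, abs_of_nonneg ha.1]
            have : a * |t| ≤ 1 := mul_le_one₀ ha.2 (abs_nonneg t) ht1
            nlinarith [norm_nonneg h]
          have h1 := le_abs_self K₂
          have h2 := abs_nonneg K₂
          nlinarith [norm_nonneg (x - p t)]
      have hK1 : ‖α (q t) - α (p t)‖ ≤ |K₁| * ‖h‖ := by
        refine (hK₁ _ (hq t ht) _ (hp t ht)).trans ?_
        have hqp : q t - p t = t • h := by rw [hpq]; abel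
        rw [hqp, norm_smul, Real.norm_eq_abs]
        have h1 := le_abs_self K₁
        calc K₁ * (|t| * ‖h‖) ≤ |K₁| * (|t| * ‖h‖) := by gcongr
          _ ≤ |K₁| * (1 * ‖h‖) := by gcongr
          _ = _ := by ring
      have hc' : ‖c' t‖ ≤ 1 := by
        refine ((α (q t)).le_opNorm _).trans ?_
        rw [mem_ball_iff_norm] at hzh
        calc ‖α (q t)‖ * ‖z + h - z₀‖ ≤ C * δ := by
              gcongr
              exact hC _ (hq t ht)
          _ ≤ 1 := hCδ
      -- algebraic form of the derivative
      have hfl : fderiv ℝ α (p t) (z - z₀) h =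
          fderiv ℝ α (p t) h (z - z₀) + c t * α (p t) h - α (p t) h * c t := by
        have := hflat _ (hp t ht) (z - z₀) h
        simp only [c]
        rw [add_sub_assoc, ← this]; abel
      have hc'c : c' t - c t =
          (α (q t) - α (p t)) (z - z₀) + α (q t) h := by
        simp only [c, c', sub_apply, map_sub, map_add]; abel
      -- Flatness, in the form `hfl`, exchanges the arguments of the derivative of `α`. The terms of
      -- first order in `h` then cancel; what is left is a Taylor remainder, a difference of `α`
      -- applied to `h`, and the product of `c' - c` with `t • α h`, all quadratic in `h`.
      have heq : η' t = c' t * η t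
          + ((α (q t) - α (p t) - fderiv ℝ α (p t) (t • h)) (z - z₀)
              + (α (q t) - α (p t)) h) * y z t
          + ((α (q t) - α (p t)) (z - z₀) + α (q t) h) * (t • α (p t) h) * y z t := by
        rw [← hc'c]
        have e1 : (α (q t) - α (p t) - fderiv ℝ α (p t) (t • h)) (z - z₀)
              + (α (q t) - α (p t)) h
            = c' t - c t - (t • fderiv ℝ α (p t) h (z - z₀) + α (p t) h) := by
          simp only [c, c', sub_apply, map_sub, map_add, map_smul, smul_sub,
            smul_apply, smul_sub]
          abel
        rw [e1]
        simp only [η', η, β, hfl]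
        simp only [mul_sub, sub_mul, add_mul, smul_add, smul_sub, smul_mul_assoc,
          mul_smul_comm, mul_assoc]
        abel
      have hN1 : ‖((α (q t) - α (p t) - fderiv ℝ α (p t) (t • h)) (z - z₀)
              + (α (q t) - α (p t)) h) * y z t‖ ≤ (|K₂| * δ + |K₁|) * Y * ‖h‖ ^ 2 := by
        refine (norm_mul_le _ _).trans ?_
        have h1 := (α (q t) - α (p t) - fderiv ℝ α (p t) (t • h)).le_opNorm (z - z₀)
        have h2 := (α (q t) - α (p t)).le_opNorm h
        calc _ ≤ (‖(α (q t) - α (p t) - fderiv ℝ α (p t) (t • h))‖ * ‖z - z₀‖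
              + ‖α (q t) - α (p t)‖ * ‖h‖) * ‖y z t‖ := by
              gcongr
              exact (norm_add_le _ _).trans (add_le_add h1 h2)
          _ ≤ (|K₂| * ‖h‖ ^ 2 * δ + |K₁| * ‖h‖ * ‖h‖) * Y := by
              gcongr
              exact hY t ht
          _ = _ := by ring
      have hN2 : ‖((α (q t) - α (p t)) (z - z₀) + α (q t) h) * (t • α (p t) h) * y z t‖
          ≤ (|K₁| * δ + C) * C * Y * ‖h‖ ^ 2 := by
        refine (norm_mul_le _ _).trans ?_
        have h1 := (α (q t) - α (p t)).le_opNorm (z - z₀)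
        have h2 := (α (q t)).le_opNorm h
        have h3 := (α (p t)).le_opNorm h
        have h4 : ‖t • α (p t) h‖ ≤ C * ‖h‖ := by
          rw [norm_smul, Real.norm_eq_abs]
          calc |t| * ‖α (p t) h‖ ≤ 1 * (‖α (p t)‖ * ‖h‖) := by gcongr
            _ ≤ 1 * (C * ‖h‖) := by gcongr; exact hC _ (hp t ht)
            _ = _ := by ring
        have h5 : ‖(α (q t) - α (p t)) (z - z₀) + α (q t) h‖ ≤ (|K₁| * δ + C) * ‖h‖ := by
          calc _ ≤ ‖α (q t) - α (p t)‖ * ‖z - z₀‖ + ‖α (q t)‖ * ‖h‖ :=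
                (norm_add_le _ _).trans (add_le_add h1 h2)
            _ ≤ |K₁| * ‖h‖ * δ + C * ‖h‖ := by
                gcongr
                exact hC _ (hq t ht)
            _ = _ := by ring
        calc _ ≤ (‖(α (q t) - α (p t)) (z - z₀) + α (q t) h‖ * ‖t • α (p t) h‖) * ‖y z t‖ := by
              gcongr; exact norm_mul_le _ _
          _ ≤ ((|K₁| * δ + C) * ‖h‖ * (C * ‖h‖)) * Y := by
              gcongr
              exact hY t ht
          _ = _ := by ring
      rw [heq]
      refine (norm_add₃_le).trans ?_
      have : ‖c' t * η t‖ ≤ 1 * ‖η t‖ :=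
        (norm_mul_le _ _).trans (mul_le_mul_of_nonneg_right hc' (norm_nonneg _))
      rw [hN]
      linarith
    have := norm_le_gronwallBound_of_norm_deriv_right_le (f := η) (f' := η') (δ := 0) (K := 1)
      (ε := N * ‖h‖ ^ 2) (a := 0) (b := 1) (fun t ht ↦ (hη t ht).continuousWithinAt)
      (fun t ht ↦ (hη t ⟨ht.1, ht.2.le⟩).mono_of_mem_nhdsWithin
        (Icc_mem_nhdsGE_of_mem ht)) (by simp [hη0])
      (fun t ht ↦ hbound t ⟨ht.1, ht.2.le⟩) 1 (by simp)
    simpa [η, p] using this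
  have hg : ∀ ε, gronwallBound 0 1 ε 1 = ε * (Real.exp 1 - 1) := by
    intro ε
    rw [gronwallBound_of_K_ne_0 one_ne_zero]; simp
  rw [hasFDerivAt_iff_isLittleO_nhds_zero]
  have hO : (fun h : E ↦ y (z + h) 1 - y z 1
      - ((ContinuousLinearMap.mul ℝ 𝒜).flip (y z 1) ∘L α z) h) =O[𝓝 0] fun h ↦ ‖h‖ ^ 2 := by
    refine Asymptotics.IsBigO.of_bound (N * (Real.exp 1 - 1)) ?_
    have : ∀ᶠ h in 𝓝 (0 : E), z + h ∈ Metric.ball z₀ δ := by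
      have : Filter.Tendsto (fun h : E ↦ z + h) (𝓝 0) (𝓝 z) := by
        have : Continuous (fun h : E ↦ z + h) := by fun_prop
        simpa using this.tendsto 0
      exact this (Metric.isOpen_ball.mem_nhds hz)
    filter_upwards [this] with h hh
    have := main h hh
    rw [hg] at this
    rw [Real.norm_of_nonneg (by positivity)]
    simpa [mul_right_comm] using this
  refine hO.trans_isLittleO ?_
  have := Asymptotics.isLittleO_pow_id (𝕜 := ℝ) one_lt_two |>.comp_tendsto
    (tendsto_norm_zero (E := E))
  exact (this.trans_isBigO (Asymptotics.isBigO_norm_left.2 (Asymptotics.isBigO_refl _ _)))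

/-- A flat system `dA = α A` of linear differential equations has local solutions. -/
theorem exists_solution_of_flat [CompleteSpace 𝒜] {α : E → E →L[ℝ] 𝒜} {s : Set E} (hs : IsOpen s)
    {z₀ : E} (hz₀ : z₀ ∈ s) (hα : ContDiffOn ℝ ∞ α s)
    (hflat : ∀ z ∈ s, ∀ u v,
      fderiv ℝ α z u v - fderiv ℝ α z v u = α z u * α z v - α z v * α z u) :
    ∃ t ⊆ s, IsOpen t ∧ z₀ ∈ t ∧ ∃ A : E → 𝒜, ContDiffOn ℝ ∞ A t ∧ A z₀ = 1 ∧
      ∀ z ∈ t, HasFDerivAt A ((ContinuousLinearMap.mul ℝ 𝒜).flip (A z) ∘L α z) z := by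
  have hα₀ : ContDiffAt ℝ ∞ α z₀ := hα.contDiffAt (hs.mem_nhds hz₀)
  obtain ⟨K₁, t₁, ht₁, hK₁⟩ := (hα₀.of_le (m := 1) (by simp)).exists_lipschitzOnWith
  obtain ⟨K₂, t₂, ht₂, hK₂⟩ :=
    (hα₀.fderiv_right (m := 1) (by norm_num; exact ENat.LEInfty.out)).exists_lipschitzOnWith
  have ht₃ : {z | ‖α z‖ < ‖α z₀‖ + 1} ∈ 𝓝 z₀ :=
    hα₀.continuousAt.norm.eventually_lt continuousAt_const (by simp)
  obtain ⟨δ₁, hδ₁, hsub⟩ := Metric.mem_nhds_iff.1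
    (Filter.inter_mem (hs.mem_nhds hz₀) (Filter.inter_mem ht₁ (Filter.inter_mem ht₂ ht₃)))
  set C := ‖α z₀‖ + 1
  have hCpos : 0 < C := by positivity
  -- On the ball of this radius the coefficient `α (·) (z - z₀)` of the equation along a ray is at
  -- most `C * δ`, the smallness that `exists_linear_ode_solution` asks for.
  set δ := min δ₁ (1 / (C * (1 + ‖(1 : 𝒜)‖)))
  have hδ : 0 < δ := by positivity
  have hCδ : C * δ * (1 + ‖(1 : 𝒜)‖) ≤ 1 := by
    have : δ ≤ 1 / (C * (1 + ‖(1 : 𝒜)‖)) := min_le_right _ _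
    rw [le_div_iff₀ (by positivity)] at this
    linarith
  have hCδ1 : C * δ ≤ 1 := by
    have : 0 ≤ C * δ * ‖(1 : 𝒜)‖ := by positivity
    linarith
  have hb : Metric.ball z₀ δ ⊆ s ∩ (t₁ ∩ (t₂ ∩ {z | ‖α z‖ < C})) :=
    (Metric.ball_subset_ball (min_le_left _ _)).trans hsub
  have hmem : ∀ z ∈ Metric.ball z₀ δ, ∀ t ∈ Icc (0 : ℝ) 1,
      z₀ + t • (z - z₀) ∈ Metric.ball z₀ δ := by
    intro z hz t ht
    have := (convex_ball z₀ δ).add_smul_sub_mem (Metric.mem_ball_self hδ) hz ht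
    simpa using this
  -- The candidate is `A z = y z 1`, the transport of `1` along the ray from `z₀` to `z`.
  have hy : ∀ z : E, ∃ y : ℝ → 𝒜, z ∈ Metric.ball z₀ δ → y 0 = 1 ∧ ∀ t ∈ Icc (0 : ℝ) 1,
      HasDerivWithinAt y (α (z₀ + t • (z - z₀)) (z - z₀) * y t) (Icc 0 1) t := by
    intro z
    by_cases hz : z ∈ Metric.ball z₀ δ
    · have hcont : ContinuousOn (fun t : ℝ ↦ α (z₀ + t • (z - z₀)) (z - z₀)) (Icc 0 1) := by
        refine ContinuousOn.clm_apply ?_ continuousOn_const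
        refine (hα.continuousOn.mono fun x hx ↦ (hb hx).1).comp (t := Metric.ball z₀ δ) ?_
          (fun t ht ↦ hmem z hz t ht)
        fun_prop
      obtain ⟨y, hy⟩ := exists_linear_ode_solution hcont hCδ fun t ht ↦ by
        refine ((α _).le_opNorm _).trans ?_
        have h2 : ‖z - z₀‖ < δ := by rwa [mem_ball_iff_norm] at hz
        have h1 : ‖α (z₀ + t • (z - z₀))‖ < C := (hb (hmem z hz t ht)).2.2.2
        gcongr
      exact ⟨y, fun _ ↦ hy⟩
    · exact ⟨0, fun h ↦ absurd h hz⟩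
  choose y hy using hy
  have hder : ∀ z ∈ Metric.ball z₀ δ, HasFDerivAt (fun z ↦ y z 1)
      ((ContinuousLinearMap.mul ℝ 𝒜).flip (y z 1) ∘L α z) z := by
    intro z hz
    refine hasFDerivAt_radial_transport (α := α) (z₀ := z₀) (δ := δ) (C := C) (K₁ := K₁) (K₂ := K₂)
      (fun z hz ↦ ?_) (fun z hz ↦ ?_) hCδ1 ?_ ?_ ?_ (fun z hz ↦ (hy z hz).1)
      (fun z hz ↦ (hy z hz).2) hz
    · exact (hα.contDiffAt (hs.mem_nhds (hb hz).1)).differentiableAt (by simp)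
    · have : ‖α z‖ < C := (hb hz).2.2.2
      exact this.le
    · intro z hz z' hz'
      simpa [dist_eq_norm] using hK₁.dist_le_mul z (hb hz).2.1 z' (hb hz').2.1
    · intro z hz z' hz'
      simpa [dist_eq_norm] using hK₂.dist_le_mul z (hb hz).2.2.1 z' (hb hz').2.2.1
    · exact fun z hz ↦ hflat z (hb hz).1
  refine ⟨Metric.ball z₀ δ, fun z hz ↦ (hb hz).1, Metric.isOpen_ball, Metric.mem_ball_self hδ,
    fun z ↦ y z 1, ?_, ?_, hder⟩
  -- Bootstrapping: the derivative of `A` is expressed by `α` and `A`, so each order of smoothness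
  -- of `A` gives the next.
  · rw [contDiffOn_infty]
    intro k
    induction k with
    | zero => exact contDiffOn_zero.2 fun z hz ↦ (hder z hz).continuousAt.continuousWithinAt
    | succ k ih =>
      push_cast
      rw [contDiffOn_succ_iff_fderiv_of_isOpen Metric.isOpen_ball]
      refine ⟨fun z hz ↦ (hder z hz).differentiableAt.differentiableWithinAt, by simp, ?_⟩
      have : ContDiffOn ℝ k (fun z ↦ (ContinuousLinearMap.mul ℝ 𝒜).flip (y z 1) ∘L α z)
          (Metric.ball z₀ δ) := by
        refine ContDiffOn.clm_comp ?_ ((hα.mono fun z hz ↦ (hb hz).1).of_le (by exact_mod_cast le_top))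
        exact (ContinuousLinearMap.contDiff _).comp_contDiffOn ih
      exact this.congr fun z hz ↦ (hder z hz).fderiv
  -- The ray to the centre is constant, so its equation has coefficient zero.
  · have h0 := hy z₀ (Metric.mem_ball_self hδ)
    have := constant_of_derivWithin_zero (f := y z₀) (a := 0) (b := 1)
      (fun t ht ↦ (h0.2 t ht).differentiableWithinAt)
      (fun t ht ↦ by
        have := (h0.2 t ⟨ht.1, ht.2.le⟩).derivWithin (uniqueDiffOn_Icc_zero_one t ⟨ht.1, ht.2.le⟩)
        simpa using this) 1 (by simp)
    exact this.trans h0.1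

end FlatSystem

/-! ### Connections on trivial bundles over open subsets of normed spaces -/

section Model

variable {E : Type*} [NormedAddCommGroup E] [NormedSpace ℝ E]
  {F : Type*} [NormedAddCommGroup F] [NormedSpace ℝ F]

/-- The covariant derivative `∂X + L X` of a function `X`. -/
def modelCov (L : E → E →L[ℝ] F →L[ℝ] F) (X : E → F) (z : E) : E →L[ℝ] F :=
  fderiv ℝ X z + (L z).flip (X z)

/-- The curvature of the connection `∂ + L`. -/
def modelCurv (L : E → E →L[ℝ] F →L[ℝ] F) (z u v : E) : F →L[ℝ] F :=
  fderiv ℝ L z u v - fderiv ℝ L z v u + L z u ∘L L z v - L z v ∘L L z u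

theorem modelCov_apply (L : E → E →L[ℝ] F →L[ℝ] F) (X : E → F) (z u : E) :
    modelCov L X z u = fderiv ℝ X z u + L z u (X z) := rfl

theorem fderiv_modelCov {L : E → E →L[ℝ] F →L[ℝ] F} {X : E → F} {V : E → E} {z : E}
    (hL : DifferentiableAt ℝ L z) (hX : ContDiffAt ℝ 2 X z) (hV : DifferentiableAt ℝ V z) (u : E) :
    DifferentiableAt ℝ (fun z ↦ modelCov L X z (V z)) z ∧
    fderiv ℝ (fun z ↦ modelCov L X z (V z)) z u =
      fderiv ℝ (fderiv ℝ X) z u (V z) + fderiv ℝ X z (fderiv ℝ V z u) +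
      (fderiv ℝ L z u (V z) (X z) + L z (fderiv ℝ V z u) (X z) +
        L z (V z) (fderiv ℝ X z u)) := by
  have h1 : HasFDerivAt (fderiv ℝ X) (fderiv ℝ (fderiv ℝ X) z) z :=
    ((hX.fderiv_right (m := 1) (by norm_num)).differentiableAt (by simp)).hasFDerivAt
  have h2 : HasFDerivAt X (fderiv ℝ X z) z := (hX.differentiableAt (by simp)).hasFDerivAt
  have h3 := (h1.clm_apply hV.hasFDerivAt).add
    ((hL.hasFDerivAt.clm_apply hV.hasFDerivAt).clm_apply h2)
  refine ⟨h3.differentiableAt, ?_⟩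
  have := h3.fderiv
  change fderiv ℝ (fun z ↦ modelCov L X z (V z)) z = _ at this
  rw [this]
  simp
  abel

/-- The second derivatives of `X` cancel by symmetry, and the derivatives of `U` and `V` are
absorbed by the bracket. Only terms of order zero in `X`, `U`, `V` remain. -/
theorem modelCov_commutator {L : E → E →L[ℝ] F →L[ℝ] F} {X : E → F} {U V : E → E} {z : E}
    (hL : DifferentiableAt ℝ L z) (hX : ContDiffAt ℝ 2 X z) (hU : DifferentiableAt ℝ U z)
    (hV : DifferentiableAt ℝ V z) :
    modelCov L (fun z ↦ modelCov L X z (V z)) z (U z)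
      - modelCov L (fun z ↦ modelCov L X z (U z)) z (V z)
      - modelCov L X z (fderiv ℝ V z (U z) - fderiv ℝ U z (V z))
      = modelCurv L z (U z) (V z) (X z) := by
  have hsymm := (hX.isSymmSndFDerivAt (by simp)).eq (U z) (V z)
  rw [modelCov_apply L (fun z ↦ modelCov L X z (V z)),
    modelCov_apply L (fun z ↦ modelCov L X z (U z)), modelCov_apply L X z (_ - _),
    (fderiv_modelCov hL hX hU _).2, (fderiv_modelCov hL hX hV _).2, hsymm]
  simp only [modelCov_apply, modelCurv, map_sub, map_add, sub_apply, add_apply,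
    ContinuousLinearMap.comp_apply]
  abel

variable [FiniteDimensional ℝ F]
  {N : Type*} [NormedAddCommGroup N] [NormedSpace ℝ N] [FiniteDimensional ℝ N]

/-- A smooth family of injective maps has a smooth family of left inverses, locally. -/
theorem exists_smooth_leftInverse {T : Set E} (hT : IsOpen T)
    {Ξ : E → N →L[ℝ] F} (hΞ : ContDiffOn ℝ ∞ Ξ T) {z₀ : E} (hz₀ : z₀ ∈ T)
    (hinj : Function.Injective (Ξ z₀)) :
    ∃ t ⊆ T, IsOpen t ∧ z₀ ∈ t ∧ ∃ Q : E → F →L[ℝ] N, ContDiffOn ℝ ∞ Q t ∧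
      ∀ z ∈ t, ∀ c, Q z (Ξ z c) = c := by
  obtain ⟨P, hP⟩ := (Ξ z₀).toLinearMap.exists_leftInverse_of_injective
    (LinearMap.ker_eq_bot.2 hinj)
  let P' : F →L[ℝ] N := LinearMap.toContinuousLinearMap P
  -- `G` is the identity at `z₀`, hence invertible nearby, and `G⁻¹ P'` is the desired left inverse.
  let G : E → N →L[ℝ] N := fun z ↦ P' ∘L Ξ z
  have hG : ContDiffOn ℝ ∞ G T := contDiffOn_const.clm_comp hΞ
  have hG0 : G z₀ = 1 := by
    ext1 c
    exact LinearMap.congr_fun hP c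
  let t := T ∩ G ⁻¹' {x | IsUnit x}
  have ht : IsOpen t := hG.continuousOn.isOpen_inter_preimage hT Units.isOpen
  refine ⟨t, inter_subset_left, ht, ⟨hz₀, by simp [hG0]⟩,
    fun z ↦ Ring.inverse (G z) ∘L P', ?_, ?_⟩
  · refine ContDiffOn.clm_comp ?_ contDiffOn_const
    intro z hz
    obtain ⟨x, hx⟩ := hz.2
    have h1 := contDiffAt_ringInverse ℝ (n := ∞) x
    rw [hx] at h1
    exact h1.comp_contDiffWithinAt z ((hG z hz.1).mono inter_subset_left)
  · intro z hz c
    have := Ring.inverse_mul_cancel (G z) hz.2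
    exact congrArg (fun f : N →L[ℝ] N ↦ f c) this

set_option synthInstance.maxHeartbeats 200000 in
/-- A flat invariant subbundle has parallel frames. -/
theorem exists_parallel_frame_model {T : Set E} (hT : IsOpen T)
    {L : E → E →L[ℝ] F →L[ℝ] F} (hL : ContDiffOn ℝ ∞ L T)
    {Ξ : E → N →L[ℝ] F} (hΞ : ContDiffOn ℝ ∞ Ξ T)
    (hinj : ∀ z ∈ T, Function.Injective (Ξ z))
    (hinv : ∀ z ∈ T, ∀ u c, modelCov L (fun z ↦ Ξ z c) z u ∈ range (Ξ z))
    (hcurv : ∀ z ∈ T, ∀ u v c, modelCurv L z u v (Ξ z c) = 0) {z₀ : E} (hz₀ : z₀ ∈ T) :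
    ∃ t ⊆ T, IsOpen t ∧ z₀ ∈ t ∧ ∃ A : E → N →L[ℝ] N, ContDiffOn ℝ ∞ A t ∧
      (∀ z ∈ t, IsUnit (A z)) ∧ ∀ z ∈ t, ∀ c, modelCov L (fun z ↦ Ξ z (A z c)) z = 0 := by
  obtain ⟨s, hsT, hs, hz₀s, Q, hQ, hQΞ⟩ := exists_smooth_leftInverse hT hΞ hz₀ (hinj z₀ hz₀)
  -- `DΞ` is the covariant derivative of the frame, and `-θ` its connection matrix: `Ξ θ = -DΞ` by
  -- invariance. Hence `Ξ A` is parallel as soon as `dA = θ A`.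
  let DΞ : E → E →L[ℝ] N →L[ℝ] F := fun z ↦
    fderiv ℝ Ξ z + ((ContinuousLinearMap.compL ℝ N F F).flip (Ξ z)) ∘L L z
  let θ : E → E →L[ℝ] N →L[ℝ] N := fun z ↦
    (ContinuousLinearMap.compL ℝ N F N (-Q z)) ∘L DΞ z
  have hdΞ : ∀ z ∈ s, HasFDerivAt Ξ (fderiv ℝ Ξ z) z := fun z hz ↦
    ((hΞ.contDiffAt (hT.mem_nhds (hsT hz))).differentiableAt (by simp)).hasFDerivAt
  have hDΞ : ∀ z ∈ s, ∀ u c, DΞ z u c = modelCov L (fun z ↦ Ξ z c) z u := by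
    intro z hz u c
    rw [modelCov_apply, ((hdΞ z hz).clm_apply (hasFDerivAt_const c z)).fderiv]
    simp [DΞ]
  have hΞθ : ∀ z ∈ s, ∀ u c, Ξ z (θ z u c) = -DΞ z u c := by
    intro z hz u c
    obtain ⟨d, hd⟩ := hinv z (hsT hz) u c
    rw [← hDΞ z hz] at hd
    change Ξ z (-Q z (DΞ z u c)) = _
    rw [← hd, hQΞ z hz, map_neg]
  have hθ : ContDiffOn ℝ ∞ θ s := by
    refine ContDiffOn.clm_comp ((ContinuousLinearMap.contDiff _).comp_contDiffOn hQ.neg) ?_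
    refine ContDiffOn.add ?_ (ContDiffOn.clm_comp
      ((ContinuousLinearMap.contDiff _).comp_contDiffOn (hΞ.mono hsT)) (hL.mono hsT))
    exact ((contDiffOn_infty_iff_fderiv_of_isOpen hs).1 (hΞ.mono hsT)).2
  have hdθ : ∀ z ∈ s, DifferentiableAt ℝ θ z := fun z hz ↦
    (hθ.contDiffAt (hs.mem_nhds hz)).differentiableAt (by simp)
  have hdd : ∀ z ∈ s, ∀ u v c, modelCov L (fun z ↦ modelCov L (fun z ↦ Ξ z c) z v) z u
      = Ξ z (θ z u (θ z v c)) - Ξ z (fderiv ℝ θ z u v c) := by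
    intro z hz u v c
    have heq : (fun z ↦ modelCov L (fun z ↦ Ξ z c) z v) =ᶠ[𝓝 z] fun z ↦ -Ξ z (θ z v c) := by
      filter_upwards [hs.mem_nhds hz] with y hy
      rw [hΞθ y hy, neg_neg, hDΞ y hy]
    have h1 := (hdΞ z hz).clm_apply (((hdθ z hz).hasFDerivAt.clm_apply
      (hasFDerivAt_const v z)).clm_apply (hasFDerivAt_const c z))
    rw [modelCov_apply, heq.fderiv_eq, h1.fun_neg.fderiv, hΞθ z hz u,
      show modelCov L (fun z ↦ Ξ z c) z v = _ from heq.self_of_nhds]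
    simp [DΞ]
    abel
  -- The integrability condition for `θ`: constant fields `u`, `v` have bracket zero, so by `hdd`
  -- the vanishing curvature on `Ξ c` is `Ξ` applied to the flatness defect of `θ`, and `Ξ` is
  -- injective.
  obtain ⟨t, hts, ht, hz₀t, A, hA, hA0, hdA⟩ := exists_solution_of_flat
    (𝒜 := N →L[ℝ] N) hs hz₀s (α := θ) hθ (by
      intro z hz u v
      ext1 c
      apply hinj z (hsT hz)
      have h := modelCov_commutator (L := L) (X := fun z ↦ Ξ z c) (U := fun _ ↦ u)
        (V := fun _ ↦ v) (z := z)
        ((hL.contDiffAt (hT.mem_nhds (hsT hz))).differentiableAt (by simp))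
        (((hΞ.contDiffAt (hT.mem_nhds (hsT hz))).clm_apply contDiffAt_const).of_le
          (ENat.LEInfty.out)) (by fun_prop) (by fun_prop)
      rw [hcurv z (hsT hz), hdd z hz, hdd z hz] at h
      change Ξ z (fderiv ℝ θ z u v c - fderiv ℝ θ z v u c) =
        Ξ z (θ z u (θ z v c) - θ z v (θ z u c))
      simp only [fderiv_fun_const, Pi.zero_apply, zero_apply, sub_zero, map_zero] at h
      simp only [map_sub]
      rw [← sub_eq_zero]
      rw [← neg_eq_zero, ← h]
      abel)
  let t' := t ∩ A ⁻¹' {x | IsUnit x}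
  have ht' : IsOpen t' := hA.continuousOn.isOpen_inter_preimage ht Units.isOpen
  refine ⟨t', fun z hz ↦ hsT (hts hz.1), ht', ⟨hz₀t, by simp [hA0]⟩, A,
    hA.mono inter_subset_left, fun z hz ↦ hz.2, fun z hz c ↦ ?_⟩
  have hzs := hts hz.1
  have h1 := (hdΞ z hzs).clm_apply ((hdA z hz.1).clm_apply (hasFDerivAt_const c z))
  ext1 u
  have h2 := hΞθ z hzs u (A z c)
  rw [modelCov_apply, h1.fderiv]
  simp only [DΞ] at h2
  simp at h2 ⊢
  rw [h2]
  abel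

end Model

/-! ### The inner product that a scalar product induces on bilinear forms -/

section TracePairing

variable {V : Type*} [AddCommGroup V] [Module ℝ V] [TopologicalSpace V] [IsTopologicalAddGroup V]
  [ContinuousSMul ℝ V]

/-- `G` is a scalar product. -/
structure IsPosDef (G : V →L[ℝ] V →L[ℝ] ℝ) : Prop where
  symm : ∀ u v, G u v = G v u
  pos : ∀ v, v ≠ 0 → 0 < G v v

variable {G : V →L[ℝ] V →L[ℝ] ℝ}

theorem IsPosDef.eq_of_forall (hG : IsPosDef G) {v w : V} (h : ∀ b, G v b = G w b) : v = w := by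
  by_contra hne
  have := hG.pos (v - w) (sub_ne_zero.2 hne)
  have h2 := h (v - w)
  have h3 : G (v - w) (v - w) = G v (v - w) - G w (v - w) := by rw [map_sub G v w, sub_apply]
  linarith

theorem IsPosDef.nonneg (hG : IsPosDef G) (v : V) : 0 ≤ G v v := by
  rcases eq_or_ne v 0 with rfl | h
  · simp
  · exact (hG.pos v h).le

/-- A bilinear form as a map to the dual space. -/
def formToDual : (V →L[ℝ] V →L[ℝ] ℝ) →ₗ[ℝ] V →ₗ[ℝ] Module.Dual ℝ V where
  toFun G :=
    { toFun := fun v ↦ (G v).toLinearMap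
      map_add' := fun v w ↦ by ext; simp
      map_smul' := fun c v ↦ by ext; simp }
  map_add' G G' := rfl
  map_smul' c G := rfl

theorem IsPosDef.formToDual_injective (hG : IsPosDef G) : Function.Injective (formToDual G) :=
  fun _ _ h ↦ hG.eq_of_forall fun b ↦ LinearMap.congr_fun h b

variable [FiniteDimensional ℝ V]

/-- The endomorphism `A` with `G (A v) w = S v w`. -/
def IsPosDef.sharp (hG : IsPosDef G) : (V →L[ℝ] V →L[ℝ] ℝ) →ₗ[ℝ] V →ₗ[ℝ] V where
  toFun S := (LinearEquiv.ofInjectiveOfFinrankEq (formToDual G) hG.formToDual_injective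
    Subspace.dual_finrank_eq.symm).symm.toLinearMap ∘ₗ formToDual S
  map_add' S S' := by ext; simp
  map_smul' c S := by ext; simp

theorem IsPosDef.sharp_spec (hG : IsPosDef G) (S : V →L[ℝ] V →L[ℝ] ℝ) (v w : V) :
    G (hG.sharp S v) w = S v w := by
  have := (LinearEquiv.ofInjectiveOfFinrankEq (formToDual G) hG.formToDual_injective
    Subspace.dual_finrank_eq.symm).apply_symm_apply (formToDual S v)
  exact LinearMap.congr_fun this w

theorem IsPosDef.eq_sharp (hG : IsPosDef G) {S : V →L[ℝ] V →L[ℝ] ℝ} {A : V →ₗ[ℝ] V}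
    (h : ∀ v w, G (A v) w = S v w) : A = hG.sharp S := by
  ext v
  exact hG.eq_of_forall fun w ↦ by rw [h, hG.sharp_spec]

/-- The pairing `tr (G⁻¹ S G⁻¹ S')` of bilinear forms. -/
def IsPosDef.pairing (hG : IsPosDef G) : LinearMap.BilinForm ℝ (V →L[ℝ] V →L[ℝ] ℝ) :=
  LinearMap.mk₂ ℝ (fun S S' ↦ LinearMap.trace ℝ V (hG.sharp S * hG.sharp S'))
    (by intros; simp [add_mul]) (by intros; simp) (by intros; simp [mul_add]) (by intros; simp)

theorem IsPosDef.pairing_apply (hG : IsPosDef G) (S S' : V →L[ℝ] V →L[ℝ] ℝ) :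
    hG.pairing S S' = LinearMap.trace ℝ V (hG.sharp S * hG.sharp S') := rfl

theorem IsPosDef.pairing_comm (hG : IsPosDef G) (S S' : V →L[ℝ] V →L[ℝ] ℝ) :
    hG.pairing S S' = hG.pairing S' S :=
  LinearMap.trace_mul_comm ℝ _ _

/-- An orthogonal basis is enough; leaving it unnormalised only puts the denominators `G (b i) (b
i)` into the coordinates. -/
theorem IsPosDef.exists_basis (hG : IsPosDef G) :
    ∃ b : Module.Basis (Fin (Module.finrank ℝ V)) ℝ V, (∀ i j, i ≠ j → G (b i) (b j) = 0) ∧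
      ∀ (v : V) i, b.repr v i = G v (b i) / G (b i) (b i) := by
  obtain ⟨b, hb⟩ := LinearMap.BilinForm.exists_orthogonal_basis
    (B := formToDual G) ⟨fun v w ↦ hG.symm v w⟩
  have hb' : ∀ i j, i ≠ j → G (b i) (b j) = 0 := fun i j hij ↦ hb hij
  refine ⟨b, hb', fun v i ↦ ?_⟩
  have hpos := hG.pos (b i) (b.ne_zero i)
  rw [eq_div_iff hpos.ne']
  conv_rhs => rw [← b.sum_repr v]
  simp only [map_sum, map_smul, sum_apply, smul_apply, smul_eq_mul]
  rw [Finset.sum_eq_single i (fun j _ hj ↦ by rw [hb' j i hj, mul_zero]) (by simp)]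

/-- For symmetric `S` the endomorphism `hG.sharp S` is self-adjoint, so the trace of its square is a
weighted sum of squared lengths. Definiteness of the pairing on symmetric forms rests on this. -/
theorem IsPosDef.pairing_self (hG : IsPosDef G) {S : V →L[ℝ] V →L[ℝ] ℝ} (hS : ∀ u v, S u v = S v u)
    {b : Module.Basis (Fin (Module.finrank ℝ V)) ℝ V}
    (hb : ∀ (v : V) i, b.repr v i = G v (b i) / G (b i) (b i)) :
    hG.pairing S S = ∑ i, G (hG.sharp S (b i)) (hG.sharp S (b i)) / G (b i) (b i) := by
  rw [hG.pairing_apply, LinearMap.trace_eq_matrix_trace ℝ b, Matrix.trace]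
  refine Finset.sum_congr rfl fun i _ ↦ ?_
  rw [Matrix.diag_apply, LinearMap.toMatrix_apply, hb, Module.End.mul_apply, hG.sharp_spec, hS,
    ← hG.sharp_spec S (b i)]

theorem IsPosDef.pairing_self_nonneg (hG : IsPosDef G) {S : V →L[ℝ] V →L[ℝ] ℝ}
    (hS : ∀ u v, S u v = S v u) : 0 ≤ hG.pairing S S := by
  obtain ⟨b, -, hb⟩ := hG.exists_basis
  rw [hG.pairing_self hS hb]
  exact Finset.sum_nonneg fun i _ ↦ div_nonneg (hG.nonneg _) (hG.nonneg _)

theorem IsPosDef.eq_zero_of_pairing_self (hG : IsPosDef G) {S : V →L[ℝ] V →L[ℝ] ℝ}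
    (hS : ∀ u v, S u v = S v u) (h : hG.pairing S S = 0) : S = 0 := by
  obtain ⟨b, -, hb⟩ := hG.exists_basis
  rw [hG.pairing_self hS hb, Finset.sum_eq_zero_iff_of_nonneg
    fun i _ ↦ div_nonneg (hG.nonneg _) (hG.nonneg _)] at h
  have hA : hG.sharp S = 0 := by
    refine b.ext fun i ↦ ?_
    by_contra hne
    have h1 := h i (Finset.mem_univ i)
    have h2 := hG.pos _ hne
    have h3 := hG.pos _ (b.ne_zero i)
    exact (div_pos h2 h3).ne' h1
  ext v w
  rw [← hG.sharp_spec, hA]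
  simp

/-- The Cauchy–Schwarz inequality for `S` and the rank one form `r = G v ⊗ G v`, since `⟨S, r⟩ = S v
v` and `⟨r, r⟩ = (G v v)²`. It turns a bound on the norm of a parallel form into a bound against the
metric. -/
theorem IsPosDef.sq_le (hG : IsPosDef G) {S : V →L[ℝ] V →L[ℝ] ℝ} (hS : ∀ u v, S u v = S v u)
    (v : V) : S v v ^ 2 ≤ hG.pairing S S * G v v ^ 2 := by
  rcases eq_or_ne v 0 with rfl | hv
  · simp
  let r : V →L[ℝ] V →L[ℝ] ℝ := (G v).smulRight (G v)
  have hr : ∀ a b, r a b = G v a * G v b := fun a b ↦ by simp [r]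
  have hrs : ∀ a b, r a b = r b a := fun a b ↦ by rw [hr, hr, mul_comm]
  have hsr : hG.sharp r = LinearMap.smulRight (G v).toLinearMap v := by
    refine (hG.eq_sharp fun a b ↦ ?_).symm
    simp [hr]
  have hpair : ∀ S' : V →L[ℝ] V →L[ℝ] ℝ, hG.pairing S' r = S' v v := by
    intro S'
    have : hG.sharp S' * hG.sharp r =
        LinearMap.smulRight (G v).toLinearMap (hG.sharp S' v) := by
      ext a; simp [hsr]
    rw [hG.pairing_apply, this, LinearMap.trace_smulRight]
    change G v (hG.sharp S' v) = _
    rw [hG.symm, hG.sharp_spec]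
  have hg := hG.pos v hv
  -- This combination is the component of `S` orthogonal to `r`, multiplied by `⟨r, r⟩` to avoid a
  -- division.
  have h := hG.pairing_self_nonneg (S := G v v ^ 2 • S + (-(S v v)) • r) fun a b ↦ by
    change G v v ^ 2 * S a b + -(S v v) * r a b = G v v ^ 2 * S b a + -(S v v) * r b a
    rw [hS a b, hrs a b]
  have e : hG.pairing (G v v ^ 2 • S + (-(S v v)) • r) (G v v ^ 2 • S + (-(S v v)) • r) =
      G v v ^ 2 * (hG.pairing S S * G v v ^ 2 - S v v ^ 2) := by
    simp only [LinearMap.BilinForm.add_left, LinearMap.BilinForm.add_right,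
      LinearMap.BilinForm.smul_left, LinearMap.BilinForm.smul_right, hpair,
      hG.pairing_comm r S]
    have hv' : (G v v ^ 2 • S + (-(S v v)) • r) v v = 0 := by
      change G v v ^ 2 * S v v + -(S v v) * r v v = 0
      rw [hr]
      ring
    rw [hv']
    ring
  rw [e] at h
  have := nonneg_of_mul_nonneg_right h (by positivity)
  linarith

theorem IsPosDef.comp (hG : IsPosDef G) {V' : Type*} [AddCommGroup V'] [Module ℝ V']
    [TopologicalSpace V'] [IsTopologicalAddGroup V'] [ContinuousSMul ℝ V'] (τ : V' ≃L[ℝ] V)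
    {G' : V' →L[ℝ] V' →L[ℝ] ℝ} (h : ∀ a b, G' a b = G (τ a) (τ b)) : IsPosDef G' where
  symm u v := by rw [h, h, hG.symm]
  pos v hv := by rw [h]; exact hG.pos _ (by simpa using hv)

/-- The isometry `τ` conjugates the endomorphisms, and the trace is invariant under conjugation.
This allows the pairing of a metric to be computed in a chart. -/
theorem IsPosDef.pairing_comp (hG : IsPosDef G) {V' : Type*} [AddCommGroup V'] [Module ℝ V']
    [TopologicalSpace V'] [IsTopologicalAddGroup V'] [ContinuousSMul ℝ V'] [FiniteDimensional ℝ V']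
    (τ : V' ≃L[ℝ] V) {G' S₁ S₂ : V' →L[ℝ] V' →L[ℝ] ℝ} (hG' : IsPosDef G')
    {T₁ T₂ : V →L[ℝ] V →L[ℝ] ℝ}
    (h : ∀ a b, G' a b = G (τ a) (τ b)) (h₁ : ∀ a b, S₁ a b = T₁ (τ a) (τ b))
    (h₂ : ∀ a b, S₂ a b = T₂ (τ a) (τ b)) :
    hG'.pairing S₁ S₂ = hG.pairing T₁ T₂ := by
  have key : ∀ {S : V' →L[ℝ] V' →L[ℝ] ℝ} {T : V →L[ℝ] V →L[ℝ] ℝ},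
      (∀ a b, S a b = T (τ a) (τ b)) →
      hG'.sharp S = τ.symm.toLinearEquiv.conj (hG.sharp T) := by
    intro S T hST
    refine (hG'.eq_sharp fun a b ↦ ?_).symm
    rw [h, hST]
    simp [LinearEquiv.conj_apply, hG.sharp_spec]
  rw [pairing_apply, pairing_apply, key h₁, key h₂, ← LinearMap.trace_conj' _
    τ.symm.toLinearEquiv]
  congr 1
  exact (LinearEquiv.conj_comp _ _ _).symm

end TracePairing

/-! ### Infinitesimal invariance of the trace pairing -/

section TracePairingDeriv

variable {E : Type*} [NormedAddCommGroup E] [NormedSpace ℝ E] [FiniteDimensional ℝ E]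

open Classical in
/-- The pairing `tr (G⁻¹ S G⁻¹ S')`, with the value `0` if `G` is not a scalar product. -/
def trPair (G S S' : E →L[ℝ] E →L[ℝ] ℝ) : ℝ :=
  if hG : IsPosDef G then hG.pairing S S' else 0

set_option synthInstance.maxHeartbeats 200000 in
/-- The derivative of `G⁻¹ S` for fields `G`, `S` of forms that are parallel with respect to the
connection with the Christoffel symbol `Γ`. -/
theorem hasFDerivAt_sharp {T : Set E} (hT : IsOpen T) {G S : E → E →L[ℝ] E →L[ℝ] ℝ}
    (hG : ∀ z ∈ T, IsPosDef (G z)) {z : E} (hz : z ∈ T) (hdG : DifferentiableAt ℝ G z)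
    (hdS : DifferentiableAt ℝ S z) {Γ : E →L[ℝ] E →L[ℝ] E}
    (hGΓ : ∀ u a b, fderiv ℝ G z u a b = G z (Γ u a) b + G z a (Γ u b))
    (hSΓ : ∀ u a b, fderiv ℝ S z u a b = S z (Γ u a) b + S z a (Γ u b)) :
    ∃ (A : E → E →L[ℝ] E) (A' : E →L[ℝ] E →L[ℝ] E), HasFDerivAt A A' z ∧
      (∀ y (hy : y ∈ T), (A y).toLinearMap = (hG y hy).sharp (S y)) ∧
      ∀ u, A' u = A z ∘L Γ u - Γ u ∘L A z := by
  have hbij : ∀ y ∈ T, ∃ e : E ≃L[ℝ] (E →L[ℝ] ℝ), (e : E →L[ℝ] (E →L[ℝ] ℝ)) = G y := by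
    intro y hy
    have hinj : Function.Injective (G y) := fun v w h ↦
      (hG y hy).eq_of_forall fun b ↦ by rw [h]
    have hfin : Module.finrank ℝ E = Module.finrank ℝ (E →L[ℝ] ℝ) := by
      rw [← (LinearMap.toContinuousLinearMap (𝕜 := ℝ) (E := E) (F' := ℝ)).finrank_eq]
      exact Subspace.dual_finrank_eq.symm
    refine ⟨(LinearEquiv.ofInjectiveOfFinrankEq (G y).toLinearMap hinj
      hfin).toContinuousLinearEquiv, ?_⟩
    ext v w
    rfl
  -- `inverse` has the value `0` at maps that are not invertible; `hbij` rules this out on `T`.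
  let A : E → E →L[ℝ] E := fun y ↦ (G y).inverse ∘L S y
  have hGA : ∀ y ∈ T, ∀ v, G y (A y v) = S y v := by
    intro y hy v
    obtain ⟨e, he⟩ := hbij y hy
    simp only [A, ContinuousLinearMap.comp_apply]
    rw [← he, ContinuousLinearMap.inverse_equiv]
    simp
  have hA : DifferentiableAt ℝ A z := by
    obtain ⟨e, he⟩ := hbij z hz
    have h1 : DifferentiableAt ℝ ContinuousLinearMap.inverse (G z) := by
      rw [← he]
      exact (contDiffAt_map_inverse (n := 1) e).differentiableAt (by simp)
    exact (DifferentiableAt.fun_comp' z h1 hdG).clm_comp hdS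
  refine ⟨A, fderiv ℝ A z, hA.hasFDerivAt, fun y hy ↦ (hG y hy).eq_sharp fun v w ↦ ?_, fun u ↦ ?_⟩
  · exact congrArg (fun f : E →L[ℝ] ℝ ↦ f w) (hGA y hy v)
  · ext1 v
    refine (hG z hz).eq_of_forall fun w ↦ ?_
    -- Differentiating `G (A v) w = S v w` and eliminating the derivatives of `G` and `S` by means
    -- of `Γ` leaves a commutator: the two terms `G (A v) (Γ u w)` cancel.
    have heq : (fun y ↦ G y (A y v) w) =ᶠ[𝓝 z] fun y ↦ S y v w := by
      filter_upwards [hT.mem_nhds hz] with y hy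
      rw [hGA y hy]
    have h1 := (hdG.hasFDerivAt.clm_apply (hA.hasFDerivAt.clm_apply
      (hasFDerivAt_const v z))).clm_apply (hasFDerivAt_const w z)
    have h2 := (hdS.hasFDerivAt.clm_apply (hasFDerivAt_const v z)).clm_apply (hasFDerivAt_const w z)
    have h3 := congrArg (fun f : E →L[ℝ] ℝ ↦ f u) (heq.fderiv_eq (𝕜 := ℝ))
    rw [h1.fderiv, h2.fderiv] at h3
    simp at h3
    rw [hGΓ, hSΓ, ← hGA z hz, ← hGA z hz] at h3
    simp only [sub_apply, map_sub, ContinuousLinearMap.comp_apply]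
    linarith

/-- The endomorphisms `A = G⁻¹ S` and `B = G⁻¹ S'` have the commutators with `Γ u` as derivatives,
hence so has `A B`, and the trace of a commutator is zero. -/
theorem hasFDerivAt_trPair {T : Set E} (hT : IsOpen T) {G S S' : E → E →L[ℝ] E →L[ℝ] ℝ}
    (hG : ∀ z ∈ T, IsPosDef (G z)) {z : E} (hz : z ∈ T) (hdG : DifferentiableAt ℝ G z)
    (hdS : DifferentiableAt ℝ S z) (hdS' : DifferentiableAt ℝ S' z) {Γ : E →L[ℝ] E →L[ℝ] E}
    (hGΓ : ∀ u a b, fderiv ℝ G z u a b = G z (Γ u a) b + G z a (Γ u b))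
    (hSΓ : ∀ u a b, fderiv ℝ S z u a b = S z (Γ u a) b + S z a (Γ u b))
    (hSΓ' : ∀ u a b, fderiv ℝ S' z u a b = S' z (Γ u a) b + S' z a (Γ u b)) :
    HasFDerivAt (fun y ↦ trPair (G y) (S y) (S' y)) (0 : E →L[ℝ] ℝ) z := by
  obtain ⟨A, dA, hA, hAs, hAΓ⟩ := hasFDerivAt_sharp hT hG hz hdG hdS hGΓ hSΓ
  obtain ⟨B, dB, hB, hBs, hBΓ⟩ := hasFDerivAt_sharp hT hG hz hdG hdS' hGΓ hSΓ'
  let tr : (E →L[ℝ] E) →L[ℝ] ℝ := LinearMap.toContinuousLinearMap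
    (LinearMap.trace ℝ E ∘ₗ ContinuousLinearMap.coeLM ℝ)
  have htr : ∀ f : E →L[ℝ] E, tr f = LinearMap.trace ℝ E f.toLinearMap := fun f ↦ rfl
  have heq : (fun y ↦ trPair (G y) (S y) (S' y)) =ᶠ[𝓝 z] fun y ↦ tr (A y ∘L B y) := by
    filter_upwards [hT.mem_nhds hz] with y hy
    rw [trPair, dif_pos (hG y hy), IsPosDef.pairing_apply, ← hAs y hy, ← hBs y hy]
    rfl
  refine HasFDerivAt.congr_of_eventuallyEq ?_ heq
  have h := tr.hasFDerivAt.comp z (hA.clm_comp hB)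
  refine h.congr_fderiv ?_
  ext1 u
  have hcomm : ∀ f g : E →L[ℝ] E, tr (f ∘L g) = tr (g ∘L f) := fun f g ↦
    LinearMap.trace_mul_comm ℝ f.toLinearMap g.toLinearMap
  have h1 := hcomm (Γ u) (A z ∘L B z)
  simp only [ContinuousLinearMap.comp_apply, add_apply, ContinuousLinearMap.compL_apply,
    ContinuousLinearMap.flip_apply, hAΓ, hBΓ, map_add, map_sub, ContinuousLinearMap.comp_assoc, zero_apply] at h1 ⊢
  linarith

end TracePairingDeriv

/-! ### Sections in charts -/

section SectionRep

variable {E : Type*} [NormedAddCommGroup E] [NormedSpace ℝ E]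
  {M : Type*} [TopologicalSpace M] [ChartedSpace E M] [IsManifold 𝓘(ℝ, E) ∞ M]
  {F : Type*} [NormedAddCommGroup F] [NormedSpace ℝ F]
  {V : M → Type*} [TopologicalSpace (TotalSpace F V)]
  [∀ x, AddCommGroup (V x)] [∀ x, Module ℝ (V x)] [∀ x : M, TopologicalSpace (V x)]
  [∀ x, IsTopologicalAddGroup (V x)] [∀ x, ContinuousSMul ℝ (V x)]
  [FiberBundle F V] [VectorBundle ℝ F V]

/-- A section in the trivialization at `p` and the chart at `p`. -/
def rep (F : Type*) [NormedAddCommGroup F] [NormedSpace ℝ F] {V : M → Type*}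
    [TopologicalSpace (TotalSpace F V)] [∀ x : M, TopologicalSpace (V x)]
    [FiberBundle F V] (p : M) (X : ∀ y, V y) (z : E) : F :=
  (trivializationAt F V p ⟨(extChartAt 𝓘(ℝ, E) p).symm z, X ((extChartAt 𝓘(ℝ, E) p).symm z)⟩).2

theorem rep_apply {p y : M} (hy : y ∈ (chartAt E p).source) (X : ∀ y, V y) :
    rep F p X (extChartAt 𝓘(ℝ, E) p y) = (trivializationAt F V p ⟨y, X y⟩).2 := by
  rw [rep, (extChartAt 𝓘(ℝ, E) p).left_inv (by simpa using hy)]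

theorem differentiableAt_comp_extChartAt_symm {p y : M} (hy : y ∈ (chartAt E p).source)
    {f : M → F} :
    MDiffAt f y ↔
      DifferentiableAt ℝ (f ∘ (extChartAt 𝓘(ℝ, E) p).symm) (extChartAt 𝓘(ℝ, E) p y) := by
  have hy' : y ∈ (extChartAt 𝓘(ℝ, E) p).source := by simpa using hy
  have hs : MDiffAt (extChartAt 𝓘(ℝ, E) p).symm (extChartAt 𝓘(ℝ, E) p y) :=
    ((contMDiffOn_extChartAt_symm (n := ∞) p).contMDiffAt
      ((isOpen_extChartAt_target p).mem_nhds ((extChartAt 𝓘(ℝ, E) p).map_source hy'))).mdifferentiableAt (by simp)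
  have hc : MDiffAt (extChartAt 𝓘(ℝ, E) p) y :=
    (contMDiffAt_extChartAt' (n := ∞) hy).mdifferentiableAt (by simp)
  constructor
  · intro h
    rw [← mdifferentiableAt_iff_differentiableAt]
    refine MDifferentiableAt.comp _ ?_ hs
    rwa [(extChartAt 𝓘(ℝ, E) p).left_inv hy']
  · intro h
    rw [← mdifferentiableAt_iff_differentiableAt] at h
    refine (h.comp y hc).congr_of_eventuallyEq ?_
    filter_upwards [extChartAt_source_mem_nhds' hy'] with x hx
    exact congrArg f ((extChartAt 𝓘(ℝ, E) p).left_inv hx).symm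

theorem contMDiffOn_iff_comp_extChartAt_symm {p : M} {U : Set M} (hU : U ⊆ (chartAt E p).source)
    {f : M → F} :
    ContMDiffOn 𝓘(ℝ, E) 𝓘(ℝ, F) ∞ f U ↔
      ContDiffOn ℝ ∞ (f ∘ (extChartAt 𝓘(ℝ, E) p).symm)
        ((extChartAt 𝓘(ℝ, E) p).target ∩ (extChartAt 𝓘(ℝ, E) p).symm ⁻¹' U) := by
  rw [← contMDiffOn_iff_contDiffOn]
  constructor
  · intro h
    exact h.comp ((contMDiffOn_extChartAt_symm p).mono inter_subset_left) inter_subset_right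
  · intro h
    have h2 := h.comp ((contMDiffOn_extChartAt (I := 𝓘(ℝ, E)) (n := ∞) (x := p)).mono hU) fun x hx ↦ ?_
    · refine h2.congr fun x hx ↦ ?_
      have hx' : x ∈ (extChartAt 𝓘(ℝ, E) p).source := by simpa using hU hx
      exact congrArg f ((extChartAt 𝓘(ℝ, E) p).left_inv hx').symm
    · have hx' : x ∈ (extChartAt 𝓘(ℝ, E) p).source := by simpa using hU hx
      exact ⟨(extChartAt 𝓘(ℝ, E) p).map_source hx', by
        rwa [mem_preimage, (extChartAt 𝓘(ℝ, E) p).left_inv hx']⟩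

theorem isOpen_extChartAt_target_inter (p : M) {U : Set M} (hU : IsOpen U) :
    IsOpen ((extChartAt 𝓘(ℝ, E) p).target ∩ (extChartAt 𝓘(ℝ, E) p).symm ⁻¹' U) :=
  (continuousOn_extChartAt_symm p).isOpen_inter_preimage (isOpen_extChartAt_target p) hU

variable [ContMDiffVectorBundle ∞ F V 𝓘(ℝ, E)]

theorem mdifferentiableAt_iff_rep {p y : M}
    (hb : (chartAt E p).source ⊆ (trivializationAt F V p).baseSet)
    (hy : y ∈ (chartAt E p).source) {X : ∀ y, V y} :
    MDiffAt (T% X) y ↔ DifferentiableAt ℝ (rep F p X) (extChartAt 𝓘(ℝ, E) p y) := by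
  have : ContMDiffVectorBundle 1 F V 𝓘(ℝ, E) := ContMDiffVectorBundle.of_le (n := ∞) (by simp)
  rw [(trivializationAt F V p).mdifferentiableAt_section_iff 𝓘(ℝ, E) X (hb hy),
    differentiableAt_comp_extChartAt_symm hy]
  rfl

theorem smoothOn_iff_rep {p : M} {U : Set M}
    (hb : (chartAt E p).source ⊆ (trivializationAt F V p).baseSet)
    (hU : U ⊆ (chartAt E p).source) (hUo : IsOpen U) {X : ∀ y, V y} :
    SmoothOn 𝓘(ℝ, E) F X U ↔ ContDiffOn ℝ ∞ (rep F p X)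
      ((extChartAt 𝓘(ℝ, E) p).target ∩ (extChartAt 𝓘(ℝ, E) p).symm ⁻¹' U) := by
  rw [SmoothOn, (trivializationAt F V p).contMDiffOn_section_iff hUo (hU.trans hb),
    contMDiffOn_iff_comp_extChartAt_symm hU]
  rfl

theorem SmoothOn.mdifferentiableAt {X : ∀ y, V y} {U : Set M} (h : SmoothOn 𝓘(ℝ, E) F X U)
    (hU : IsOpen U) {y : M} (hy : y ∈ U) : MDiffAt (T% X) y :=
  (ContMDiffOn.contMDiffAt h (hU.mem_nhds hy)).mdifferentiableAt (by simp)

/-- A smooth section over an open set agrees near each of its points with a global section. -/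
theorem exists_global_section [FiniteDimensional ℝ E] [T2Space M] {X : ∀ y, V y} {U : Set M}
    (hU : IsOpen U) (h : SmoothOn 𝓘(ℝ, E) F X U) {y : M} (hy : y ∈ U) :
    ∃ Y : ∀ y, V y, SmoothOn 𝓘(ℝ, E) F Y univ ∧ ∀ᶠ x in 𝓝 y, Y x = X x := by
  obtain ⟨ψ, -, hψ⟩ := (SmoothBumpFunction.nhds_basis_tsupport (I := 𝓘(ℝ, E)) y).mem_iff.1
    (hU.mem_nhds hy)
  refine ⟨(ψ : M → ℝ) • X, ?_, ?_⟩
  · have := ContMDiffOn.smul_section_of_tsupport (I := 𝓘(ℝ, E)) (n := ∞) (ψ := ψ)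
      (ψ.contMDiff.contMDiffOn) hU hψ h
    exact this.contMDiffOn
  · filter_upwards [ψ.eventuallyEq_one] with x hx
    simp [hx]

end SectionRep

/-! ### The induced connection on bilinear forms in charts -/

section Christoffel

variable {E : Type*} [NormedAddCommGroup E] [NormedSpace ℝ E]
  {M : Type u} [TopologicalSpace M] [ChartedSpace E M] [IsManifold 𝓘(ℝ, E) ∞ M]

theorem source_subset_baseSet_tangent (p : M) : (chartAt E p).source ⊆
    (trivializationAt E (TangentSpace 𝓘(ℝ, E) : M → Type _) p).baseSet :=
  subset_rfl

theorem source_subset_baseSet_bilin (p : M) : (chartAt E p).source ⊆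
    (trivializationAt (E →L[ℝ] E →L[ℝ] ℝ) (BilinForms E : M → Type _) p).baseSet :=
  fun _ h ↦ ⟨h, h, mem_univ _⟩

/-- The vector at `y` with the given components in the chart at `p`. -/
def chartVec (p y : M) : E →L[ℝ] TangentSpace 𝓘(ℝ, E) y :=
  (trivializationAt E (TangentSpace 𝓘(ℝ, E) : M → Type _) p).symmL ℝ y

/-- `chartVec` as an isomorphism. -/
def chartVecEquiv {p y : M} (hy : y ∈ (chartAt E p).source) : E ≃L[ℝ] TangentSpace 𝓘(ℝ, E) y :=
  ((trivializationAt E (TangentSpace 𝓘(ℝ, E) : M → Type _) p).continuousLinearEquivAt ℝ y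
    (source_subset_baseSet_tangent p hy)).symm

theorem chartVecEquiv_apply {p y : M} (hy : y ∈ (chartAt E p).source) (a : E) :
    chartVecEquiv hy a = chartVec p y a := by
  rw [chartVecEquiv, chartVec, Trivialization.symm_continuousLinearEquivAt_eq]

/-- The coordinates of a bilinear form at `y` in the chart at `p`. -/
def chartForm (p y : M) (w : BilinForms E y) : E →L[ℝ] E →L[ℝ] ℝ :=
  (trivializationAt (E →L[ℝ] E →L[ℝ] ℝ) (BilinForms E : M → Type _) p ⟨y, w⟩).2

theorem chartForm_apply {p y : M} (hy : y ∈ (chartAt E p).source) (w : BilinForms E y) (a b : E) :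
    chartForm p y w a b = w (chartVec p y a) (chartVec p y b) := by
  rw [chartForm, hom_trivializationAt_apply]
  erw [inCoordinates_apply_eq₂ (source_subset_baseSet_tangent p hy)
    (source_subset_baseSet_tangent p hy) (mem_univ _)]
  simp only [chartVec, Trivial.fiberBundle_trivializationAt', Trivial.linearMapAt_trivialization,
    LinearMap.id_coe, id_eq]
  rw [Trivialization.symmL_apply _ (source_subset_baseSet_tangent p hy),
    Trivialization.symmL_apply _ (source_subset_baseSet_tangent p hy)]

theorem chartForm_injective {p y : M} (hy : y ∈ (chartAt E p).source) (w w' : BilinForms E y)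
    (h : chartForm p y w = chartForm p y w') : w = w' := by
  ext u v
  obtain ⟨a, rfl⟩ := (chartVecEquiv hy).surjective u
  obtain ⟨b, rfl⟩ := (chartVecEquiv hy).surjective v
  have := congrArg (fun f : E →L[ℝ] E →L[ℝ] ℝ ↦ f a b) h
  simpa only [chartForm_apply hy, chartVecEquiv_apply] using this

/-- The coordinates of a bilinear form, as a linear isomorphism. -/
def chartFormEquiv {p y : M} (hy : y ∈ (chartAt E p).source) :
    BilinForms E y ≃ₗ[ℝ] (E →L[ℝ] E →L[ℝ] ℝ) :=
  LinearEquiv.ofBijective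
    { toFun := chartForm p y
      map_add' := fun w w' ↦ by
        ext a b
        simp only [chartForm_apply hy, add_apply]
      map_smul' := fun c w ↦ by
        ext a b
        simp only [chartForm_apply hy, smul_apply, RingHom.id_apply] }
    ⟨fun w w' h ↦ chartForm_injective hy w w' h, fun H ↦ by
      let e : TangentSpace 𝓘(ℝ, E) y →L[ℝ] E := (chartVecEquiv hy).symm
      have he : ∀ a, e (chartVec p y a) = a := fun a ↦ by
        rw [← chartVecEquiv_apply hy]
        exact (chartVecEquiv hy).symm_apply_apply a
      refine ⟨(ContinuousLinearMap.precomp ℝ e) ∘L H ∘L e, ?_⟩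
      ext a b
      change chartForm p y _ a b = _
      rw [chartForm_apply hy]
      change H (e (chartVec p y a)) (e (chartVec p y b)) = _
      rw [he, he]⟩

theorem chartFormEquiv_apply {p y : M} (hy : y ∈ (chartAt E p).source) (w : BilinForms E y) :
    chartFormEquiv hy w = chartForm p y w := rfl

theorem rep_bilin_apply {p y : M} (hy : y ∈ (chartAt E p).source) (s : ∀ y : M, BilinForms E y) :
    rep (E →L[ℝ] E →L[ℝ] ℝ) p s (extChartAt 𝓘(ℝ, E) p y) = chartForm p y (s y) := by
  rw [rep_apply hy]
  rfl

theorem mvfderiv_chartVec {F : Type*} [NormedAddCommGroup F] [NormedSpace ℝ F]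
    {p y : M} (hy : y ∈ (chartAt E p).source) {f : M → F} (hf : MDiffAt f y) (u : E) :
    mvfderiv 𝓘(ℝ, E) f y (chartVec p y u) =
      fderiv ℝ (f ∘ (extChartAt 𝓘(ℝ, E) p).symm) (extChartAt 𝓘(ℝ, E) p y) u := by
  have hy' : y ∈ (extChartAt 𝓘(ℝ, E) p).source := by simpa using hy
  have hs : MDiffAt (extChartAt 𝓘(ℝ, E) p).symm (extChartAt 𝓘(ℝ, E) p y) :=
    ((contMDiffOn_extChartAt_symm (n := ∞) p).contMDiffAt
      ((isOpen_extChartAt_target p).mem_nhds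
        ((extChartAt 𝓘(ℝ, E) p).map_source hy'))).mdifferentiableAt (by simp)
  rw [← mfderiv_eq_fderiv]
  rw [chartVec, TangentBundle.symmL_trivializationAt hy]
  have hf' : MDiffAt f ((extChartAt 𝓘(ℝ, E) p).symm (extChartAt 𝓘(ℝ, E) p y)) := by
    rwa [(extChartAt 𝓘(ℝ, E) p).left_inv hy']
  rw [mfderiv_comp (I' := 𝓘(ℝ, E)) _ hf' hs]
  simp only [modelWithCornersSelf_coe, range_id, mfderivWithin_univ]
  rw [(extChartAt 𝓘(ℝ, E) p).left_inv hy']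
  rfl

end Christoffel

/-! ### Christoffel symbols and their smoothness -/

section ChristoffelSymbols

variable {E : Type*} [NormedAddCommGroup E] [NormedSpace ℝ E] [FiniteDimensional ℝ E]
  {M : Type u} [TopologicalSpace M] [ChartedSpace E M] [IsManifold 𝓘(ℝ, E) ∞ M]
  (cov : CovariantDerivative 𝓘(ℝ, E) E (TangentSpace 𝓘(ℝ, E) : M → Type _))

theorem rep_chartVec {p y : M} (hy : y ∈ (chartAt E p).source) (a : E) :
    rep E p (fun y ↦ chartVec p y a : ∀ y : M, TangentSpace 𝓘(ℝ, E) y)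
      (extChartAt 𝓘(ℝ, E) p y) = a := by
  rw [rep_apply hy, chartVec, Trivialization.symmL_apply _ (source_subset_baseSet_tangent p hy)]
  exact Trivialization.apply_mk_symm _ (source_subset_baseSet_tangent p hy) a |>.symm ▸ rfl

theorem chartVec_rep {p y : M} (hy : y ∈ (chartAt E p).source)
    (X : ∀ y : M, TangentSpace 𝓘(ℝ, E) y) :
    chartVec p y (rep E p X (extChartAt 𝓘(ℝ, E) p y)) = X y := by
  rw [rep_apply hy, chartVec, Trivialization.symmL_apply _ (source_subset_baseSet_tangent p hy)]
  exact Trivialization.symm_apply_apply_mk _ (source_subset_baseSet_tangent p hy) _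

theorem smoothOn_chartVec (p : M) (a : E) :
    SmoothOn 𝓘(ℝ, E) E (fun y ↦ chartVec p y a : ∀ y : M, TangentSpace 𝓘(ℝ, E) y)
      (chartAt E p).source := by
  rw [smoothOn_iff_rep (source_subset_baseSet_tangent p) subset_rfl (chartAt E p).open_source]
  refine contDiffOn_const (c := a) |>.congr fun z hz ↦ ?_
  have h := rep_chartVec hz.2 a
  rwa [(extChartAt 𝓘(ℝ, E) p).right_inv hz.1] at h

theorem mdifferentiableAt_chartVec {p y : M} (hy : y ∈ (chartAt E p).source) (a : E) :
    MDiffAt (T% (fun y ↦ chartVec p y a : ∀ y : M, TangentSpace 𝓘(ℝ, E) y)) y :=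
  (smoothOn_chartVec p a).mdifferentiableAt (chartAt E p).open_source hy

open Classical in
/-- The Christoffel symbols of the connection in the chart at `p`. -/
def christoffel (p : M) (z : E) : E →L[ℝ] E →L[ℝ] E :=
  if hz : (extChartAt 𝓘(ℝ, E) p).symm z ∈ (chartAt E p).source then
    LinearMap.toContinuousLinearMap
    { toFun u := LinearMap.toContinuousLinearMap
        { toFun a := (chartVecEquiv hz).symm (cov (fun y ↦ chartVec p y a) _ (chartVec p _ u))
          map_add' a b := by
            have h := cov.isCovariantDerivativeOn.add (mdifferentiableAt_chartVec hz a)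
              (mdifferentiableAt_chartVec hz b)
            rw [← map_add, ← add_apply]
            congr 2
            rw [← h]
            congr 1
            ext y
            simp
          map_smul' c a := by
            have h := cov.isCovariantDerivativeOn.smul_const c (mdifferentiableAt_chartVec hz a)
            rw [RingHom.id_apply, ← map_smul, ← smul_apply]
            congr 2
            rw [← h]
            congr 1
            ext y
            simp }
      map_add' u v := by
        ext a
        change (chartVecEquiv hz).symm (cov (fun y ↦ chartVec p y a) _ (chartVec p _ (u + v))) = _
        rw [map_add, map_add, map_add]
        rfl
      map_smul' c u := by
        ext a
        change (chartVecEquiv hz).symm (cov (fun y ↦ chartVec p y a) _ (chartVec p _ (c • u))) = _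
        rw [map_smul, map_smul, map_smul]
        rfl }
  else 0

theorem chartVec_christoffel {p y : M} (hy : y ∈ (chartAt E p).source) (u a : E) :
    chartVec p y (christoffel cov p (extChartAt 𝓘(ℝ, E) p y) u a) =
      cov (fun y ↦ chartVec p y a) y (chartVec p y u) := by
  have hy' := (extChartAt 𝓘(ℝ, E) p).left_inv (x := y) (by simpa using hy)
  obtain ⟨z, hz, rfl⟩ : ∃ z, extChartAt 𝓘(ℝ, E) p y = z ∧ (extChartAt 𝓘(ℝ, E) p).symm z = y :=
    ⟨_, rfl, hy'⟩
  rw [hz, christoffel, dif_pos hy, ← chartVecEquiv_apply hy]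
  exact (chartVecEquiv hy).apply_symm_apply _

theorem contDiffOn_christoffel [T2Space M] [CovariantDerivative.ContMDiffCovariantDerivative cov ∞]
    (p : M) : ContDiffOn ℝ ∞ (christoffel cov p) (extChartAt 𝓘(ℝ, E) p).target := by
  rw [contDiffOn_clm_apply]
  intro u
  rw [contDiffOn_clm_apply]
  intro a
  have hX : SmoothOn 𝓘(ℝ, E) E
      (fun y ↦ cov (fun y ↦ chartVec p y a) y (chartVec p y u) : ∀ y : M, TangentSpace 𝓘(ℝ, E) y)
      (chartAt E p).source := by
    intro y hy
    -- The smoothness assumption on `cov` speaks of sections that are smooth on all of `M`. The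
    -- coordinate field is therefore replaced by a global field with the same germ at `y`, which
    -- does not change the covariant derivative near `y`.
    obtain ⟨Y, hY, hYX⟩ := exists_global_section (chartAt E p).open_source
      (smoothOn_chartVec p a) hy
    have h1 := CovariantDerivative.ContMDiffCovariantDerivative.contMDiff (cov := cov) (k := ∞)
    have h2 := h1.contMDiff (σ := Y) hY
    have h3 := ContMDiffOn.contMDiffAt h2 Filter.univ_mem (x := y)
    have h4 := ContMDiffOn.contMDiffAt (smoothOn_chartVec p u)
      ((chartAt E p).open_source.mem_nhds hy)
    have h5 := h3.clm_bundle_apply h4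
    refine ContMDiffAt.contMDiffWithinAt (h5.congr_of_eventuallyEq ?_)
    filter_upwards [hYX.eventually_nhds, (chartAt E p).open_source.mem_nhds hy] with x hx hxs
    have : cov (fun y ↦ chartVec p y a) x = cov Y x :=
      cov.isCovariantDerivativeOnUniv.congr_of_eventuallyEq (mdifferentiableAt_chartVec hxs a)
        (SmoothOn.mdifferentiableAt hY isOpen_univ (mem_univ x)) Filter.univ_mem
        (hx.mono fun _ h ↦ h.symm)
    rw [this]
  rw [smoothOn_iff_rep (source_subset_baseSet_tangent p) subset_rfl (chartAt E p).open_source] at hX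
  have hX' : ContDiffOn ℝ ∞ _ (extChartAt 𝓘(ℝ, E) p).target := hX.mono fun z hz ↦
    ⟨hz, by simpa using (extChartAt 𝓘(ℝ, E) p).map_target hz⟩
  refine hX'.congr fun z hz ↦ ?_
  have hy : (extChartAt 𝓘(ℝ, E) p).symm z ∈ (chartAt E p).source := by
    simpa using (extChartAt 𝓘(ℝ, E) p).map_target hz
  have h1 := chartVec_christoffel cov hy u a
  have h2 := chartVec_rep hy
    (fun y ↦ cov (fun y ↦ chartVec p y a) y (chartVec p y u) : ∀ y : M, TangentSpace 𝓘(ℝ, E) y)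
  rw [(extChartAt 𝓘(ℝ, E) p).right_inv hz] at h1 h2
  rw [← h2] at h1
  simp only [← chartVecEquiv_apply hy] at h1
  exact (chartVecEquiv hy).injective h1

end ChristoffelSymbols

/-! ### The infinitesimal action on bilinear forms -/

section FormSymbol

variable {E : Type*} [NormedAddCommGroup E] [NormedSpace ℝ E]

/-- Shortcut instance, only to speed up instance search. -/
instance normedAddCommGroupForms : NormedAddCommGroup (E →L[ℝ] E →L[ℝ] ℝ) :=
  ContinuousLinearMap.toNormedAddCommGroup

/-- Shortcut instance, only to speed up instance search. -/
instance normedSpaceForms : NormedSpace ℝ (E →L[ℝ] E →L[ℝ] ℝ) :=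
  ContinuousLinearMap.toNormedSpace

variable (E) in
/-- The (infinitesimal) action of endomorphisms on bilinear forms. -/
def formAction : (E →L[ℝ] E) →L[ℝ] (E →L[ℝ] E →L[ℝ] ℝ) →L[ℝ] (E →L[ℝ] E →L[ℝ] ℝ) :=
  (-1 : ℝ) • ((ContinuousLinearMap.compL ℝ E E (E →L[ℝ] ℝ)).flip +
    (ContinuousLinearMap.compL ℝ E (E →L[ℝ] ℝ) (E →L[ℝ] ℝ)) ∘L
      (ContinuousLinearMap.compL ℝ E E ℝ).flip)

theorem formAction_apply (g : E →L[ℝ] E) (H : E →L[ℝ] E →L[ℝ] ℝ) (a b : E) :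
    formAction E g H a b = -(H (g a) b) - H a (g b) := by
  change (-1 : ℝ) * (H (g a) b + H a (g b)) = _
  ring

end FormSymbol

/-! ### The induced connection in a chart as `∂ + L` -/

section ChartFormulas

variable {E : Type*} [NormedAddCommGroup E] [NormedSpace ℝ E] [FiniteDimensional ℝ E]
  {M : Type u} [TopologicalSpace M] [ChartedSpace E M] [IsManifold 𝓘(ℝ, E) ∞ M]
  (cov : CovariantDerivative 𝓘(ℝ, E) E (TangentSpace 𝓘(ℝ, E) : M → Type _))

/-- The connection form on bilinear forms in the chart at `p`. -/
def formSymbol (p : M) (z : E) : E →L[ℝ] (E →L[ℝ] E →L[ℝ] ℝ) →L[ℝ] (E →L[ℝ] E →L[ℝ] ℝ) :=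
  formAction E ∘L christoffel cov p z

theorem formSymbol_apply (p : M) (z u : E) (H : E →L[ℝ] E →L[ℝ] ℝ) (a b : E) :
    formSymbol cov p z u H a b =
      -(H (christoffel cov p z u a) b) - H a (christoffel cov p z u b) :=
  formAction_apply _ _ _ _

theorem contDiffOn_formSymbol [T2Space M]
    [CovariantDerivative.ContMDiffCovariantDerivative cov ∞] (p : M) :
    ContDiffOn ℝ ∞ (formSymbol cov p) (extChartAt 𝓘(ℝ, E) p).target :=
  contDiffOn_const.clm_comp (contDiffOn_christoffel cov p)

theorem differentiableAt_rep {p y : M} (hy : y ∈ (chartAt E p).source)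
    {s : ∀ y : M, BilinForms E y}
    (hs : MDifferentiableAt 𝓘(ℝ, E) (𝓘(ℝ, E).prod 𝓘(ℝ, E →L[ℝ] E →L[ℝ] ℝ))
      (fun y ↦ TotalSpace.mk' (E →L[ℝ] E →L[ℝ] ℝ) y (s y)) y) :
    DifferentiableAt ℝ (rep (E →L[ℝ] E →L[ℝ] ℝ) p s) (extChartAt 𝓘(ℝ, E) p y) :=
  (mdifferentiableAt_iff_rep (source_subset_baseSet_bilin p) hy).1 hs

/-- On vector fields with constant components `a`, `b` the Leibniz rule reads `∂s(a, b) - s(Γa, b) -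
s(a, Γb)`, because the covariant derivatives of such fields are the Christoffel symbols. All local
arguments pass to `modelCov` through this formula. -/
theorem chartForm_tensorCov {p y : M} (hy : y ∈ (chartAt E p).source)
    {s : ∀ y : M, BilinForms E y}
    (hs : MDifferentiableAt 𝓘(ℝ, E) (𝓘(ℝ, E).prod 𝓘(ℝ, E →L[ℝ] E →L[ℝ] ℝ))
      (fun y ↦ TotalSpace.mk' (E →L[ℝ] E →L[ℝ] ℝ) y (s y)) y) (u : E) :
    chartForm p y (tensorCov cov s y (chartVec p y u)) =
      modelCov (formSymbol cov p) (rep (E →L[ℝ] E →L[ℝ] ℝ) p s)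
        (extChartAt 𝓘(ℝ, E) p y) u := by
  ext a b
  have ha := mdifferentiableAt_chartVec hy a
  have hb := mdifferentiableAt_chartVec hy b
  have h1 : tensorCov cov s y = bilinCovAt cov hs := dif_pos hs
  rw [chartForm_apply hy, h1,
    bilinCovAt_apply cov hs (chartVec p y u) ha hb, leibnizForm,
    mvfderiv_chartVec hy (mdifferentiableAt_eval hs ha hb)]
  rw [← chartVec_christoffel cov hy, ← chartVec_christoffel cov hy, modelCov_apply, add_apply,
    add_apply, formSymbol_apply, rep_bilin_apply hy, chartForm_apply hy, chartForm_apply hy]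
  have heq : ((fun y ↦ s y (chartVec p y a) (chartVec p y b)) ∘ (extChartAt 𝓘(ℝ, E) p).symm)
      =ᶠ[𝓝 (extChartAt 𝓘(ℝ, E) p y)] fun z ↦ rep (E →L[ℝ] E →L[ℝ] ℝ) p s z a b := by
    filter_upwards [(isOpen_extChartAt_target p).mem_nhds
      ((extChartAt 𝓘(ℝ, E) p).map_source (by simpa using hy))] with z hz
    have hz' : (extChartAt 𝓘(ℝ, E) p).symm z ∈ (chartAt E p).source := by
      simpa using (extChartAt 𝓘(ℝ, E) p).map_target hz
    have := rep_bilin_apply hz' s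
    rw [(extChartAt 𝓘(ℝ, E) p).right_inv hz] at this
    rw [this, chartForm_apply hz']
    rfl
  rw [heq.fderiv_eq]
  have h2 := ((differentiableAt_rep hy hs).hasFDerivAt.clm_apply (hasFDerivAt_const a _)).clm_apply
    (hasFDerivAt_const b _)
  rw [h2.fderiv]
  simp
  ring

end ChartFormulas

/-! ### Brackets and iterated derivatives in a chart -/

section ChartCurvature

variable {E : Type*} [NormedAddCommGroup E] [NormedSpace ℝ E] [FiniteDimensional ℝ E]
  {M : Type u} [TopologicalSpace M] [ChartedSpace E M] [IsManifold 𝓘(ℝ, E) ∞ M]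
  (cov : CovariantDerivative 𝓘(ℝ, E) E (TangentSpace 𝓘(ℝ, E) : M → Type _))

theorem eventually_extChartAt {p y : M} (hy : y ∈ (chartAt E p).source) {P : M → Prop}
    (h : ∀ᶠ x in 𝓝 y, P x) :
    ∀ᶠ z in 𝓝 (extChartAt 𝓘(ℝ, E) p y), z ∈ (extChartAt 𝓘(ℝ, E) p).target ∧
      (extChartAt 𝓘(ℝ, E) p).symm z ∈ (chartAt E p).source ∧
      P ((extChartAt 𝓘(ℝ, E) p).symm z) := by
  have hy' : y ∈ (extChartAt 𝓘(ℝ, E) p).source := by simpa using hy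
  have ht := (isOpen_extChartAt_target (I := 𝓘(ℝ, E)) p).mem_nhds
    ((extChartAt 𝓘(ℝ, E) p).map_source hy')
  have hc : Filter.Tendsto (extChartAt 𝓘(ℝ, E) p).symm (𝓝 (extChartAt 𝓘(ℝ, E) p y)) (𝓝 y) := by
    have := (continuousOn_extChartAt_symm (I := 𝓘(ℝ, E)) p).continuousAt ht
    rwa [ContinuousAt, (extChartAt 𝓘(ℝ, E) p).left_inv hy'] at this
  filter_upwards [ht, hc.eventually h] with z hz hz'
  exact ⟨hz, by simpa using (extChartAt 𝓘(ℝ, E) p).map_target hz, hz'⟩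

/-- An identity of germs is needed because the curvature differentiates `∇_V s` once more. -/
theorem rep_tensorCov_eventuallyEq {p y : M} (hy : y ∈ (chartAt E p).source)
    {s : ∀ y : M, BilinForms E y}
    (hs : ∀ᶠ x in 𝓝 y, MDifferentiableAt 𝓘(ℝ, E) (𝓘(ℝ, E).prod 𝓘(ℝ, E →L[ℝ] E →L[ℝ] ℝ))
      (fun y ↦ TotalSpace.mk' (E →L[ℝ] E →L[ℝ] ℝ) y (s y)) x)
    (V : ∀ y : M, TangentSpace 𝓘(ℝ, E) y) :
    rep (E →L[ℝ] E →L[ℝ] ℝ) p (fun x ↦ tensorCov cov s x (V x) : ∀ y : M, BilinForms E y)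
      =ᶠ[𝓝 (extChartAt 𝓘(ℝ, E) p y)]
      fun z ↦ modelCov (formSymbol cov p) (rep (E →L[ℝ] E →L[ℝ] ℝ) p s) z (rep E p V z) := by
  filter_upwards [eventually_extChartAt hy hs] with z ⟨hz, hzs, h⟩
  have h1 := chartForm_tensorCov cov hzs h (rep E p V z)
  have h2 := chartVec_rep hzs V
  rw [(extChartAt 𝓘(ℝ, E) p).right_inv hz] at h1 h2
  rw [← h1, h2]
  rfl

theorem modelCov_congr {F : Type*} [NormedAddCommGroup F] [NormedSpace ℝ F]
    (L : E → E →L[ℝ] F →L[ℝ] F) {X Y : E → F} {z : E} (h : X =ᶠ[𝓝 z] Y) :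
    modelCov L X z = modelCov L Y z := by
  rw [modelCov, modelCov, h.fderiv_eq, h.eq_of_nhds]

/-- Pulling back by the inverse chart commutes with brackets and turns a vector field into its
components, so the bracket is the one of the model space. -/
theorem rep_mlieBracket {p y : M} (hy : y ∈ (chartAt E p).source)
    {U V : ∀ y : M, TangentSpace 𝓘(ℝ, E) y} (hU : MDiffAt (T% U) y) (hV : MDiffAt (T% V) y) :
    VectorField.mlieBracket 𝓘(ℝ, E) U V y = chartVec p y
      (fderiv ℝ (rep E p V) (extChartAt 𝓘(ℝ, E) p y) (rep E p U (extChartAt 𝓘(ℝ, E) p y)) -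
      fderiv ℝ (rep E p U) (extChartAt 𝓘(ℝ, E) p y) (rep E p V (extChartAt 𝓘(ℝ, E) p y))) := by
  have hy' : y ∈ (extChartAt 𝓘(ℝ, E) p).source := by simpa using hy
  have hyy := (extChartAt 𝓘(ℝ, E) p).left_inv hy'
  have hd : ∀ x ∈ (chartAt E p).source, ∀ a : E,
      mfderiv 𝓘(ℝ, E) 𝓘(ℝ, E) (extChartAt 𝓘(ℝ, E) p).symm (extChartAt 𝓘(ℝ, E) p x) a =
        chartVec p x a := by
    intro x hx a
    rw [chartVec, TangentBundle.symmL_trivializationAt hx]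
    simp only [modelWithCornersSelf_coe, range_id, mfderivWithin_univ]
    rfl
  have hpull : ∀ W : ∀ y : M, TangentSpace 𝓘(ℝ, E) y,
      ∀ z ∈ (extChartAt 𝓘(ℝ, E) p).target,
      VectorField.mpullback 𝓘(ℝ, E) 𝓘(ℝ, E) (extChartAt 𝓘(ℝ, E) p).symm W z = rep E p W z := by
    intro W z hz
    have hx : (extChartAt 𝓘(ℝ, E) p).symm z ∈ (chartAt E p).source := by
      simpa using (extChartAt 𝓘(ℝ, E) p).map_target hz
    have h1 := hd _ hx
    have h2 := chartVec_rep hx W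
    rw [(extChartAt 𝓘(ℝ, E) p).right_inv hz] at h1 h2
    rw [VectorField.mpullback_apply]
    have h3 : mfderiv 𝓘(ℝ, E) 𝓘(ℝ, E) (extChartAt 𝓘(ℝ, E) p).symm z =
        (chartVecEquiv hx : E →L[ℝ] _) := by
      ext a
      exact (h1 a).trans (chartVecEquiv_apply hx a).symm
    rw [h3]
    erw [ContinuousLinearMap.inverse_equiv]
    rw [← h2, ← chartVecEquiv_apply hx]
    exact (chartVecEquiv hx).symm_apply_apply _
  have hz := (extChartAt 𝓘(ℝ, E) p).map_source hy'
  have hf : ContMDiffAt 𝓘(ℝ, E) 𝓘(ℝ, E) ∞ (extChartAt 𝓘(ℝ, E) p).symm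
      (extChartAt 𝓘(ℝ, E) p y) :=
    (contMDiffOn_extChartAt_symm (n := ∞) p).contMDiffAt
      ((isOpen_extChartAt_target p).mem_nhds hz)
  have : IsManifold 𝓘(ℝ, E) (minSmoothness ℝ 2) M := by
    rw [minSmoothness_of_isRCLikeNormedField]
    exact IsManifold.of_le (n := ∞) ENat.LEInfty.out
  have hb := VectorField.mpullback_mlieBracket (I := 𝓘(ℝ, E)) (I' := 𝓘(ℝ, E))
    (f := (extChartAt 𝓘(ℝ, E) p).symm) (V := U) (W := V) (x₀ := extChartAt 𝓘(ℝ, E) p y)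
    (n := ∞) (by rwa [hyy]) (by rwa [hyy]) hf
    (by rw [minSmoothness_of_isRCLikeNormedField]; exact ENat.LEInfty.out)
  rw [hpull _ _ hz] at hb
  have hev : ∀ W : ∀ y : M, TangentSpace 𝓘(ℝ, E) y,
      VectorField.mpullback 𝓘(ℝ, E) 𝓘(ℝ, E) (extChartAt 𝓘(ℝ, E) p).symm W
        =ᶠ[𝓝 (extChartAt 𝓘(ℝ, E) p y)] rep E p W := fun W ↦ by
    filter_upwards [(isOpen_extChartAt_target p).mem_nhds hz] with z hz
    exact hpull W z hz
  have hmodel : ∀ A B : E → E, ∀ z : E, (VectorField.mlieBracket 𝓘(ℝ, E) A B z : E) =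
      fderiv ℝ B z (A z) - fderiv ℝ A z (B z) := by
    intro A B z
    have h1 := VectorField.mlieBracketWithin_univ (I := 𝓘(ℝ, E)) (V := A) (W := B)
    have h2 := VectorField.mlieBracketWithin_eq_lieBracketWithin (𝕜 := ℝ) (E := E) (V := A)
      (W := B) (s := univ)
    have h3 := VectorField.lieBracketWithin_univ (𝕜 := ℝ) (V := A) (W := B)
    exact congrFun (h1.symm.trans (h2.trans h3)) z
  rw [Filter.EventuallyEq.mlieBracket_vectorField_eq (hev U) (hev V)] at hb
  have h4 := hb.trans (hmodel (rep E p U) (rep E p V) _)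
  rw [← h4]
  exact (chartVec_rep hy (VectorField.mlieBracket 𝓘(ℝ, E) U V)).symm

end ChartCurvature

/-! ### The curvature in a chart -/

section ChartCurvature

variable {E : Type*} [NormedAddCommGroup E] [NormedSpace ℝ E] [FiniteDimensional ℝ E]
  {M : Type u} [TopologicalSpace M] [ChartedSpace E M] [IsManifold 𝓘(ℝ, E) ∞ M]
  (cov : CovariantDerivative 𝓘(ℝ, E) E (TangentSpace 𝓘(ℝ, E) : M → Type _))

theorem chartForm_tensorCov_apply {p y : M} (hy : y ∈ (chartAt E p).source)
    {s : ∀ y : M, BilinForms E y}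
    (hs : MDifferentiableAt 𝓘(ℝ, E) (𝓘(ℝ, E).prod 𝓘(ℝ, E →L[ℝ] E →L[ℝ] ℝ))
      (fun y ↦ TotalSpace.mk' (E →L[ℝ] E →L[ℝ] ℝ) y (s y)) y) (V : TangentSpace 𝓘(ℝ, E) y) :
    chartForm p y (tensorCov cov s y V) =
      modelCov (formSymbol cov p) (rep (E →L[ℝ] E →L[ℝ] ℝ) p s)
        (extChartAt 𝓘(ℝ, E) p y) ((chartVecEquiv hy).symm V) := by
  rw [← chartForm_tensorCov cov hy hs, ← chartVecEquiv_apply hy]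
  congr 2
  exact ((chartVecEquiv hy).apply_symm_apply V).symm

theorem contDiffAt_rep_extend {p y : M} (hy : y ∈ (chartAt E p).source) (w : BilinForms E y) :
    ContDiffAt ℝ ∞ (rep (E →L[ℝ] E →L[ℝ] ℝ) p (extend (E →L[ℝ] E →L[ℝ] ℝ) w))
      (extChartAt 𝓘(ℝ, E) p y) := by
  obtain ⟨t, ht, hX⟩ := exists_contMDiffOn_extend (k := ∞) 𝓘(ℝ, E) (E →L[ℝ] E →L[ℝ] ℝ) w
  have hy' : y ∈ (extChartAt 𝓘(ℝ, E) p).source := by simpa using hy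
  have h := (smoothOn_iff_rep (p := p) (U := interior t ∩ (chartAt E p).source)
    (source_subset_baseSet_bilin p) inter_subset_right
    (isOpen_interior.inter (chartAt E p).open_source)).1
    (hX.mono (inter_subset_left.trans interior_subset))
  refine h.contDiffAt ((isOpen_extChartAt_target_inter p
    (isOpen_interior.inter (chartAt E p).open_source)).mem_nhds ⟨?_, ?_⟩)
  · exact (extChartAt 𝓘(ℝ, E) p).map_source hy'
  · rw [mem_preimage, (extChartAt 𝓘(ℝ, E) p).left_inv hy']
    exact ⟨mem_interior_iff_mem_nhds.2 ht, hy⟩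

theorem differentiableAt_rep_extend {p y : M} (hy : y ∈ (chartAt E p).source)
    (v : TangentSpace 𝓘(ℝ, E) y) :
    DifferentiableAt ℝ (rep E p (extend E v)) (extChartAt 𝓘(ℝ, E) p y) :=
  (mdifferentiableAt_iff_rep (source_subset_baseSet_tangent p) hy).1
    (mdifferentiableAt_extend ..)

variable [T2Space M] [CovariantDerivative.ContMDiffCovariantDerivative cov ∞]

/-- The extensions that define `curvature` have uncontrolled derivatives; these drop out in
`modelCov_commutator`, and only the values at `y` survive. -/
theorem chartForm_curvature {p y : M} (hy : y ∈ (chartAt E p).source)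
    (u v : E) (w : BilinForms E y) :
    chartForm p y (curvature (tensorCov cov) (chartVec p y u) (chartVec p y v) w) =
      modelCurv (formSymbol cov p) (extChartAt 𝓘(ℝ, E) p y) u v (chartForm p y w) := by
  have hy' : y ∈ (extChartAt 𝓘(ℝ, E) p).source := by simpa using hy
  set z := extChartAt 𝓘(ℝ, E) p y with hz
  set L := formSymbol cov p with hLdef
  have hL : DifferentiableAt ℝ L z :=
    ((contDiffOn_formSymbol cov p).contDiffAt ((isOpen_extChartAt_target p).mem_nhds
      ((extChartAt 𝓘(ℝ, E) p).map_source hy'))).differentiableAt (by simp)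
  set X : ∀ y : M, BilinForms E y := extend (E →L[ℝ] E →L[ℝ] ℝ) w with hXdef
  have hX : ∀ᶠ x in 𝓝 y, MDifferentiableAt 𝓘(ℝ, E) (𝓘(ℝ, E).prod 𝓘(ℝ, E →L[ℝ] E →L[ℝ] ℝ))
      (fun y ↦ TotalSpace.mk' (E →L[ℝ] E →L[ℝ] ℝ) y (X y)) x := by
    obtain ⟨t, ht, hX⟩ := exists_mdifferentiableOn_extend 𝓘(ℝ, E) (E →L[ℝ] E →L[ℝ] ℝ) w
    filter_upwards [eventually_mem_nhds_iff.2 ht] with x hx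
    exact hX.mdifferentiableAt hx
  have hX2 : ContDiffAt ℝ 2 (rep (E →L[ℝ] E →L[ℝ] ℝ) p X) z :=
    (contDiffAt_rep_extend hy w).of_le ENat.LEInfty.out
  have hXz : rep (E →L[ℝ] E →L[ℝ] ℝ) p X z = chartForm p y w := by
    rw [rep_bilin_apply hy, hXdef, extend_apply_self]
  have hvec : ∀ a : E, rep E p (extend E (chartVec p y a)) z = a := by
    intro a
    have h1 := chartVec_rep hy (extend E (chartVec p y a))
    rw [extend_apply_self] at h1
    apply (chartVecEquiv hy).injective
    rw [chartVecEquiv_apply hy, chartVecEquiv_apply hy]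
    exact h1
  have key : ∀ a b : E, chartForm p y (tensorCov cov
        (fun x ↦ tensorCov cov X x (extend E (chartVec p y a) x)) y (chartVec p y b)) =
      modelCov L (fun z ↦ modelCov L (rep (E →L[ℝ] E →L[ℝ] ℝ) p X) z
        (rep E p (extend E (chartVec p y a)) z)) z b := by
    intro a b
    have h1 := rep_tensorCov_eventuallyEq cov hy hX (extend E (chartVec p y a))
    -- The inner derivative has to be differentiable at `y`: on other fields `tensorCov` has the
    -- value `0` by convention.
    have h2 : DifferentiableAt ℝ (rep (E →L[ℝ] E →L[ℝ] ℝ) p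
        (fun x ↦ tensorCov cov X x (extend E (chartVec p y a) x) : ∀ y : M, BilinForms E y)) z :=
      h1.differentiableAt_iff.2
        (fderiv_modelCov hL hX2 (differentiableAt_rep_extend hy _) 0).1
    have h3 := (mdifferentiableAt_iff_rep (source_subset_baseSet_bilin p) hy).2 h2
    rw [chartForm_tensorCov cov hy h3, modelCov_congr L h1]
  have hbr := rep_mlieBracket hy
    (mdifferentiableAt_extend (I := 𝓘(ℝ, E)) (F := E) (chartVec p y u))
    (mdifferentiableAt_extend (I := 𝓘(ℝ, E)) (F := E) (chartVec p y v))
  have hcomm := modelCov_commutator hL hX2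
    (differentiableAt_rep_extend hy (chartVec p y u))
    (differentiableAt_rep_extend hy (chartVec p y v))
  rw [hvec u, hvec v, hXz] at hcomm
  rw [← hz, hvec u, hvec v] at hbr
  rw [← hcomm, ← key, ← key, ← chartForm_tensorCov cov hy hX.self_of_nhds, ← hbr,
    ← chartFormEquiv_apply hy, ← chartFormEquiv_apply hy, ← chartFormEquiv_apply hy,
    ← chartFormEquiv_apply hy, ← map_sub, ← map_sub]
  rfl

theorem curvature_eq_zero_iff {p y : M} (hy : y ∈ (chartAt E p).source) (w : BilinForms E y) :
    (∀ u v : TangentSpace 𝓘(ℝ, E) y, curvature (tensorCov cov) u v w = 0) ↔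
      ∀ u v : E, modelCurv (formSymbol cov p) (extChartAt 𝓘(ℝ, E) p y) u v
        (chartForm p y w) = 0 := by
  constructor
  · intro h u v
    rw [← chartForm_curvature cov hy, h, ← chartFormEquiv_apply hy, map_zero]
  · intro h u v
    obtain ⟨a, rfl⟩ := (chartVecEquiv hy).surjective u
    obtain ⟨b, rfl⟩ := (chartVecEquiv hy).surjective v
    rw [chartVecEquiv_apply, chartVecEquiv_apply]
    have := chartForm_curvature cov hy a b w
    rw [h, ← chartFormEquiv_apply hy] at this
    exact (chartFormEquiv hy).map_eq_zero_iff.1 this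

end ChartCurvature

/-! ### The derived flag -/

section FlagFacts

variable {E : Type*} [NormedAddCommGroup E] [NormedSpace ℝ E]
  {H : Type*} [TopologicalSpace H] {I : ModelWithCorners ℝ E H}
  {M : Type*} [TopologicalSpace M] [ChartedSpace H M] [IsManifold I ∞ M]
  {F : Type*} [NormedAddCommGroup F] [NormedSpace ℝ F]
  {V : M → Type*} [TopologicalSpace (TotalSpace F V)]
  [∀ x, AddCommGroup (V x)] [∀ x, Module ℝ (V x)] [∀ x : M, TopologicalSpace (V x)]
  [∀ x, IsTopologicalAddGroup (V x)] [∀ x, ContinuousSMul ℝ (V x)]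
  [FiberBundle F V] [VectorBundle ℝ F V] (D : CovariantDerivative I F V)

theorem sectionCore_subset (W' : ∀ x : M, Set (V x)) (x : M) : sectionCore I F W' x ⊆ W' x := by
  rintro w ⟨U, X, hx, -, hX, rfl⟩
  exact hX x hx

theorem secondFormKer_subset (W' : ∀ x : M, Set (V x)) (x : M) : secondFormKer D W' x ⊆ W' x := by
  rintro w ⟨U, X, hx, -, hX, rfl, -⟩
  exact hX x hx

theorem flag_antitone (W : ∀ x : M, Set (V x)) {j k : ℕ} (h : j ≤ k) (x : M) :
    flag D W k x ⊆ flag D W j x := by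
  induction k, h using Nat.le_induction with
  | base => exact subset_rfl
  | succ k _ ih => exact ((sectionCore_subset _ x).trans (secondFormKer_subset D _ x)).trans ih

theorem flag_subset_curvatureKer (W : ∀ x : M, Set (V x)) (k : ℕ) (x : M) :
    flag D W k x ⊆ curvatureKer D W x :=
  (flag_antitone D W k.zero_le x).trans (sectionCore_subset _ x)

/-- This is what stationarity gives: the second fundamental form of the terminal member vanishes, so
the connection restricts to it. -/
theorem flag_subset_secondFormKer {W : ∀ x : M, Set (V x)} {k : ℕ}
    (hk : flag D W (k + 1) = flag D W k) (x : M) :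
    flag D W k x ⊆ secondFormKer D (flag D W k) x := by
  conv_lhs => rw [← hk]
  exact sectionCore_subset _ x

/-- A parallel section with values in the kernel of the curvature lies in the derived flag. -/
theorem mem_flag_of_parallel {W : ∀ x : M, Set (V x)} {X : ∀ x : M, V x} {U : Opens M}
    (hX : SmoothOn I F X U) (hp : ParallelOn D X U) (hc : ∀ x ∈ U, X x ∈ curvatureKer D W x)
    {k : ℕ} (h0 : ∀ x ∈ U, (0 : V x) ∈ flag D W k x) {j : ℕ} (hj : j ≤ k) :
    ∀ x ∈ U, X x ∈ flag D W j x := by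
  induction j with
  | zero => exact fun x hx ↦ ⟨U, X, hx, hX, hc, rfl⟩
  | succ j ih =>
    have ih' := ih (by lia)
    -- The section `X` is itself the witness, both for `sectionCore` and for `secondFormKer`. Its
    -- derivative is `0`, which lies in stage `j` because `h0` puts it in the smaller stage `k`.
    refine fun x hx ↦ ⟨U, X, hx, hX, fun y hy ↦ ⟨U, X, hy, hX, ih', rfl, fun u ↦ ?_⟩, rfl⟩
    rw [hp y hy]
    exact flag_antitone D W (by lia) y (h0 y hy)

end FlagFacts

/-! ### Parallel frames of the terminal subset -/

section ParallelFrames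

variable {E : Type*} [NormedAddCommGroup E] [NormedSpace ℝ E] [FiniteDimensional ℝ E]
  {M : Type u} [TopologicalSpace M] [ChartedSpace E M] [IsManifold 𝓘(ℝ, E) ∞ M]

/-- The coordinate map at `z` of a family of fields of bilinear forms. -/
def repComb {n : ℕ} (p : M) (X : Fin n → ∀ y : M, BilinForms E y) (z : E) :
    (Fin n → ℝ) →L[ℝ] (E →L[ℝ] E →L[ℝ] ℝ) :=
  ∑ i, (ContinuousLinearMap.proj (R := ℝ) (φ := fun _ : Fin n ↦ ℝ) i).smulRight
    (rep (E →L[ℝ] E →L[ℝ] ℝ) p (X i) z)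

theorem repComb_apply {n : ℕ} {p y : M} (hy : y ∈ (chartAt E p).source)
    (X : Fin n → ∀ y : M, BilinForms E y) (c : Fin n → ℝ) :
    repComb p X (extChartAt 𝓘(ℝ, E) p y) c = chartForm p y (∑ i, c i • X i y) := by
  rw [← chartFormEquiv_apply hy, map_sum, repComb, sum_apply]
  refine Finset.sum_congr rfl fun i _ ↦ ?_
  rw [rep_bilin_apply hy, map_smul, chartFormEquiv_apply]
  rfl

variable {T : ∀ y : M, Set (BilinForms E y)}

theorem IsFrameOn.mem_iff {n : ℕ} {X : Fin n → ∀ y : M, BilinForms E y} {U : Set M}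
    (hX : IsFrameOn 𝓘(ℝ, E) (E →L[ℝ] E →L[ℝ] ℝ) T X U) {y : M} (hy : y ∈ U)
    {w : BilinForms E y} : w ∈ T y ↔ ∃ c : Fin n → ℝ, ∑ i, c i • X i y = w := by
  rw [← hX.span_eq y hy, SetLike.mem_coe, Submodule.mem_span_range_iff_exists_fun]

theorem IsFrameOn.repComb_injective {n : ℕ} {X : Fin n → ∀ y : M, BilinForms E y} {U : Set M}
    (hX : IsFrameOn 𝓘(ℝ, E) (E →L[ℝ] E →L[ℝ] ℝ) T X U) {p y : M}
    (hy : y ∈ U) (hyp : y ∈ (chartAt E p).source) :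
    Function.Injective (repComb p X (extChartAt 𝓘(ℝ, E) p y)) := by
  intro c c' h
  rw [repComb_apply hyp, repComb_apply hyp] at h
  have h1 := chartForm_injective hyp _ _ h
  exact (Fintype.linearIndependent_iffₛ.1 (hX.linearIndependent y hy) c c' h1 |> funext)

theorem IsFrameOn.contDiffOn_repComb {n : ℕ} {X : Fin n → ∀ y : M, BilinForms E y} {U : Set M}
    (hX : IsFrameOn 𝓘(ℝ, E) (E →L[ℝ] E →L[ℝ] ℝ) T X U) {p : M} (hU : IsOpen U)
    (hUp : U ⊆ (chartAt E p).source) :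
    ContDiffOn ℝ ∞ (repComb p X)
      ((extChartAt 𝓘(ℝ, E) p).target ∩ (extChartAt 𝓘(ℝ, E) p).symm ⁻¹' U) := by
  refine ContDiffOn.sum fun i _ ↦ ?_
  have h := (smoothOn_iff_rep (source_subset_baseSet_bilin p) hUp hU).1 (hX.smoothOn i)
  exact ((ContinuousLinearMap.smulRightL ℝ (Fin n → ℝ) (E →L[ℝ] E →L[ℝ] ℝ)
    (ContinuousLinearMap.proj i)).contDiff).comp_contDiffOn h

theorem IsFrameOn.mono {n : ℕ} {X : Fin n → ∀ y : M, BilinForms E y} {U U' : Set M}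
    (hX : IsFrameOn 𝓘(ℝ, E) (E →L[ℝ] E →L[ℝ] ℝ) T X U) (h : U' ⊆ U) :
    IsFrameOn 𝓘(ℝ, E) (E →L[ℝ] E →L[ℝ] ℝ) T X U' where
  smoothOn i := ContMDiffOn.mono (hX.smoothOn i) h
  linearIndependent x hx := hX.linearIndependent x (h hx)
  span_eq x hx := hX.span_eq x (h hx)

variable (cov : CovariantDerivative 𝓘(ℝ, E) E (TangentSpace 𝓘(ℝ, E) : M → Type _))
  [T2Space M] [CovariantDerivative.ContMDiffCovariantDerivative cov ∞]

/-- The condition in `secondFormKer` concerns one section `Y` through the given point. With `Y = Ξ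
f` for a differentiable `f` with `f z = c`, the derivatives of `Y` and of `Ξ c` at `z` differ by `Ξ
(df)`, which lies in `T`; so the condition carries over to constant coefficients. -/
theorem IsFrameOn.modelCov_mem_range {n : ℕ} {X : Fin n → ∀ y : M, BilinForms E y} {U : Set M}
    (hX : IsFrameOn 𝓘(ℝ, E) (E →L[ℝ] E →L[ℝ] ℝ) T X U) {p : M} (hU : IsOpen U)
    (hUp : U ⊆ (chartAt E p).source)
    (hinv : ∀ y, T y ⊆ secondFormKer (tensorCov cov) T y) {z : E}
    (hz : z ∈ (extChartAt 𝓘(ℝ, E) p).target ∩ (extChartAt 𝓘(ℝ, E) p).symm ⁻¹' U)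
    (u : E) (c : Fin n → ℝ) :
    modelCov (formSymbol cov p) (fun z ↦ repComb p X z c) z u ∈ range (repComb p X z) := by
  have hΞ := hX.contDiffOn_repComb hU hUp
  have hTo := isOpen_extChartAt_target_inter (E := E) p hU
  obtain ⟨y, hy⟩ : ∃ y, y = (extChartAt 𝓘(ℝ, E) p).symm z := ⟨_, rfl⟩
  have hyU : y ∈ U := hy ▸ hz.2
  have hyp := hUp hyU
  have hzy : extChartAt 𝓘(ℝ, E) p y = z := by rw [hy, (extChartAt 𝓘(ℝ, E) p).right_inv hz.1]
  obtain ⟨U₁, Y, hyU₁, hY, hYT, hYy, hDY⟩ := hinv y ((hX.mem_iff hyU).2 ⟨c, rfl⟩)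
  obtain ⟨t, htT, hto, hzt, Q, hQ, hQΞ⟩ := exists_smooth_leftInverse hTo hΞ hz
    (hzy ▸ hX.repComb_injective hyU hyp)
  have hYd := hY.mdifferentiableAt U₁.isOpen hyU₁
  have hYr := differentiableAt_rep hyp hYd
  rw [hzy] at hYr
  set f : E → (Fin n → ℝ) := fun z ↦ Q z (rep (E →L[ℝ] E →L[ℝ] ℝ) p Y z) with hf
  have hfd : DifferentiableAt ℝ f z :=
    ((hQ.contDiffAt (hto.mem_nhds hzt)).differentiableAt (by simp)).clm_apply hYr
  have hΞd : DifferentiableAt ℝ (repComb p X) z :=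
    (hΞ.contDiffAt (hTo.mem_nhds hz)).differentiableAt (by simp)
  have hev : rep (E →L[ℝ] E →L[ℝ] ℝ) p Y =ᶠ[𝓝 z] fun z ↦ repComb p X z (f z) := by
    have h1 := eventually_extChartAt hyp (U₁.isOpen.mem_nhds hyU₁)
    rw [hzy] at h1
    filter_upwards [h1, hto.mem_nhds hzt] with z' ⟨hz't, hz's, hz'U⟩ hz'
    have h2 := hYT _ hz'U
    obtain ⟨c', hc'⟩ := (hX.mem_iff (htT hz').2).1 h2
    have h3 := repComb_apply hz's X c'
    rw [(extChartAt 𝓘(ℝ, E) p).right_inv hz't, hc', ← rep_bilin_apply hz's,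
      (extChartAt 𝓘(ℝ, E) p).right_inv hz't] at h3
    rw [hf]
    simp only
    rw [← h3, hQΞ z' hz']
  have hfz : f z = c := by
    have h3 := repComb_apply hyp X c
    rw [← hYy, ← rep_bilin_apply hyp, hzy] at h3
    rw [hf]
    simp only
    rw [← h3, hQΞ z hzt]
  have h1 : modelCov (formSymbol cov p) (rep (E →L[ℝ] E →L[ℝ] ℝ) p Y) z u ∈
      range (repComb p X z) := by
    have := chartForm_tensorCov cov hyp hYd u
    rw [hzy] at this
    rw [← this]
    obtain ⟨c', hc'⟩ := (hX.mem_iff hyU).1 (hDY (chartVec p y u))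
    exact ⟨c', by rw [← hc', ← repComb_apply hyp, hzy]⟩
  obtain ⟨c₁, hc₁⟩ := h1
  rw [modelCov_congr _ hev, modelCov_apply,
    (hΞd.hasFDerivAt.clm_apply hfd.hasFDerivAt).fderiv, hfz] at hc₁
  refine ⟨c₁ - fderiv ℝ f z u, ?_⟩
  rw [map_sub, hc₁, modelCov_apply, (hΞd.hasFDerivAt.clm_apply (hasFDerivAt_const c z)).fderiv]
  simp
  abel

end ParallelFrames

/-! ### Existence of parallel frames -/

section ParallelFrames

variable {E : Type*} [NormedAddCommGroup E] [NormedSpace ℝ E] [FiniteDimensional ℝ E]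
  {M : Type u} [TopologicalSpace M] [ChartedSpace E M] [IsManifold 𝓘(ℝ, E) ∞ M]
  {T : ∀ y : M, Set (BilinForms E y)}
  (cov : CovariantDerivative 𝓘(ℝ, E) E (TangentSpace 𝓘(ℝ, E) : M → Type _))
  [T2Space M] [CovariantDerivative.ContMDiffCovariantDerivative cov ∞]

/-- By `hinv` the connection restricts to `T`, and by `hcurv` the restriction is flat, so
`exists_parallel_frame_model` applies in the chart at `p` and gives the matrix `A` that makes the
given frame parallel. -/
theorem exists_parallel_frame (hinv : ∀ y, T y ⊆ secondFormKer (tensorCov cov) T y)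
    (hcurv : ∀ y, ∀ w ∈ T y, ∀ u v, curvature (tensorCov cov) (x := y) u v w = 0) {p : M}
    (hT : IsBundleAt 𝓘(ℝ, E) (E →L[ℝ] E →L[ℝ] ℝ) T p) :
    ∃ (U : Opens M) (n : ℕ) (h : Fin n → ∀ y : M, BilinForms E y), p ∈ U ∧
      IsFrameOn 𝓘(ℝ, E) (E →L[ℝ] E →L[ℝ] ℝ) T h U ∧
      ∀ i, ParallelOn (tensorCov cov) (h i) U := by
  obtain ⟨U₀, n, X, hpU₀, hX₀⟩ := hT
  set U : Set M := U₀ ∩ (chartAt E p).source with hUdef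
  have hU : IsOpen U := U₀.isOpen.inter (chartAt E p).open_source
  have hUp : U ⊆ (chartAt E p).source := inter_subset_right
  have hX := hX₀.mono (U' := U) inter_subset_left
  have hpU : p ∈ U := ⟨hpU₀, mem_chart_source E p⟩
  set O := (extChartAt 𝓘(ℝ, E) p).target ∩ (extChartAt 𝓘(ℝ, E) p).symm ⁻¹' U with hO
  have hOo : IsOpen O := isOpen_extChartAt_target_inter p hU
  have hmem : ∀ y ∈ U, extChartAt 𝓘(ℝ, E) p y ∈ O := fun y hy ↦ by
    have hy' : y ∈ (extChartAt 𝓘(ℝ, E) p).source := by simpa using hUp hy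
    exact ⟨(extChartAt 𝓘(ℝ, E) p).map_source hy', by
      rwa [mem_preimage, (extChartAt 𝓘(ℝ, E) p).left_inv hy']⟩
  have hinj : ∀ z ∈ O, Function.Injective (repComb p X z) := fun z hz ↦ by
    have := hX.repComb_injective hz.2 (hUp hz.2)
    rwa [(extChartAt 𝓘(ℝ, E) p).right_inv hz.1] at this
  obtain ⟨t, htO, hto, hpt, A, hA, hAu, hAp⟩ := exists_parallel_frame_model hOo
    ((contDiffOn_formSymbol cov p).mono inter_subset_left) (hX.contDiffOn_repComb hU hUp) hinj
    (fun z hz u c ↦ hX.modelCov_mem_range cov hU hUp hinv hz u c)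
    (fun z hz u v c ↦ by
      have h1 := hcurv _ _ ((hX.mem_iff hz.2).2 ⟨c, rfl⟩)
      have h2 := (curvature_eq_zero_iff cov (hUp hz.2) _).1 h1 u v
      rwa [← repComb_apply (hUp hz.2), (extChartAt 𝓘(ℝ, E) p).right_inv hz.1] at h2)
    (hmem p hpU)
  let N : Opens M := ⟨(chartAt E p).source ∩ extChartAt 𝓘(ℝ, E) p ⁻¹' t, by
    have := (continuousOn_extChartAt (I := 𝓘(ℝ, E)) p).isOpen_inter_preimage
      (isOpen_extChartAt_source p) hto
    rwa [extChartAt_source] at this⟩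
  have hNs : ∀ y ∈ N, y ∈ (chartAt E p).source := fun y hy ↦ hy.1
  have hNt : ∀ y ∈ N, extChartAt 𝓘(ℝ, E) p y ∈ t := fun y hy ↦ hy.2
  have hNU : ∀ y ∈ N, y ∈ U := fun y hy ↦ by
    have := (htO (hNt y hy)).2
    rwa [mem_preimage, (extChartAt 𝓘(ℝ, E) p).left_inv (by simpa using hNs y hy)] at this
  let h : Fin n → ∀ y : M, BilinForms E y := fun i y ↦
    ∑ j, A (extChartAt 𝓘(ℝ, E) p y) (Pi.single i 1) j • X j y
  have hrep : ∀ i, ∀ z ∈ t, rep (E →L[ℝ] E →L[ℝ] ℝ) p (h i) z =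
      repComb p X z (A z (Pi.single i 1)) := by
    intro i z hz
    have h1 := repComb_apply (hUp (htO hz).2) X (A z (Pi.single i 1))
    rw [(extChartAt 𝓘(ℝ, E) p).right_inv (htO hz).1] at h1
    rw [h1, rep]
    simp only [h]
    rw [(extChartAt 𝓘(ℝ, E) p).right_inv (htO hz).1]
    rfl
  have hsm : ∀ i, SmoothOn 𝓘(ℝ, E) (E →L[ℝ] E →L[ℝ] ℝ) (h i) N := by
    intro i
    rw [smoothOn_iff_rep (source_subset_baseSet_bilin p) (fun y hy ↦ hNs y hy) N.isOpen]
    have h1 : ContDiffOn ℝ ∞ (fun z ↦ repComb p X z (A z (Pi.single i 1))) t :=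
      ((hX.contDiffOn_repComb hU hUp).mono htO).clm_apply (hA.clm_apply contDiffOn_const)
    refine (h1.congr (hrep i)).mono fun z hz ↦ ?_
    have := hNt _ hz.2
    rwa [(extChartAt 𝓘(ℝ, E) p).right_inv hz.1] at this
  -- The new frame with coefficients `c` is the old one with coefficients `A c`, so independence and
  -- span are inherited through the bijectivity of `A`.
  have hcomb : ∀ y, ∀ c : Fin n → ℝ, ∑ i, c i • h i y =
      ∑ j, A (extChartAt 𝓘(ℝ, E) p y) c j • X j y := by
    intro y c
    have hc : A (extChartAt 𝓘(ℝ, E) p y) c =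
        ∑ i, c i • A (extChartAt 𝓘(ℝ, E) p y) (Pi.single i 1) := by
      conv_lhs => rw [pi_eq_sum_univ' c]
      rw [map_sum]
      refine Finset.sum_congr rfl fun i _ ↦ ?_
      rw [map_smul]
    rw [hc]
    simp only [h, Finset.smul_sum, Finset.sum_apply, Pi.smul_apply, smul_eq_mul, Finset.sum_smul,
      mul_smul]
    exact Finset.sum_comm
  have hbij : ∀ y ∈ N, Function.Bijective (A (extChartAt 𝓘(ℝ, E) p y)) := fun y hy ↦ by
    have := (ContinuousLinearMap.isUnit_iff_bijective).1 (hAu _ (hNt y hy))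
    exact this
  refine ⟨N, n, h, ⟨mem_chart_source E p, hpt⟩, ⟨hsm, fun y hy ↦ ?_, fun y hy ↦ ?_⟩,
    fun i y hy ↦ ?_⟩
  · rw [Fintype.linearIndependent_iffₛ]
    intro c c' hcc
    rw [hcomb, hcomb] at hcc
    have := funext (Fintype.linearIndependent_iffₛ.1 (hX.linearIndependent y (hNU y hy)) _ _ hcc)
    exact congrFun ((hbij y hy).1 this)
  · ext w
    rw [SetLike.mem_coe, Submodule.mem_span_range_iff_exists_fun, hX.mem_iff (hNU y hy)]
    constructor
    · rintro ⟨c, rfl⟩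
      exact ⟨_, (hcomb y c).symm⟩
    · rintro ⟨c, rfl⟩
      obtain ⟨c', rfl⟩ := (hbij y hy).2 c
      exact ⟨c', hcomb y c'⟩
  · have hd := (hsm i).mdifferentiableAt N.isOpen hy
    ext1 V
    rw [zero_apply]
    apply (chartFormEquiv (hNs y hy)).injective
    rw [map_zero, chartFormEquiv_apply, chartForm_tensorCov_apply cov (hNs y hy) hd]
    have hev : rep (E →L[ℝ] E →L[ℝ] ℝ) p (h i) =ᶠ[𝓝 (extChartAt 𝓘(ℝ, E) p y)]
        fun z ↦ repComb p X z (A z (Pi.single i 1)) := by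
      filter_upwards [hto.mem_nhds (hNt y hy)] with z hz using hrep i z hz
    rw [modelCov_congr _ hev, hAp _ (hNt y hy)]
    rfl

end ParallelFrames

/-! ### The space of parallel sections -/

section ParallelSections

variable {E : Type*} [NormedAddCommGroup E] [NormedSpace ℝ E]
  {M : Type*} [TopologicalSpace M] [ChartedSpace E M] [IsManifold 𝓘(ℝ, E) ∞ M]
  {F : Type*} [NormedAddCommGroup F] [NormedSpace ℝ F]
  {V : M → Type*} [TopologicalSpace (TotalSpace F V)]
  [∀ x, AddCommGroup (V x)] [∀ x, Module ℝ (V x)] [∀ x : M, TopologicalSpace (V x)]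
  [∀ x, IsTopologicalAddGroup (V x)] [∀ x, ContinuousSMul ℝ (V x)]
  [FiberBundle F V] [VectorBundle ℝ F V] [ContMDiffVectorBundle ∞ F V 𝓘(ℝ, E)]
  (D : CovariantDerivative 𝓘(ℝ, E) F V)

/-- The sections that are smooth and parallel on the open set `U`. -/
def parallelSections (U : Opens M) : Submodule ℝ (∀ x : M, V x) where
  carrier := {X | SmoothOn 𝓘(ℝ, E) F X U ∧ ParallelOn D X U}
  add_mem' := by
    rintro X Y ⟨hX, hX'⟩ ⟨hY, hY'⟩
    refine ⟨ContMDiffOn.add_section hX hY, fun x hx ↦ ?_⟩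
    have := D.isCovariantDerivativeOn.add (hX.mdifferentiableAt U.isOpen hx)
      (hY.mdifferentiableAt U.isOpen hx)
    refine this.trans ?_
    rw [hX' x hx, hY' x hx, add_zero]
  zero_mem' := by
    refine ⟨(Bundle.contMDiff_zeroSection ℝ V).contMDiffOn, fun x hx ↦ ?_⟩
    exact D.isCovariantDerivativeOnUniv.zero
  smul_mem' := by
    rintro c X ⟨hX, hX'⟩
    refine ⟨ContMDiffOn.const_smul_section hX, fun x hx ↦ ?_⟩
    have := D.isCovariantDerivativeOn.smul_const c (hX.mdifferentiableAt U.isOpen hx)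
    refine this.trans ?_
    rw [hX' x hx, smul_zero]

theorem parallelSections_mono {U U' : Opens M} (h : U' ≤ U) {X : ∀ x : M, V x}
    (hX : X ∈ parallelSections D U) : X ∈ parallelSections D U' :=
  ⟨ContMDiffOn.mono hX.1 h, fun x hx ↦ hX.2 x (h hx)⟩

end ParallelSections

/-! ### Parallel metrics and the norms of parallel sections -/

section MetricPairing

variable {E : Type*} [NormedAddCommGroup E] [NormedSpace ℝ E] [FiniteDimensional ℝ E]
  {M : Type u} [TopologicalSpace M] [ChartedSpace E M] [IsManifold 𝓘(ℝ, E) ∞ M]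
  (cov : CovariantDerivative 𝓘(ℝ, E) E (TangentSpace 𝓘(ℝ, E) : M → Type _))

instance finiteDimensional_tangentSpace (x : M) :
    FiniteDimensional ℝ (TangentSpace 𝓘(ℝ, E) x) :=
  inferInstanceAs (FiniteDimensional ℝ E)

theorem isPosDef_inner
    (g : ContMDiffRiemannianMetric 𝓘(ℝ, E) ∞ E (TangentSpace 𝓘(ℝ, E) : M → Type _)) (y : M) :
    IsPosDef (g.inner y) :=
  ⟨g.symm y, g.pos y⟩

/-- The scalar product on bilinear forms induced by a Riemannian metric. -/
def metricPairing
    (g : ContMDiffRiemannianMetric 𝓘(ℝ, E) ∞ E (TangentSpace 𝓘(ℝ, E) : M → Type _)) (y : M) :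
    LinearMap.BilinForm ℝ (BilinForms E y) :=
  (isPosDef_inner g y).pairing

variable {cov}

theorem fderiv_rep_of_parallel {p y : M} (hy : y ∈ (chartAt E p).source)
    {s : ∀ y : M, BilinForms E y}
    (hs : MDifferentiableAt 𝓘(ℝ, E) (𝓘(ℝ, E).prod 𝓘(ℝ, E →L[ℝ] E →L[ℝ] ℝ))
      (fun y ↦ TotalSpace.mk' (E →L[ℝ] E →L[ℝ] ℝ) y (s y)) y) (h : tensorCov cov s y = 0)
    (u a b : E) :
    fderiv ℝ (rep (E →L[ℝ] E →L[ℝ] ℝ) p s) (extChartAt 𝓘(ℝ, E) p y) u a b =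
      rep (E →L[ℝ] E →L[ℝ] ℝ) p s (extChartAt 𝓘(ℝ, E) p y)
        (christoffel cov p (extChartAt 𝓘(ℝ, E) p y) u a) b +
      rep (E →L[ℝ] E →L[ℝ] ℝ) p s (extChartAt 𝓘(ℝ, E) p y) a
        (christoffel cov p (extChartAt 𝓘(ℝ, E) p y) u b) := by
  have h1 := chartForm_tensorCov cov hy hs u
  rw [h, zero_apply, ← chartFormEquiv_apply hy, map_zero, modelCov_apply] at h1
  have h2 := congrArg (fun f : E →L[ℝ] E →L[ℝ] ℝ ↦ f a b) h1
  simp only [add_apply, formSymbol_apply, zero_apply] at h2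
  linarith

theorem trPair_rep
    (g : ContMDiffRiemannianMetric 𝓘(ℝ, E) ∞ E (TangentSpace 𝓘(ℝ, E) : M → Type _)) {p y : M}
    (hy : y ∈ (chartAt E p).source) (s s' : ∀ y : M, BilinForms E y) :
    IsPosDef (rep (E →L[ℝ] E →L[ℝ] ℝ) p g.inner (extChartAt 𝓘(ℝ, E) p y)) ∧
    trPair (rep (E →L[ℝ] E →L[ℝ] ℝ) p g.inner (extChartAt 𝓘(ℝ, E) p y))
      (rep (E →L[ℝ] E →L[ℝ] ℝ) p s (extChartAt 𝓘(ℝ, E) p y))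
      (rep (E →L[ℝ] E →L[ℝ] ℝ) p s' (extChartAt 𝓘(ℝ, E) p y)) =
      metricPairing g y (s y) (s' y) := by
  have h1 : ∀ (r : ∀ y : M, BilinForms E y) (a b : E),
      rep (E →L[ℝ] E →L[ℝ] ℝ) p r (extChartAt 𝓘(ℝ, E) p y) a b =
        r y (chartVecEquiv hy a) (chartVecEquiv hy b) := fun r a b ↦ by
    rw [rep_bilin_apply hy, chartForm_apply hy, chartVecEquiv_apply, chartVecEquiv_apply]
  have hpos := (isPosDef_inner g y).comp (chartVecEquiv hy) (h1 g.inner)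
  refine ⟨hpos, ?_⟩
  rw [trPair, dif_pos hpos]
  exact (isPosDef_inner g y).pairing_comp (chartVecEquiv hy) hpos (h1 g.inner) (h1 s) (h1 s')

/-- In a chart, `g`, `s` and `s'` satisfy the same linear equation with the Christoffel symbols, so
`hasFDerivAt_trPair` makes the derivative of the pairing vanish. On a ball in the chart it is then
constant. -/
theorem metricPairing_eventually_const
    {g : ContMDiffRiemannianMetric 𝓘(ℝ, E) ∞ E (TangentSpace 𝓘(ℝ, E) : M → Type _)}
    (hg : IsParallelMetric cov g) {U : Opens M} {s s' : ∀ y : M, BilinForms E y}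
    (hs : s ∈ parallelSections (tensorCov cov) U) (hs' : s' ∈ parallelSections (tensorCov cov) U)
    {y : M} (hy : y ∈ U) :
    ∀ᶠ x in 𝓝 y, metricPairing g x (s x) (s' x) = metricPairing g y (s y) (s' y) := by
  have hgs : g.inner ∈ parallelSections (tensorCov cov) U :=
    ⟨g.contMDiff.contMDiffOn, fun x _ ↦ hg x (mem_univ x)⟩
  set T : Set E := (extChartAt 𝓘(ℝ, E) y).target ∩ (extChartAt 𝓘(ℝ, E) y).symm ⁻¹' U with hT
  have hTo : IsOpen T := isOpen_extChartAt_target_inter y U.isOpen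
  have hsrc : ∀ z ∈ T, (extChartAt 𝓘(ℝ, E) y).symm z ∈ (chartAt E y).source := fun z hz ↦ by
    simpa using (extChartAt 𝓘(ℝ, E) y).map_target hz.1
  set G : E → E →L[ℝ] E →L[ℝ] ℝ := rep (E →L[ℝ] E →L[ℝ] ℝ) y g.inner with hG
  have hGpos : ∀ z ∈ T, IsPosDef (G z) := fun z hz ↦ by
    have := (trPair_rep g (hsrc z hz) s s').1
    rwa [(extChartAt 𝓘(ℝ, E) y).right_inv hz.1] at this
  have hdiff : ∀ r : ∀ y : M, BilinForms E y, r ∈ parallelSections (tensorCov cov) U → ∀ z ∈ T,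
      DifferentiableAt ℝ (rep (E →L[ℝ] E →L[ℝ] ℝ) y r) z ∧ ∀ u a b,
        fderiv ℝ (rep (E →L[ℝ] E →L[ℝ] ℝ) y r) z u a b =
          rep (E →L[ℝ] E →L[ℝ] ℝ) y r z (christoffel cov y z u a) b +
          rep (E →L[ℝ] E →L[ℝ] ℝ) y r z a (christoffel cov y z u b) := by
    intro r hr z hz
    have h1 := SmoothOn.mdifferentiableAt (E := E) hr.1 U.isOpen hz.2
    have h2 := differentiableAt_rep (hsrc z hz) h1
    have h3 := fderiv_rep_of_parallel (hsrc z hz) h1 (hr.2 _ hz.2)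
    rw [(extChartAt 𝓘(ℝ, E) y).right_inv hz.1] at h2 h3
    exact ⟨h2, h3⟩
  have hder : ∀ z ∈ T, HasFDerivAt (fun z ↦ trPair (G z) (rep (E →L[ℝ] E →L[ℝ] ℝ) y s z)
      (rep (E →L[ℝ] E →L[ℝ] ℝ) y s' z)) (0 : E →L[ℝ] ℝ) z := fun z hz ↦
    hasFDerivAt_trPair hTo hGpos hz (hdiff _ hgs z hz).1 (hdiff _ hs z hz).1 (hdiff _ hs' z hz).1
      (hdiff _ hgs z hz).2 (hdiff _ hs z hz).2 (hdiff _ hs' z hz).2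
  have hyT : extChartAt 𝓘(ℝ, E) y y ∈ T := ⟨mem_extChartAt_target (I := 𝓘(ℝ, E)) y, by
    rwa [mem_preimage, extChartAt_to_inv (I := 𝓘(ℝ, E)) y]⟩
  obtain ⟨ε, hε, hball⟩ := Metric.isOpen_iff.1 hTo _ hyT
  have hconst : ∀ z ∈ Metric.ball (extChartAt 𝓘(ℝ, E) y y) ε, _ := fun z hz ↦
    (convex_ball (extChartAt 𝓘(ℝ, E) y y) ε).is_const_of_fderivWithin_eq_zero (𝕜 := ℝ)
      (fun z hz ↦ (hder z (hball hz)).differentiableAt.differentiableWithinAt)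
      (fun z hz ↦ by
        rw [fderivWithin_of_isOpen Metric.isOpen_ball hz, (hder z (hball hz)).fderiv])
      hz (Metric.mem_ball_self hε)
  have hc := (continuousAt_extChartAt (I := 𝓘(ℝ, E)) y).eventually
    (Metric.ball_mem_nhds _ hε)
  filter_upwards [hc, chart_source_mem_nhds E y] with x hx hxs
  have h1 := hconst _ hx
  rw [(trPair_rep g hxs s s').2, (trPair_rep g (mem_chart_source E y) s s').2] at h1
  exact h1

end MetricPairing

/-! ### Transition matrices -/

section TransitionMatrix

variable {V : Type*} [AddCommGroup V] [Module ℝ V] {n : ℕ}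

/-- A linear relation between the rows of the matrix would be a relation between the `v i`, so
independence of `v` already makes the matrix invertible. -/
theorem exists_transition {v v' : Fin n → V} (hv : LinearIndependent ℝ v)
    (h : ∀ i, v i ∈ Submodule.span ℝ (range v')) :
    ∃ A : Matrix.GeneralLinearGroup (Fin n) ℝ,
      ∀ i, v i = ∑ j, (A : Matrix (Fin n) (Fin n) ℝ) i j • v' j := by
  choose A hA using fun i ↦ (Submodule.mem_span_range_iff_exists_fun ℝ).1 (h i)
  have hu : IsUnit (Matrix.of A) := by
    rw [← Matrix.linearIndependent_rows_iff_isUnit, Fintype.linearIndependent_iff]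
    intro c hc
    refine Fintype.linearIndependent_iff.1 hv c ?_
    have hc' : ∀ j, ∑ i, c i * A i j = 0 := fun j ↦ by
      have := congrFun hc j
      simpa using this
    calc ∑ i, c i • v i = ∑ i, ∑ j, (c i * A i j) • v' j := by
          refine Finset.sum_congr rfl fun i _ ↦ ?_
          rw [← hA i, Finset.smul_sum]
          simp only [mul_smul]
      _ = ∑ j, (∑ i, c i * A i j) • v' j := by
          rw [Finset.sum_comm]
          simp only [Finset.sum_smul]
      _ = 0 := by simp [hc']
  obtain ⟨A', hA'⟩ := hu
  exact ⟨A', fun i ↦ by rw [hA']; exact (hA i).symm⟩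

theorem transition_unique {v' : Fin n → V} (hv' : LinearIndependent ℝ v')
    {A B : Matrix.GeneralLinearGroup (Fin n) ℝ}
    (h : ∀ i, ∑ j, (A : Matrix (Fin n) (Fin n) ℝ) i j • v' j =
      ∑ j, (B : Matrix (Fin n) (Fin n) ℝ) i j • v' j) : A = B := by
  ext i j
  exact Fintype.linearIndependent_iffₛ.1 hv' _ _ (h i) j

theorem transition_mul {v v' v'' : Fin n → V} {A B : Matrix (Fin n) (Fin n) ℝ}
    (h : ∀ i, v i = ∑ j, A i j • v' j) (h' : ∀ i, v' i = ∑ j, B i j • v'' j) (i : Fin n) :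
    v i = ∑ j, (A * B) i j • v'' j := by
  rw [h i]
  simp only [h', Finset.smul_sum, Matrix.mul_apply, Finset.sum_smul, mul_smul]
  exact Finset.sum_comm

end TransitionMatrix

/-! ### Flat frames -/

section FlatFrames

variable {E : Type*} [NormedAddCommGroup E] [NormedSpace ℝ E]
  {M : Type u} [TopologicalSpace M] [ChartedSpace E M] [IsManifold 𝓘(ℝ, E) ∞ M]
  {F : Type*} [NormedAddCommGroup F] [NormedSpace ℝ F]
  {V : M → Type*} [TopologicalSpace (TotalSpace F V)]
  [∀ x, AddCommGroup (V x)] [∀ x, Module ℝ (V x)] [∀ x : M, TopologicalSpace (V x)]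
  [∀ x, IsTopologicalAddGroup (V x)] [∀ x, ContinuousSMul ℝ (V x)]
  [FiberBundle F V] [VectorBundle ℝ F V] [ContMDiffVectorBundle ∞ F V 𝓘(ℝ, E)]
  {D : CovariantDerivative 𝓘(ℝ, E) F V} {T : ∀ y : M, Set (V y)}

variable (D T) in
/-- `h` is a frame of parallel sections of `T` over `U`. -/
structure IsFlatFrame {n : ℕ} (h : Fin n → ∀ y : M, V y) (U : Opens M) : Prop where
  isFrameOn : IsFrameOn 𝓘(ℝ, E) F T h U
  parallelOn : ∀ i, ParallelOn D (h i) U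

theorem IsFlatFrame.mem {n : ℕ} {h : Fin n → ∀ y : M, V y} {U : Opens M}
    (hh : IsFlatFrame D T h U) (i : Fin n) : h i ∈ parallelSections D U :=
  ⟨hh.isFrameOn.smoothOn i, hh.parallelOn i⟩

theorem IsFlatFrame.linearIndependent {n : ℕ} {h : Fin n → ∀ y : M, V y} {U : Opens M}
    (hh : IsFlatFrame D T h U) {y : M} (hy : y ∈ U) : LinearIndependent ℝ fun i ↦ h i y :=
  hh.isFrameOn.linearIndependent y hy

theorem IsFlatFrame.mem_iff {n : ℕ} {h : Fin n → ∀ y : M, V y} {U : Opens M}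
    (hh : IsFlatFrame D T h U) {y : M} (hy : y ∈ U) {w : V y} :
    w ∈ T y ↔ w ∈ Submodule.span ℝ (range fun i ↦ h i y) := by
  rw [← hh.isFrameOn.span_eq y hy, SetLike.mem_coe]

theorem IsFlatFrame.apply_mem {n : ℕ} {h : Fin n → ∀ y : M, V y} {U : Opens M}
    (hh : IsFlatFrame D T h U) {y : M} (hy : y ∈ U) (i : Fin n) : h i y ∈ T y :=
  (hh.mem_iff hy).2 (Submodule.subset_span ⟨i, rfl⟩)

theorem IsFlatFrame.sum_mem {n : ℕ} {h : Fin n → ∀ y : M, V y} {U : Opens M}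
    (hh : IsFlatFrame D T h U) {y : M} (hy : y ∈ U) (c : Fin n → ℝ) :
    ∑ i, c i • h i y ∈ T y :=
  (hh.mem_iff hy).2 (Submodule.sum_mem _ fun i _ ↦
    Submodule.smul_mem _ _ (Submodule.subset_span ⟨i, rfl⟩))

theorem IsFlatFrame.mono {n : ℕ} {h : Fin n → ∀ y : M, V y} {U U' : Opens M}
    (hh : IsFlatFrame D T h U) (hU : U' ≤ U) : IsFlatFrame D T h U' :=
  ⟨⟨fun i ↦ ContMDiffOn.mono (hh.isFrameOn.smoothOn i) hU,
    fun x hx ↦ hh.isFrameOn.linearIndependent x (hU hx),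
    fun x hx ↦ hh.isFrameOn.span_eq x (hU hx)⟩, fun i x hx ↦ hh.parallelOn i x (hU hx)⟩

theorem IsFlatFrame.finrank {n : ℕ} {h : Fin n → ∀ y : M, V y} {U : Opens M}
    (hh : IsFlatFrame D T h U) {y : M} (hy : y ∈ U) :
    Module.finrank ℝ (Submodule.span ℝ (T y)) = n := by
  rw [← hh.isFrameOn.span_eq y hy, Submodule.span_coe_eq_restrictScalars,
    Submodule.restrictScalars_self, finrank_span_eq_card (hh.linearIndependent hy),
    Fintype.card_fin]

variable (D T) in
/-- A fibrewise bilinear form that is definite on `T` and constant on parallel sections. -/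
structure IsParallelPairing (B : ∀ y, LinearMap.BilinForm ℝ (V y)) : Prop where
  eventually_const : ∀ {U : Opens M} {s s' : ∀ y : M, V y}, s ∈ parallelSections D U →
    s' ∈ parallelSections D U → ∀ {y : M}, y ∈ U →
    ∀ᶠ x in 𝓝 y, B x (s x) (s' x) = B y (s y) (s' y)
  definite : ∀ {y : M} {w : V y}, w ∈ T y → B y w w = 0 → w = 0

variable {B : ∀ y, LinearMap.BilinForm ℝ (V y)}

theorem IsParallelPairing.const (hB : IsParallelPairing D T B) {U : Opens M}
    (hU : IsPreconnected (U : Set M)) {s s' : ∀ y : M, V y}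
    (hs : s ∈ parallelSections D U) (hs' : s' ∈ parallelSections D U)
    {x y : M} (hx : x ∈ U) (hy : y ∈ U) : B x (s x) (s' x) = B y (s y) (s' y) := by
  have : PreconnectedSpace U := isPreconnected_iff_preconnectedSpace.1 hU
  have hlc : IsLocallyConstant fun x : U ↦ B x (s x) (s' x) := by
    rw [IsLocallyConstant.iff_eventually_eq]
    intro y
    exact continuous_subtype_val.continuousAt.eventually (hB.eventually_const hs hs' y.2)
  exact hlc.apply_eq_of_preconnectedSpace ⟨x, hx⟩ ⟨y, hy⟩

/-- This takes the place of uniqueness for the differential equation `∇s = 0`: the square of `s` is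
locally constant and the pairing is definite. -/
theorem IsParallelPairing.eventually_eq_zero (hB : IsParallelPairing D T B) {U : Opens M}
    {s : ∀ y : M, V y} (hs : s ∈ parallelSections D U) (hsT : ∀ y ∈ U, s y ∈ T y) {y : M}
    (hy : y ∈ U) (h : s y = 0) : ∀ᶠ x in 𝓝 y, s x = 0 := by
  filter_upwards [hB.eventually_const hs hs hy, U.isOpen.mem_nhds hy] with x hx hxU
  refine hB.definite (hsT x hxU) (hx.trans ?_)
  rw [h, map_zero]

theorem IsParallelPairing.eq_zero (hB : IsParallelPairing D T B) {U : Opens M}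
    (hU : IsPreconnected (U : Set M)) {s : ∀ y : M, V y}
    (hs : s ∈ parallelSections D U) (hsT : ∀ y ∈ U, s y ∈ T y) {y : M} (hy : y ∈ U) (h : s y = 0)
    {x : M} (hx : x ∈ U) : s x = 0 := by
  refine hB.definite (hsT x hx) ((hB.const hU hs hs hx hy).trans ?_)
  rw [h, map_zero]

/-- A parallel section of `T` has locally constant components with respect to a flat frame. -/
theorem IsFlatFrame.eventually_eq (hB : IsParallelPairing D T B) {n : ℕ}
    {h : Fin n → ∀ y : M, V y} {U U' : Opens M} (hh : IsFlatFrame D T h U)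
    {s : ∀ y : M, V y} (hs : s ∈ parallelSections D U')
    (hsT : ∀ y ∈ U', s y ∈ T y) {x : M} (hx : x ∈ U) (hx' : x ∈ U') {c : Fin n → ℝ}
    (hc : s x = ∑ i, c i • h i x) : ∀ᶠ y in 𝓝 x, s y = ∑ i, c i • h i y := by
  -- Freezing the coefficients at `x` gives a parallel section of `T`; the difference is parallel
  -- and vanishes at `x`.
  have h1 : s - ∑ i, c i • h i ∈ parallelSections D (U ⊓ U') :=
    Submodule.sub_mem _ (parallelSections_mono _ inf_le_right hs)
      (Submodule.sum_mem _ fun i _ ↦ Submodule.smul_mem _ _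
        (parallelSections_mono _ inf_le_left (hh.mem i)))
  have h2 : ∀ y, (s - ∑ i, c i • h i) y = s y - ∑ i, c i • h i y := fun y ↦ by
    simp [Finset.sum_apply]
  have h3 := hB.eventually_eq_zero h1 (fun y hy ↦ ?_) ⟨hx, hx'⟩
    (by rw [h2, hc, sub_self])
  · filter_upwards [h3] with y hy
    rw [h2, sub_eq_zero] at hy
    exact hy
  · rw [h2, hh.mem_iff hy.1]
    exact Submodule.sub_mem _ ((hh.mem_iff hy.1).1 (hsT y hy.2))
      ((hh.mem_iff hy.1).1 (hh.sum_mem hy.1 c))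

theorem IsFlatFrame.exists_transition (hB : IsParallelPairing D T B) {n : ℕ} {h h' : Fin n → ∀ y : M, V y}
    {U U' : Opens M} (hh : IsFlatFrame D T h U) (hh' : IsFlatFrame D T h' U') :
    ∃ t : LocallyConstant (U ⊓ U' : Opens M) (Matrix.GeneralLinearGroup (Fin n) ℝ),
      ∀ x (hx : x ∈ U) (hx' : x ∈ U') (i : Fin n),
        h i x = ∑ j, (t ⟨x, hx, hx'⟩ : Matrix (Fin n) (Fin n) ℝ) i j • h' j x := by
  have key : ∀ x : (U ⊓ U' : Opens M), ∃ A : Matrix.GeneralLinearGroup (Fin n) ℝ, ∀ i,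
      h i x = ∑ j, (A : Matrix (Fin n) (Fin n) ℝ) i j • h' j x := fun x ↦
    MetricConnection.exists_transition (hh.linearIndependent x.2.1) fun i ↦
      (hh'.mem_iff x.2.2).1 (hh.apply_mem x.2.1 i)
  choose t ht using key
  refine ⟨⟨t, (IsLocallyConstant.iff_eventually_eq t).2 fun x ↦ ?_⟩,
    fun x hx hx' i ↦ ht ⟨x, hx, hx'⟩ i⟩
  have h1 : ∀ᶠ y in 𝓝 (x : M), ∀ i, h i y =
      ∑ j, (t x : Matrix (Fin n) (Fin n) ℝ) i j • h' j y :=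
    Filter.eventually_all.2 fun i ↦ hh'.eventually_eq hB (hh.mem i)
      (fun y hy ↦ hh.apply_mem hy i) x.2.2 x.2.1 (ht x i)
  filter_upwards [continuous_subtype_val.continuousAt.eventually h1] with y hy
  exact transition_unique (hh'.linearIndependent y.2.2) fun i ↦ by rw [← ht y i, hy i]

end FlatFrames

/-! ### Parallel metrics span the parallel sections -/

section Positivity

variable {E : Type*} [NormedAddCommGroup E] [NormedSpace ℝ E] [FiniteDimensional ℝ E]
  {M : Type u} [TopologicalSpace M] [ChartedSpace E M] [IsManifold 𝓘(ℝ, E) ∞ M]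
  {cov : CovariantDerivative 𝓘(ℝ, E) E (TangentSpace 𝓘(ℝ, E) : M → Type _)}
  {g : ContMDiffRiemannianMetric 𝓘(ℝ, E) ∞ E (TangentSpace 𝓘(ℝ, E) : M → Type _)}

theorem isParallelPairing_metricPairing (hg : IsParallelMetric cov g)
    {T : ∀ y : M, Set (BilinForms E y)} (hT : ∀ y, T y ⊆ symForms E y) :
    IsParallelPairing (tensorCov cov) T (metricPairing g) where
  eventually_const hs hs' _ hy := metricPairing_eventually_const hg hs hs' hy
  definite hw h := (isPosDef_inner g _).eq_zero_of_pairing_self (hT _ hw) h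

/-- A parallel metric stays a metric when a small multiple of a parallel section is added. -/
theorem exists_isParallelMetric_add [PreconnectedSpace M] (hg : IsParallelMetric cov g)
    {s : ∀ y : M, BilinForms E y} (hs : s ∈ parallelSections (tensorCov cov) ⊤)
    (hsym : ∀ y, s y ∈ symForms E y) :
    ∃ ε : ℝ, ε ≠ 0 ∧ ∃ g' : ContMDiffRiemannianMetric 𝓘(ℝ, E) ∞ E
      (TangentSpace 𝓘(ℝ, E) : M → Type _), IsParallelMetric cov g' ∧
        g'.inner = g.inner + ε • s := by
  -- The norm of a parallel section is constant on the connected manifold, so a single `C` serves at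
  -- all points without compactness.
  obtain ⟨C, hC0, hC⟩ : ∃ C : ℝ, 0 ≤ C ∧ ∀ x, metricPairing g x (s x) (s x) ≤ C ^ 2 := by
    rcases isEmpty_or_nonempty M with h | ⟨⟨x₀⟩⟩
    · exact ⟨0, le_rfl, fun x ↦ (h.false x).elim⟩
    · refine ⟨√(metricPairing g x₀ (s x₀) (s x₀)), Real.sqrt_nonneg _, fun x ↦ ?_⟩
      have h0 : 0 ≤ metricPairing g x₀ (s x₀) (s x₀) :=
        (isPosDef_inner g x₀).pairing_self_nonneg (hsym x₀)
      rw [Real.sq_sqrt h0]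
      exact ((isParallelPairing_metricPairing hg fun _ ↦ subset_rfl).const (U := ⊤) isPreconnected_univ hs hs (mem_univ x)
        (mem_univ x₀)).le
  -- By `sq_le`, `|s v v| ≤ C * g v v`; with `ε C ≤ 1/2` the form `g + εs` stays above `g / 2`. The
  -- summand `1` covers `C = 0`.
  set ε : ℝ := 1 / (2 * (C + 1)) with hε
  have hεpos : 0 < ε := by positivity
  have hεC : ε * C ≤ 1 / 2 := by
    rw [hε, div_mul_eq_mul_div, one_mul, div_le_div_iff₀ (by positivity) (by norm_num)]
    linarith
  have hlow : ∀ (x : M) (v : TangentSpace 𝓘(ℝ, E) x),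
      g.inner x v v / 2 ≤ (g.inner + ε • s) x v v := by
    intro x v
    have h0 := (isPosDef_inner g x).nonneg v
    have h1 : s x v v ^ 2 ≤ (C * g.inner x v v) ^ 2 := by
      rw [mul_pow]
      exact ((isPosDef_inner g x).sq_le (hsym x) v).trans
        (mul_le_mul_of_nonneg_right (hC x) (sq_nonneg _))
    have h2 := (abs_le_of_sq_le_sq' h1 (by positivity)).1
    change _ ≤ g.inner x v v + ε * s x v v
    nlinarith [mul_le_mul_of_nonneg_left h2 hεpos.le, mul_le_mul_of_nonneg_right hεC h0]
  have hmem : g.inner + ε • s ∈ parallelSections (tensorCov cov) (⊤ : Opens M) :=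
    Submodule.add_mem _ ⟨g.contMDiff.contMDiffOn, fun x _ ↦ hg x (mem_univ x)⟩
      (Submodule.smul_mem _ _ hs)
  refine ⟨ε, hεpos.ne', ⟨g.inner + ε • s, fun x v w ↦ ?_, fun x v hv ↦ ?_, fun x ↦ ?_,
    contMDiffOn_univ.1 hmem.1⟩, hmem.2, rfl⟩
  · change g.inner x v w + ε * s x v w = g.inner x w v + ε * s x w v
    rw [g.symm, hsym x]
  · exact lt_of_lt_of_le (half_pos (g.pos x v hv)) (hlow x v)
  -- Since `g / 2 ≤ g + εs`, the unit ball of the new form lies in twice the unit ball of `g`.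
  · refine ((g.isVonNBounded x).image ((2 : ℝ) • ContinuousLinearMap.id ℝ _)).subset ?_
    intro v hv
    refine ⟨(1 / 2 : ℝ) • v, ?_, ?_⟩
    · have h1 := hlow x v
      have h2 : (g.inner + ε • s) x v v < 1 := hv
      have h3 : g.inner x ((1 / 2 : ℝ) • v) ((1 / 2 : ℝ) • v) = g.inner x v v / 4 := by
        rw [map_smul, map_smul, smul_apply, smul_eq_mul, smul_eq_mul]
        ring
      change g.inner x ((1 / 2 : ℝ) • v) ((1 / 2 : ℝ) • v) < 1
      linarith [(isPosDef_inner g x).nonneg v]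
    · change (2 : ℝ) • ((1 / 2 : ℝ) • v) = v
      rw [smul_smul]
      norm_num

/-- A parallel section is `ε⁻¹ (g' - g)` with two parallel metrics, by
`exists_isParallelMetric_add`. -/
theorem parallelMetricSpan_eq [PreconnectedSpace M] (hmet : IsMetric cov) (x : M) :
    parallelMetricSpan cov x = parallelSectionSpan cov x := by
  obtain ⟨g, hg⟩ := hmet
  apply le_antisymm
  · refine Submodule.span_mono ?_
    rintro w ⟨g', hg', rfl⟩
    exact ⟨g'.inner, g'.contMDiff.contMDiffOn, fun y ↦ g'.symm y, hg', rfl⟩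
  · refine Submodule.span_le.2 ?_
    rintro w ⟨s, hs, hsym, hp, rfl⟩
    obtain ⟨ε, hε, g', hg', hgg⟩ := exists_isParallelMetric_add hg (s := s) ⟨hs, hp⟩ hsym
    have h1 : g'.inner x ∈ parallelMetricSpan cov x := Submodule.subset_span ⟨g', hg', rfl⟩
    have h2 : g.inner x ∈ parallelMetricSpan cov x := Submodule.subset_span ⟨g, hg, rfl⟩
    have h3 : s x = ε⁻¹ • g'.inner x + (-ε⁻¹) • g.inner x := by
      rw [hgg]
      ext u v
      change s x u v = ε⁻¹ * (g.inner x u v + ε * s x u v) + -ε⁻¹ * g.inner x u v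
      field_simp
      ring
    rw [SetLike.mem_coe, h3]
    exact Submodule.add_mem _ (Submodule.smul_mem _ _ h1) (Submodule.smul_mem _ _ h2)

end Positivity

/-! ### The class of a flat bundle with a parallel scalar product -/

section EmbedSum

variable {V : Type*} [AddCommGroup V] [Module ℝ V] {m n : ℕ}

/-- The decomposition of the indices in the definition of `embedGL`. -/
def splitIndex (h : m ≤ n) : Fin (n - m) ⊕ Fin m ≃ Fin n :=
  finSumFinEquiv.trans (finCongr (Nat.sub_add_cancel h))

theorem embedGL_sum (h : m ≤ n) (A : Matrix.GeneralLinearGroup (Fin m) ℝ) (v : Fin n → V)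
    (i : Fin (n - m) ⊕ Fin m) :
    ∑ j, (embedGL h A : Matrix (Fin n) (Fin n) ℝ) (splitIndex h i) j • v j =
      Sum.elim (fun k ↦ v (splitIndex h (Sum.inl k)))
        (fun k ↦ ∑ l, (A : Matrix (Fin m) (Fin m) ℝ) k l • v (splitIndex h (Sum.inr l))) i := by
  rw [← (splitIndex h).sum_comp, Fintype.sum_sum_type]
  have key : ∀ i j, (embedGL h A : Matrix (Fin n) (Fin n) ℝ) (splitIndex h i) (splitIndex h j) =
      Matrix.fromBlocks (1 : Matrix (Fin (n - m)) (Fin (n - m)) ℝ) 0 0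
        (A : Matrix (Fin m) (Fin m) ℝ) i j := fun i j ↦ by
    change Matrix.reindex (splitIndex h) (splitIndex h) (Matrix.fromBlocks
      (1 : Matrix (Fin (n - m)) (Fin (n - m)) ℝ) 0 0 (A : Matrix (Fin m) (Fin m) ℝ)) _ _ = _
    rw [Matrix.reindex_apply, Matrix.submatrix_apply, Equiv.symm_apply_apply,
      Equiv.symm_apply_apply]
  simp only [key]
  rcases i with i | i
  · simp [Matrix.one_apply]
  · simp

end EmbedSum

section FlatClass

variable {E : Type*} [NormedAddCommGroup E] [NormedSpace ℝ E]
  {M : Type u} [TopologicalSpace M] [ChartedSpace E M] [IsManifold 𝓘(ℝ, E) ∞ M]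
  {F : Type*} [NormedAddCommGroup F] [NormedSpace ℝ F]
  {V : M → Type*} [TopologicalSpace (TotalSpace F V)]
  [∀ x, AddCommGroup (V x)] [∀ x, Module ℝ (V x)] [∀ x : M, TopologicalSpace (V x)]
  [∀ x, IsTopologicalAddGroup (V x)] [∀ x, ContinuousSMul ℝ (V x)]
  [FiberBundle F V] [VectorBundle ℝ F V] [ContMDiffVectorBundle ∞ F V 𝓘(ℝ, E)]
  {D : CovariantDerivative 𝓘(ℝ, E) F V} {T : ∀ y : M, Set (V y)}
  {B : ∀ y, LinearMap.BilinForm ℝ (V y)}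

/-- `t` is the cocycle of the frames `h α`. -/
def IsTransition {𝒰 : OpenCover M} {n : ℕ} (h : 𝒰.Index → Fin n → ∀ y : M, V y)
    (t : Cocycle 𝒰 n) : Prop :=
  ∀ α β x (hα : x ∈ 𝒰.set α) (hβ : x ∈ 𝒰.set β) (i : Fin n),
    h α i x = ∑ j, (t.val α β ⟨x, hα, hβ⟩ : Matrix (Fin n) (Fin n) ℝ) i j • h β j x

theorem exists_cocycle (hB : IsParallelPairing D T B) {𝒰 : OpenCover M} {n : ℕ}
    {h : 𝒰.Index → Fin n → ∀ y : M, V y} (hh : ∀ α, IsFlatFrame D T (h α) (𝒰.set α)) :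
    ∃ t : Cocycle 𝒰 n, IsTransition h t := by
  choose t ht using fun α β ↦ (hh α).exists_transition hB (hh β)
  refine ⟨⟨t, fun α β γ x hα hβ hγ ↦ ?_⟩, ht⟩
  rw [mul_assoc, inv_mul_eq_one]
  refine transition_unique ((hh γ).linearIndependent hγ) fun i ↦ ?_
  rw [← ht α γ x hα hγ i, Units.val_mul]
  exact transition_mul (ht α β x hα hβ) (ht β γ x hβ hγ) i

theorem sameClass_of_isTransition (hB : IsParallelPairing D T B) {𝒰 𝒰' : OpenCover M} {n : ℕ}
    {h : 𝒰.Index → Fin n → ∀ y : M, V y} (hh : ∀ α, IsFlatFrame D T (h α) (𝒰.set α))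
    {t : Cocycle 𝒰 n} (ht : IsTransition h t)
    {h' : 𝒰'.Index → Fin n → ∀ y : M, V y} (hh' : ∀ α, IsFlatFrame D T (h' α) (𝒰'.set α))
    {t' : Cocycle 𝒰' n} (ht' : IsTransition h' t') : t.toH1 = t'.toH1 := by
  refine Quotient.sound ?_
  choose b hb using fun p : 𝒰.Index × 𝒰'.Index ↦ (hh p.1).exists_transition hB (hh' p.2)
  refine ⟨⟨𝒰.Index × 𝒰'.Index, fun p ↦ 𝒰.set p.1 ⊓ 𝒰'.set p.2, fun x ↦ ?_⟩, Prod.fst, Prod.snd,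
    fun p ↦ inf_le_left, fun p ↦ inf_le_right, b, ?_⟩
  · obtain ⟨α, hα⟩ := 𝒰.exists_mem x
    obtain ⟨β, hβ⟩ := 𝒰'.exists_mem x
    exact ⟨(α, β), hα, hβ⟩
  · rintro ⟨α, α'⟩ ⟨β, β'⟩ x ⟨hα, hα'⟩ ⟨hβ, hβ'⟩
    change t'.val α' β' ⟨x, hα', hβ'⟩ = (b (α, α') ⟨x, hα, hα'⟩)⁻¹ *
      t.val α β ⟨x, hα, hβ⟩ * b (β, β') ⟨x, hβ, hβ'⟩
    rw [mul_assoc, eq_inv_mul_iff_mul_eq]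
    refine transition_unique ((hh' β').linearIndependent hβ') fun i ↦ ?_
    rw [Units.val_mul, Units.val_mul,
      ← transition_mul (hb (α, α') x hα hα') (ht' α' β' x hα' hβ') i]
    exact transition_mul (ht α β x hα hβ) (hb (β, β') x hβ hβ') i

/-- If the class of the frames comes from `GL(m, ℝ)`, then there are `n - m` independent global
parallel sections. -/
theorem exists_sections_of_embed {𝒰 : OpenCover M} {m n : ℕ}
    {h : 𝒰.Index → Fin n → ∀ y : M, V y} (hh : ∀ α, IsFlatFrame D T (h α) (𝒰.set α))
    {t : Cocycle 𝒰 n} (ht : IsTransition h t) (hm : m ≤ n) {σ : H1 M m}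
    (hσ : H1.embed hm σ = t.toH1) :
    ∃ s : Fin (n - m) → ∀ y : M, V y, (∀ i, s i ∈ parallelSections D ⊤) ∧
      (∀ i y, s i y ∈ T y) ∧ ∀ y, LinearIndependent ℝ fun i ↦ s i y := by
  induction σ using Quotient.inductionOn with | h a => ?_
  obtain ⟨𝒰', a⟩ := a
  obtain ⟨𝒱, ρ', ρ, hρ', hρ, b, hb⟩ := Quotient.exact hσ
  have hb' : ∀ α β x (hα : x ∈ 𝒱.set α) (hβ : x ∈ 𝒱.set β),
      b α ⟨x, hα⟩ * t.val (ρ α) (ρ β) ⟨x, hρ α hα, hρ β hβ⟩ =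
        embedGL hm (a.val (ρ' α) (ρ' β) ⟨x, hρ' α hα, hρ' β hβ⟩) * b β ⟨x, hβ⟩ := by
    intro α β x hα hβ
    have := hb α β x hα hβ
    change t.val (ρ α) (ρ β) ⟨x, hρ α hα, hρ β hβ⟩ = (b α ⟨x, hα⟩)⁻¹ *
      embedGL hm (a.val (ρ' α) (ρ' β) ⟨x, hρ' α hα, hρ' β hβ⟩) * b β ⟨x, hβ⟩ at this
    rw [this, mul_assoc, mul_inv_cancel_left]
  -- The frames `h` changed by `b`: their transition matrices are the block matrices, so by `hk'`
  -- the first `n - m` members do not depend on the index.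
  let k : ∀ (α : 𝒱.Index) (x : M), x ∈ 𝒱.set α → Fin n → V x := fun α x hx i ↦
    ∑ j, (b α ⟨x, hx⟩ : Matrix (Fin n) (Fin n) ℝ) i j • h (ρ α) j x
  have hk : ∀ α β x (hα : x ∈ 𝒱.set α) (hβ : x ∈ 𝒱.set β) (i : Fin n), k α x hα i =
      ∑ j, (embedGL hm (a.val (ρ' α) (ρ' β) ⟨x, hρ' α hα, hρ' β hβ⟩) :
        Matrix (Fin n) (Fin n) ℝ) i j • k β x hβ j := by
    intro α β x hα hβ i
    have h1 := transition_mul (v := k α x hα) (fun i ↦ rfl)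
      (ht (ρ α) (ρ β) x (hρ α hα) (hρ β hβ)) i
    have h2 := transition_mul (v := fun i ↦ ∑ j, (embedGL hm
      (a.val (ρ' α) (ρ' β) ⟨x, hρ' α hα, hρ' β hβ⟩) : Matrix (Fin n) (Fin n) ℝ) i j • k β x hβ j)
      (fun i ↦ rfl) (v' := k β x hβ) (fun i ↦ rfl) i
    rw [h1, h2, ← Units.val_mul, ← Units.val_mul, hb' α β x hα hβ]
  have hk' : ∀ α β x (hα : x ∈ 𝒱.set α) (hβ : x ∈ 𝒱.set β) (i : Fin (n - m)),
      k α x hα (splitIndex hm (Sum.inl i)) = k β x hβ (splitIndex hm (Sum.inl i)) := by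
    intro α β x hα hβ i
    rw [hk α β x hα hβ, embedGL_sum]
    rfl
  choose A hA using 𝒱.exists_mem
  let s : Fin (n - m) → ∀ y : M, V y := fun i y ↦ k (A y) y (hA y) (splitIndex hm (Sum.inl i))
  -- The index `A y` may jump with `y`, but near `x` it can be replaced by the fixed index `A x`.
  -- There `b` is constant, so `s i` is a combination of parallel sections with constant
  -- coefficients.
  have hloc : ∀ i x, ∃ N : Opens M, x ∈ N ∧ ∃ X ∈ parallelSections D N, ∀ y ∈ N, s i y = X y := by
    intro i x
    let α := A x
    let X : ∀ y : M, V y := ∑ j, (b α ⟨x, hA x⟩ : Matrix (Fin n) (Fin n) ℝ)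
      (splitIndex hm (Sum.inl i)) j • h (ρ α) j
    have h1 := (IsLocallyConstant.iff_exists_open (b α)).1 (b α).isLocallyConstant ⟨x, hA x⟩
    obtain ⟨O, hO, hxO, hOc⟩ := h1
    let N : Opens M := ⟨Subtype.val '' O, (𝒱.set α).isOpen.isOpenMap_subtype_val O hO⟩
    have hN : N ≤ 𝒰.set (ρ α) := by
      rintro y ⟨⟨y, hy⟩, -, rfl⟩
      exact hρ α hy
    refine ⟨N, ⟨⟨x, hA x⟩, hxO, rfl⟩, X, Submodule.sum_mem _ fun j _ ↦ Submodule.smul_mem _ _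
      (parallelSections_mono D hN ((hh (ρ α)).mem j)), ?_⟩
    rintro y ⟨⟨y, hy⟩, hyO, rfl⟩
    change k (A y) y (hA y) _ = _
    rw [hk' (A y) α y (hA y) hy i]
    simp only [k, X, hOc _ hyO, Finset.sum_apply, Pi.smul_apply]
  refine ⟨s, fun i ↦ ⟨fun x _ ↦ ?_, fun x _ ↦ ?_⟩, fun i y ↦ ?_, fun y ↦ ?_⟩
  · obtain ⟨N, hxN, X, hX, hsX⟩ := hloc i x
    have h1 := ContMDiffOn.contMDiffAt hX.1 (N.isOpen.mem_nhds hxN)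
    refine (h1.congr_of_eventuallyEq ?_).contMDiffWithinAt
    filter_upwards [N.isOpen.mem_nhds hxN] with y hy
    rw [hsX y hy]
  · obtain ⟨N, hxN, X, hX, hsX⟩ := hloc i x
    have h1 := SmoothOn.mdifferentiableAt hX.1 N.isOpen hxN
    have h2 : MDiffAt (T% (s i)) x := by
      refine h1.congr_of_eventuallyEq ?_
      filter_upwards [N.isOpen.mem_nhds hxN] with y hy
      rw [hsX y hy]
    have h3 := D.isCovariantDerivativeOnUniv.congr_of_eventuallyEq h2 h1 Filter.univ_mem (by
      filter_upwards [N.isOpen.mem_nhds hxN] with y hy using hsX y hy)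
    exact h3.trans (hX.2 x hxN)
  · exact (hh _).sum_mem (hρ _ (hA y)) _
  · have h1 : LinearIndependent ℝ (k (A y) y (hA y)) := by
      have h2 := (hh (ρ (A y))).linearIndependent (hρ _ (hA y))
      rw [Fintype.linearIndependent_iff]
      intro c hc
      have hu : IsUnit (b (A y) ⟨y, hA y⟩ : Matrix (Fin n) (Fin n) ℝ) := Units.isUnit _
      rw [← Matrix.linearIndependent_rows_iff_isUnit, Fintype.linearIndependent_iff] at hu
      refine hu c ?_
      ext j
      refine Fintype.linearIndependent_iff.1 h2 (fun j ↦ _) ?_ j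
      rw [← hc]
      simp only [k, Finset.sum_apply, Finset.sum_smul, Pi.smul_apply, Finset.smul_sum,
        smul_eq_mul, mul_smul]
      exact Finset.sum_comm
    exact h1.comp _ ((splitIndex hm).injective.comp Sum.inl_injective)

end FlatClass

/-! ### Splitting off global parallel sections -/

section OrthogonalSplitting

variable {E : Type*} [NormedAddCommGroup E] [NormedSpace ℝ E]
  {M : Type u} [TopologicalSpace M] [ChartedSpace E M] [IsManifold 𝓘(ℝ, E) ∞ M]
  {F : Type*} [NormedAddCommGroup F] [NormedSpace ℝ F]
  {V : M → Type*} [TopologicalSpace (TotalSpace F V)]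
  [∀ x, AddCommGroup (V x)] [∀ x, Module ℝ (V x)] [∀ x : M, TopologicalSpace (V x)]
  [∀ x, IsTopologicalAddGroup (V x)] [∀ x, ContinuousSMul ℝ (V x)]
  [FiberBundle F V] [VectorBundle ℝ F V] [ContMDiffVectorBundle ∞ F V 𝓘(ℝ, E)]
  {D : CovariantDerivative 𝓘(ℝ, E) F V} {T : ∀ y : M, Set (V y)}
  {B : ∀ y, LinearMap.BilinForm ℝ (V y)}

/-- The elements of `T` that are orthogonal to the sections `s i`. -/
def orthogonalPart (T : ∀ y : M, Set (V y)) (B : ∀ y, LinearMap.BilinForm ℝ (V y)) {r : ℕ}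
    (s : Fin r → ∀ y : M, V y) (y : M) : Set (V y) :=
  {w | w ∈ T y ∧ ∀ i, B y (s i y) w = 0}

theorem IsParallelPairing.orthogonalPart (hB : IsParallelPairing D T B) {r : ℕ}
    (s : Fin r → ∀ y : M, V y) : IsParallelPairing D (orthogonalPart T B s) B :=
  ⟨hB.eventually_const, fun hw ↦ hB.definite hw.1⟩

/-- The map `φ` sends coefficients to the products with the `s i`. On the span of the `s i` it is
injective, because a vector of this span orthogonal to all `s i` is orthogonal to itself. Hence `φ`
is onto, and its kernel has dimension `n - (n - m) = m`. -/
theorem exists_orthogonal_coefficients {n m : ℕ} (hm : m ≤ n) {W : Type*} [AddCommGroup W]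
    [Module ℝ W] {b : LinearMap.BilinForm ℝ W} {v : Fin n → W} {s : Fin (n - m) → W}
    (hsv : ∀ i, s i ∈ Submodule.span ℝ (range v)) (hs : LinearIndependent ℝ s)
    (hb : ∀ w ∈ Submodule.span ℝ (range v), b w w = 0 → w = 0) :
    ∃ C : Fin m → Fin n → ℝ, LinearIndependent ℝ C ∧ ∀ c : Fin n → ℝ,
      (∀ i, b (s i) (∑ j, c j • v j) = 0) ↔ c ∈ Submodule.span ℝ (range C) := by
  let φ : (Fin n → ℝ) →ₗ[ℝ] (Fin (n - m) → ℝ) :=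
    LinearMap.pi fun i ↦ b (s i) ∘ₗ Fintype.linearCombination ℝ v
  have hφ : ∀ c i, φ c i = b (s i) (∑ j, c j • v j) := fun c i ↦ rfl
  choose S hS using fun i ↦ (Submodule.mem_span_range_iff_exists_fun ℝ).1 (hsv i)
  let ψ : (Fin (n - m) → ℝ) →ₗ[ℝ] (Fin n → ℝ) := Fintype.linearCombination ℝ S
  have hψ : ∀ d, ∑ j, ψ d j • v j = ∑ i, d i • s i := by
    intro d
    have : ∀ j, ψ d j = ∑ i, d i * S i j := fun j ↦ by
      simp [ψ, Fintype.linearCombination_apply, Finset.sum_apply]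
    simp only [this, Finset.sum_smul, ← hS, Finset.smul_sum, mul_smul]
    exact Finset.sum_comm
  have hinj : Function.Injective (φ ∘ₗ ψ) := by
    rw [← LinearMap.ker_eq_bot, LinearMap.ker_eq_bot']
    intro d hd
    have h1 : ∀ i, b (s i) (∑ k, d k • s k) = 0 := fun i ↦ by
      have := congrFun hd i
      rwa [LinearMap.comp_apply, hφ, hψ] at this
    have h2 : ∑ k, d k • s k = 0 := by
      refine hb _ (Submodule.sum_mem _ fun k _ ↦ Submodule.smul_mem _ _ (hsv k)) ?_
      conv_lhs => enter [1]; rw [map_sum]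
      rw [LinearMap.sum_apply]
      refine Finset.sum_eq_zero fun k _ ↦ ?_
      rw [map_smul, LinearMap.smul_apply, h1, smul_zero]
    exact funext (Fintype.linearIndependent_iff.1 hs d h2)
  have hsurj : Function.Surjective φ := by
    have := LinearMap.injective_iff_surjective.1 hinj
    exact Function.Surjective.of_comp this
  have hker : Module.finrank ℝ (LinearMap.ker φ) = m := by
    have h1 := LinearMap.finrank_range_add_finrank_ker φ
    rw [LinearMap.range_eq_top.2 hsurj, finrank_top, Module.finrank_fin_fun,
      Module.finrank_fin_fun] at h1
    omega
  let β := Module.finBasisOfFinrankEq ℝ (LinearMap.ker φ) hker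
  refine ⟨fun j ↦ β j, ?_, fun c ↦ ?_⟩
  · exact β.linearIndependent.map' (LinearMap.ker φ).subtype (Submodule.ker_subtype _)
  · have h1 : Submodule.span ℝ (range fun j ↦ ((β j : LinearMap.ker φ) : Fin n → ℝ)) =
        LinearMap.ker φ := by
      have := congrArg (Submodule.map (LinearMap.ker φ).subtype) β.span_eq
      rw [Submodule.map_span, ← range_comp, Submodule.map_subtype_top] at this
      exact this
    rw [h1, LinearMap.mem_ker]
    constructor
    · intro h
      ext i
      exact h i
    · intro h i
      exact congrFun h i

/-- Products of parallel sections are constant on the connected set `U`. The coefficients that give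
orthogonality at `p` therefore do so at every point of `U`, and constant coefficients give parallel
sections. -/
theorem exists_orthogonal_frame (hB : IsParallelPairing D T B) {n m : ℕ} (hm : m ≤ n)
    {s : Fin (n - m) → ∀ y : M, V y} (hs : ∀ i, s i ∈ parallelSections D ⊤)
    (hsT : ∀ i y, s i y ∈ T y) (hsl : ∀ y, LinearIndependent ℝ fun i ↦ s i y)
    {h : Fin n → ∀ y : M, V y} {U : Opens M} (hh : IsFlatFrame D T h U)
    (hU : IsPreconnected (U : Set M)) {p : M} (hp : p ∈ U) :
    ∃ b : Fin m → ∀ y : M, V y, IsFlatFrame D (orthogonalPart T B s) b U := by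
  obtain ⟨C, hC, hCs⟩ := exists_orthogonal_coefficients hm (b := B p) (v := fun j ↦ h j p)
    (s := fun i ↦ s i p) (fun i ↦ (hh.mem_iff hp).1 (hsT i p)) (hsl p)
    (fun w hw ↦ hB.definite ((hh.mem_iff hp).2 hw))
  have hpar : ∀ c : Fin n → ℝ, ∑ j, c j • h j ∈ parallelSections D U := fun c ↦
    Submodule.sum_mem _ fun j _ ↦ Submodule.smul_mem _ _ (hh.mem j)
  have happ : ∀ (c : Fin n → ℝ) y, (∑ j, c j • h j) y = ∑ j, c j • h j y := fun c y ↦ by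
    simp [Finset.sum_apply]
  have hiff : ∀ y ∈ U, ∀ c : Fin n → ℝ,
      (∀ i, B y (s i y) (∑ j, c j • h j y) = 0) ↔ c ∈ Submodule.span ℝ (range C) := by
    intro y hy c
    rw [← hCs c]
    refine forall_congr' fun i ↦ ?_
    have := hB.const hU (parallelSections_mono D le_top (hs i)) (hpar c) hy hp
    rw [happ, happ] at this
    rw [this]
  refine ⟨fun k ↦ ∑ j, C k j • h j, ⟨⟨fun k ↦ (hpar _).1, fun y hy ↦ ?_, fun y hy ↦ ?_⟩,
    fun k ↦ (hpar _).2⟩⟩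
  · have h1 : LinearIndependent ℝ fun k ↦ ∑ j, C k j • h j y := by
      have := hC.map' (Fintype.linearCombination ℝ fun j ↦ h j y)
        (LinearMap.ker_eq_bot.2 (hh.linearIndependent hy).fintypeLinearCombination_injective)
      exact this
    simpa only [happ] using h1
  · have h2 : Submodule.span ℝ (range fun k ↦ (∑ j, C k j • h j) y) =
        (Submodule.span ℝ (range C)).map (Fintype.linearCombination ℝ fun j ↦ h j y) := by
      rw [Submodule.map_span, ← range_comp]
      congr 1
      congr 1
      ext1 k
      rw [happ]
      rfl
    rw [h2]
    ext w
    rw [SetLike.mem_coe, Submodule.mem_map]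
    constructor
    · rintro ⟨c, hc, rfl⟩
      exact ⟨hh.sum_mem hy c, (hiff y hy c).2 hc⟩
    · rintro ⟨hw, hw'⟩
      obtain ⟨c, rfl⟩ := (Submodule.mem_span_range_iff_exists_fun ℝ).1 ((hh.mem_iff hy).1 hw)
      exact ⟨c, (hiff y hy c).1 hw', rfl⟩

/-- Independent parallel sections and a flat frame of their orthogonal part form a flat frame. -/
theorem isFlatFrame_elim (hB : IsParallelPairing D T B) {n m : ℕ} (hm : m ≤ n)
    {s : Fin (n - m) → ∀ y : M, V y} (hs : ∀ i, s i ∈ parallelSections D ⊤)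
    (hsT : ∀ i y, s i y ∈ T y) (hsl : ∀ y, LinearIndependent ℝ fun i ↦ s i y)
    {h : Fin n → ∀ y : M, V y} {U : Opens M} (hh : IsFlatFrame D T h U)
    {b : Fin m → ∀ y : M, V y} (hb : IsFlatFrame D (orthogonalPart T B s) b U) :
    IsFlatFrame D T (fun i ↦ Sum.elim s b ((splitIndex hm).symm i)) U := by
  have hpar : ∀ i, Sum.elim s b i ∈ parallelSections D U := by
    rintro (i | i)
    · exact parallelSections_mono D le_top (hs i)
    · exact hb.mem i
  have hli : ∀ y ∈ U, LinearIndependent ℝ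
      fun i ↦ Sum.elim s b ((splitIndex hm).symm i) y := by
    intro y hy
    have h1 : LinearIndependent ℝ (Sum.elim (fun i ↦ s i y) (fun i ↦ b i y)) := by
      refine (hsl y).sum_type (hb.linearIndependent hy) (Submodule.disjoint_def.2 ?_)
      intro w hw hw'
      -- A vector in both spans is orthogonal to itself.
      have hwb := (hb.mem_iff hy).2 hw'
      refine hB.definite hwb.1 ?_
      obtain ⟨c, hc⟩ := (Submodule.mem_span_range_iff_exists_fun ℝ).1 hw
      have h3 : B y (∑ i, c i • s i y) w = 0 := by
        rw [map_sum, LinearMap.sum_apply]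
        refine Finset.sum_eq_zero fun i _ ↦ ?_
        rw [map_smul, LinearMap.smul_apply, hwb.2 i, smul_zero]
      rwa [hc] at h3
    have h2 := h1.comp _ (splitIndex hm).symm.injective
    convert h2 using 1
    ext i
    rcases hi : (splitIndex hm).symm i with j | j <;> simp [hi]
  refine ⟨⟨fun i ↦ (hpar _).1, hli, fun y hy ↦ ?_⟩, fun i ↦ (hpar _).2⟩
  rw [← hh.isFrameOn.span_eq y hy]
  congr 1
  have : FiniteDimensional ℝ (Submodule.span ℝ (range fun i ↦ h i y)) :=
    FiniteDimensional.span_of_finite ℝ (finite_range _)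
  refine Submodule.eq_of_le_of_finrank_eq (Submodule.span_le.2 ?_) ?_
  · rintro _ ⟨i, rfl⟩
    rw [SetLike.mem_coe, ← hh.mem_iff hy]
    rcases hi : (splitIndex hm).symm i with j | j
    · simpa only [hi, Sum.elim_inl] using hsT j y
    · simpa only [hi, Sum.elim_inr] using (hb.apply_mem hy j).1
  · rw [finrank_span_eq_card (hli y hy), finrank_span_eq_card (hh.linearIndependent hy)]

/-- `n - m` independent global parallel sections reduce the class of a flat bundle to
`GL(m, ℝ)`. -/
theorem exists_embed_of_sections [LocallyConnectedSpace M] (hB : IsParallelPairing D T B)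
    {n m : ℕ} (hm : m ≤ n)
    (hT : ∀ p : M, ∃ (U : Opens M) (h : Fin n → ∀ y : M, V y), p ∈ U ∧ IsFlatFrame D T h U)
    {s : Fin (n - m) → ∀ y : M, V y} (hs : ∀ i, s i ∈ parallelSections D ⊤)
    (hsT : ∀ i y, s i y ∈ T y) (hsl : ∀ y, LinearIndependent ℝ fun i ↦ s i y) :
    ∃ (𝒰 : OpenCover M) (h : 𝒰.Index → Fin n → ∀ y : M, V y) (a : Cocycle 𝒰 m),
      (∀ α, IsFlatFrame D T (h α) (𝒰.set α)) ∧ IsTransition h (a.embed hm) := by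
  have key : ∀ p : M, ∃ (U : Opens M) (h : Fin n → ∀ y : M, V y) (b : Fin m → ∀ y : M, V y),
      p ∈ U ∧ IsFlatFrame D T h U ∧ IsFlatFrame D (orthogonalPart T B s) b U := by
    intro p
    obtain ⟨U, h, hpU, hh⟩ := hT p
    -- Connected neighbourhoods are needed for `exists_orthogonal_frame`; components are open by
    -- local connectedness.
    let U' : Opens M := ⟨connectedComponentIn U p, U.isOpen.connectedComponentIn⟩
    have hU' : U' ≤ U := connectedComponentIn_subset _ _
    have hpU' : p ∈ U' := mem_connectedComponentIn hpU
    obtain ⟨b, hb⟩ := exists_orthogonal_frame hB hm hs hsT hsl (hh.mono hU')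
      isPreconnected_connectedComponentIn hpU'
    exact ⟨U', h, b, hpU', hh.mono hU', hb⟩
  choose U h b hpU hh hb using key
  let 𝒰 : OpenCover M := ⟨M, U, fun x ↦ ⟨x, hpU x⟩⟩
  -- The cocycle of the orthogonal part is the block `A`; the sections `s`, common to all frames,
  -- contribute the identity block.
  obtain ⟨a, ha⟩ := exists_cocycle (𝒰 := 𝒰) (h := b) (hB.orthogonalPart s) hb
  refine ⟨𝒰, fun α i ↦ Sum.elim s (b α) ((splitIndex hm).symm i), a,
    fun α ↦ isFlatFrame_elim hB hm hs hsT hsl (hh α) (hb α), fun α β x hα hβ i ↦ ?_⟩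
  obtain ⟨i, rfl⟩ := (splitIndex hm).surjective i
  have h1 := embedGL_sum hm (a.val α β ⟨x, hα, hβ⟩)
    (fun j ↦ Sum.elim s (b β) ((splitIndex hm).symm j) x) i
  refine Eq.trans ?_ h1.symm
  simp only [Equiv.symm_apply_apply]
  rcases i with i | i
  · rfl
  · exact ha α β x hα hβ i

end OrthogonalSplitting

/-! ### The rank of the class of a flat bundle -/

section FlatRank

variable {E : Type*} [NormedAddCommGroup E] [NormedSpace ℝ E]
  {M : Type u} [TopologicalSpace M] [ChartedSpace E M] [IsManifold 𝓘(ℝ, E) ∞ M]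
  {F : Type*} [NormedAddCommGroup F] [NormedSpace ℝ F]
  {V : M → Type*} [TopologicalSpace (TotalSpace F V)]
  [∀ x, AddCommGroup (V x)] [∀ x, Module ℝ (V x)] [∀ x : M, TopologicalSpace (V x)]
  [∀ x, IsTopologicalAddGroup (V x)] [∀ x, ContinuousSMul ℝ (V x)]
  [FiberBundle F V] [VectorBundle ℝ F V] [ContMDiffVectorBundle ∞ F V 𝓘(ℝ, E)]
  {D : CovariantDerivative 𝓘(ℝ, E) F V} {T : ∀ y : M, Set (V y)}
  {B : ∀ y, LinearMap.BilinForm ℝ (V y)}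

variable (D T) in
/-- The global parallel sections of the subspaces spanned by `T`. -/
def globalSections : Submodule ℝ (∀ y : M, V y) :=
  parallelSections D ⊤ ⊓ Submodule.pi univ fun y ↦ Submodule.span ℝ (T y)

/-- The fibres of `T` are mere sets; where there is a flat frame they are subspaces, and the span in
`globalSections` adds nothing. -/
theorem IsFlatFrame.mem_span_iff {n : ℕ} {h : Fin n → ∀ y : M, V y} {U : Opens M}
    (hh : IsFlatFrame D T h U) {y : M} (hy : y ∈ U) {w : V y} :
    w ∈ Submodule.span ℝ (T y) ↔ w ∈ T y := by
  rw [← hh.isFrameOn.span_eq y hy, Submodule.span_coe_eq_restrictScalars,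
    Submodule.restrictScalars_self, SetLike.mem_coe]

theorem exists_isFlatFrame_const [PreconnectedSpace M] [Nonempty M]
    (hT : ∀ p : M, ∃ (U : Opens M) (n : ℕ) (h : Fin n → ∀ y : M, V y),
      p ∈ U ∧ IsFlatFrame D T h U) :
    ∃ n : ℕ, ∀ p : M, ∃ (U : Opens M) (h : Fin n → ∀ y : M, V y), p ∈ U ∧ IsFlatFrame D T h U := by
  have hlc : IsLocallyConstant fun x : M ↦ Module.finrank ℝ (Submodule.span ℝ (T x)) := by
    rw [IsLocallyConstant.iff_eventually_eq]
    intro p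
    obtain ⟨U, n, h, hp, hh⟩ := hT p
    filter_upwards [U.isOpen.mem_nhds hp] with y hy
    rw [hh.finrank hy, hh.finrank hp]
  obtain ⟨x⟩ := ‹Nonempty M›
  refine ⟨Module.finrank ℝ (Submodule.span ℝ (T x)), fun p ↦ ?_⟩
  obtain ⟨U, n, h, hp, hh⟩ := hT p
  obtain rfl : Module.finrank ℝ (Submodule.span ℝ (T x)) = n :=
    (hlc.apply_eq_of_preconnectedSpace x p).trans (hh.finrank hp)
  exact ⟨U, h, hp, hh⟩

/-- The values of the global parallel sections of a flat bundle with a parallel scalar product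
span a subspace whose dimension is the rank of the class of the bundle. -/
theorem finrank_globalSections [PreconnectedSpace M] [LocallyConnectedSpace M]
    (hB : IsParallelPairing D T B) {n : ℕ}
    (hT : ∀ p : M, ∃ (U : Opens M) (h : Fin n → ∀ y : M, V y), p ∈ U ∧ IsFlatFrame D T h U)
    {𝒰 : OpenCover M} {h : 𝒰.Index → Fin n → ∀ y : M, V y}
    (hh : ∀ α, IsFlatFrame D T (h α) (𝒰.set α)) {t : Cocycle 𝒰 n} (ht : IsTransition h t)
    (x : M) :
    Module.finrank ℝ ((globalSections D T).map (LinearMap.proj x)) = t.toH1.rank := by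
  have hspan : ∀ y, ∀ w : V y, w ∈ Submodule.span ℝ (T y) ↔ w ∈ T y := fun y w ↦ by
    obtain ⟨U, h, hy, hh⟩ := hT y
    exact hh.mem_span_iff hy
  have hval : ∀ s ∈ globalSections D T, ∀ y, s y ∈ T y := fun s hs y ↦
    (hspan y _).1 (hs.2 y (mem_univ y))
  let ev : ∀ y : M, globalSections D T →ₗ[ℝ] V y := fun y ↦
    (LinearMap.proj y) ∘ₗ (globalSections D T).subtype
  -- A global parallel section of `T` is determined by its value at one point.
  have hev : ∀ y, Function.Injective (ev y) := by
    intro y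
    rw [← LinearMap.ker_eq_bot, LinearMap.ker_eq_bot']
    rintro ⟨s, hs⟩ h0
    ext z
    exact hB.eq_zero (U := ⊤) isPreconnected_univ hs.1 (fun y _ ↦ hval s hs y) (mem_univ y) h0
      (mem_univ z)
  have hfr : Module.finrank ℝ ((globalSections D T).map (LinearMap.proj x)) =
      Module.finrank ℝ (globalSections D T) := by
    rw [← LinearMap.finrank_range_of_inj (hev x), LinearMap.range_comp, Submodule.range_subtype]
  obtain ⟨U₀, h₀, hx₀, hh₀⟩ := hT x
  have : FiniteDimensional ℝ (Submodule.span ℝ (T x)) := by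
    rw [← hh₀.isFrameOn.span_eq x hx₀, Submodule.span_coe_eq_restrictScalars,
      Submodule.restrictScalars_self]
    exact FiniteDimensional.span_of_finite ℝ (finite_range _)
  let ev' : globalSections D T →ₗ[ℝ] Submodule.span ℝ (T x) :=
    (ev x).codRestrict _ fun s ↦ s.2.2 x (mem_univ x)
  have hev' : Function.Injective ev' := fun a b hab ↦ hev x (congrArg Subtype.val hab)
  have hfin : FiniteDimensional ℝ (globalSections D T) := FiniteDimensional.of_injective ev' hev'
  have hle : Module.finrank ℝ (globalSections D T) ≤ n :=
    (LinearMap.finrank_le_finrank_of_injective hev').trans (hh₀.finrank hx₀).le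
  set S : Set ℕ := {m | ∃ h : m ≤ n, t.toH1 ∈ range (H1.embed (M := M) h)} with hS
  have hmem : n - Module.finrank ℝ (globalSections D T) ∈ S := by
    have hm : n - Module.finrank ℝ (globalSections D T) ≤ n := Nat.sub_le _ _
    -- With `m = n - r`, a basis of the global sections has `n - m = r` members; the truncated
    -- subtractions are harmless by `hle`.
    let b := Module.finBasisOfFinrankEq ℝ (globalSections D T)
      (n := n - (n - Module.finrank ℝ (globalSections D T))) (by omega)
    obtain ⟨𝒰', h', a, hh', ha⟩ := exists_embed_of_sections hB hm hT
      (s := fun i ↦ (b i : ∀ y, V y)) (fun i ↦ (b i).2.1) (fun i y ↦ hval _ (b i).2 y)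
      (fun y ↦ b.linearIndependent.map' (ev y) (LinearMap.ker_eq_bot.2 (hev y)))
    exact ⟨hm, a.toH1, sameClass_of_isTransition hB hh' ha hh ht⟩
  have h1 : sInf S ≤ n - Module.finrank ℝ (globalSections D T) := Nat.sInf_le hmem
  -- The infimum is attained because `S` is nonempty, and a reduction to this minimal size yields `n
  -- - sInf S` independent global sections.
  obtain ⟨hm, σ, hσ⟩ : sInf S ∈ S := Nat.sInf_mem ⟨_, hmem⟩
  obtain ⟨s, hs, hsT, hsl⟩ := exists_sections_of_embed hh ht hm hσ
  have h2 : n - sInf S ≤ Module.finrank ℝ (globalSections D T) := by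
    let s' : Fin (n - sInf S) → globalSections D T := fun i ↦
      ⟨s i, hs i, fun y _ ↦ (hspan y _).2 (hsT i y)⟩
    have h3 : LinearIndependent ℝ s' := LinearIndependent.of_comp (ev x) (hsl x)
    simpa using h3.fintype_card_le_finrank
  rw [hfr, H1.rank, ← hS]
  omega

end FlatRank

/-! ### Regular metric connections -/

section Regular

variable {E : Type*} [NormedAddCommGroup E] [NormedSpace ℝ E] [FiniteDimensional ℝ E]
  {M : Type u} [TopologicalSpace M] [ChartedSpace E M] [IsManifold 𝓘(ℝ, E) ∞ M] [T2Space M]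
  (cov : CovariantDerivative 𝓘(ℝ, E) E (TangentSpace 𝓘(ℝ, E) : M → Type _))
  [CovariantDerivative.ContMDiffCovariantDerivative cov ∞]

/-- Since `∇s` vanishes in a whole neighbourhood, so do both iterated derivatives; with constant
fields in the chart there is no bracket term. -/
theorem curvature_eq_zero_of_parallel {U : Opens M} {s : ∀ y : M, BilinForms E y}
    (hs : s ∈ parallelSections (tensorCov cov) U) {y : M} (hy : y ∈ U)
    (u v : TangentSpace 𝓘(ℝ, E) y) : curvature (tensorCov cov) u v (s y) = 0 := by
  have hys : y ∈ (chartAt E y).source := mem_chart_source E y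
  set z := extChartAt 𝓘(ℝ, E) y y with hz
  set X : E → E →L[ℝ] E →L[ℝ] ℝ := rep (E →L[ℝ] E →L[ℝ] ℝ) y s with hX
  have hzt : z ∈ (extChartAt 𝓘(ℝ, E) y).target := mem_extChartAt_target (I := 𝓘(ℝ, E)) y
  have hL : DifferentiableAt ℝ (formSymbol cov y) z :=
    ((contDiffOn_formSymbol cov y).contDiffAt ((isOpen_extChartAt_target y).mem_nhds
      hzt)).differentiableAt (by simp)
  have hXs : ContDiffAt ℝ ∞ X z := by
    have h1 : SmoothOn 𝓘(ℝ, E) (E →L[ℝ] E →L[ℝ] ℝ) s ((U : Set M) ∩ (chartAt E y).source) :=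
      ContMDiffOn.mono hs.1 inter_subset_left
    have hO := U.isOpen.inter (chartAt E y).open_source
    rw [smoothOn_iff_rep (source_subset_baseSet_bilin y) inter_subset_right hO] at h1
    refine h1.contDiffAt ((isOpen_extChartAt_target_inter y hO).mem_nhds ⟨hzt, ?_⟩)
    rw [mem_preimage, hz, extChartAt_to_inv (I := 𝓘(ℝ, E)) y]
    exact ⟨hy, hys⟩
  have hpar : ∀ᶠ x in 𝓝 z, modelCov (formSymbol cov y) X x = 0 := by
    filter_upwards [eventually_extChartAt (E := E) hys (U.isOpen.mem_nhds hy)] with x ⟨hxt, hxs, hxU⟩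
    ext1 a
    have h1 := chartForm_tensorCov cov hxs (SmoothOn.mdifferentiableAt hs.1 U.isOpen hxU) a
    rw [hs.2 _ hxU, zero_apply, ← chartFormEquiv_apply hxs, map_zero,
      (extChartAt 𝓘(ℝ, E) y).right_inv hxt] at h1
    rw [← h1, zero_apply]
  have hzero : ∀ a b : E,
      modelCov (formSymbol cov y) (fun x ↦ modelCov (formSymbol cov y) X x a) z b = 0 := by
    intro a b
    have h1 : (fun x ↦ modelCov (formSymbol cov y) X x a) =ᶠ[𝓝 z] fun _ ↦ 0 := by
      filter_upwards [hpar] with x hx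
      rw [hx, zero_apply]
    rw [modelCov_congr _ h1, modelCov_apply, fderiv_const_apply, zero_apply, map_zero, add_zero]
  refine (curvature_eq_zero_iff cov hys (s y)).2 (fun a b ↦ ?_) u v
  have h1 := modelCov_commutator (U := fun _ ↦ a) (V := fun _ ↦ b) hL
    (hXs.of_le ENat.LEInfty.out) (differentiableAt_const a) (differentiableAt_const b)
  rw [hzero, hzero, hpar.self_of_nhds, zero_apply, sub_zero, sub_zero] at h1
  rw [← rep_bilin_apply hys]
  exact h1.symm

variable {cov}

/-- The terminal subset of the derived flag of a regular connection is a flat bundle that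
contains all global parallel sections. -/
theorem IsRegular.flat [Nonempty M] (hreg : IsRegular cov) :
    (∀ y, terminalForms cov y ⊆ symForms E y) ∧
    (∀ p : M, ∃ (U : Opens M) (n : ℕ) (h : Fin n → ∀ y : M, BilinForms E y),
      p ∈ U ∧ IsFlatFrame (tensorCov cov) (terminalForms cov) h U) ∧
    ∀ s ∈ parallelSections (tensorCov cov) (⊤ : Opens M), (∀ y, s y ∈ symForms E y) →
      ∀ y, s y ∈ terminalForms cov y := by
  have hzero : ∀ y, (0 : BilinForms E y) ∈ terminalForms cov y := by
    intro y
    obtain ⟨U, n, X, hy, hX⟩ := hreg y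
    rw [← hX.span_eq y hy]
    exact Submodule.zero_mem _
  -- Membership in `terminal` includes an index from which on the flag is stationary. Regularity
  -- makes the fibres spans, so they contain `0`, and this supplies `k`.
  obtain ⟨k, hk, -⟩ := hzero (Classical.arbitrary M)
  have hter : terminalForms cov = flag (tensorCov cov) (symForms E) k :=
    terminal_eq (tensorCov cov) (symForms E) hk
  have hker : ∀ y, terminalForms cov y ⊆ curvatureKer (tensorCov cov) (symForms E) y := fun y ↦ by
    rw [hter]
    exact flag_subset_curvatureKer (tensorCov cov) (symForms E) k y
  have hinv : ∀ y, terminalForms cov y ⊆ secondFormKer (tensorCov cov) (terminalForms cov) y := by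
    rw [hter]
    exact flag_subset_secondFormKer (tensorCov cov) (hk (k + 1) (Nat.le_succ k))
  refine ⟨fun y w hw ↦ (hker y hw).1, fun p ↦ ?_, fun s hs hsym y ↦ ?_⟩
  · obtain ⟨U, n, h, hp, hh, hpar⟩ := exists_parallel_frame cov hinv
      (fun y w hw ↦ (hker y hw).2) (hreg p)
    exact ⟨U, n, h, hp, hh, hpar⟩
  · rw [hter] at hzero ⊢
    exact mem_flag_of_parallel (tensorCov cov) hs.1 hs.2
      (fun x hx ↦ ⟨hsym x, curvature_eq_zero_of_parallel cov hs hx⟩) (fun x _ ↦ hzero x) le_rfl y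
      (mem_univ y)

/-- Global parallel sections of `W` and of `W̃` are the same, by the last part of `IsRegular.flat`;
as they form a vector space, their values at `x` already form a subspace. -/
theorem IsRegular.map_globalSections [Nonempty M] (hreg : IsRegular cov) (x : M) :
    (globalSections (tensorCov cov) (terminalForms cov)).map (LinearMap.proj x) =
      parallelSectionSpan cov x := by
  obtain ⟨hsym, hflat, hmem⟩ := hreg.flat
  apply le_antisymm
  · rintro w ⟨s, ⟨hs, hs'⟩, rfl⟩
    refine Submodule.subset_span ⟨s, hs.1, fun y ↦ ?_, hs.2, rfl⟩
    obtain ⟨U, n, h, hy, hh⟩ := hflat y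
    exact hsym y ((hh.mem_span_iff hy).1 (hs' y (mem_univ y)))
  · refine Submodule.span_le.2 ?_
    rintro w ⟨s, hs, hss, hp, rfl⟩
    exact ⟨s, ⟨⟨hs, hp⟩, fun y _ ↦ Submodule.subset_span (hmem s ⟨hs, hp⟩ hss y)⟩, rfl⟩

end Regular

end

end MetricConnection

/-! ### The theorem on ranks -/

theorem theorem3 {E : Type*} [NormedAddCommGroup E] [NormedSpace ℝ E] [FiniteDimensional ℝ E]
    {M : Type*} [TopologicalSpace M] [ChartedSpace E M] [IsManifold 𝓘(ℝ, E) ∞ M]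
    [T2Space M] [SecondCountableTopology M] [ConnectedSpace M]
    (cov : CovariantDerivative 𝓘(ℝ, E) E (TangentSpace 𝓘(ℝ, E) : M → Type _))
    [CovariantDerivative.ContMDiffCovariantDerivative cov ∞]
    (hreg : MetricConnection.IsRegular cov) (hmet : MetricConnection.IsMetric cov) :
    ∃ (n : ℕ) (τ : MetricConnection.H1 M n),
      (∀ x, Module.finrank ℝ (Submodule.span ℝ (MetricConnection.terminalForms cov x)) = n) ∧
      (∀ σ : MetricConnection.H1 M n,
        MetricConnection.IsFlatClass (MetricConnection.tensorCov cov)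
          (MetricConnection.terminalForms cov) σ ↔ σ = τ) ∧
      ∀ x, Module.finrank ℝ (MetricConnection.parallelMetricSpan cov x) =
          Module.finrank ℝ (MetricConnection.parallelSectionSpan cov x) ∧
        Module.finrank ℝ (MetricConnection.parallelSectionSpan cov x) = τ.rank := by
  have : LocallyConnectedSpace M := ChartedSpace.locallyConnectedSpace E M
  obtain ⟨hsym, hflat, -⟩ := hreg.flat
  obtain ⟨n, hT⟩ := MetricConnection.exists_isFlatFrame_const hflat
  -- Any one parallel metric serves: it only provides the parallel scalar product on `W̃`.
  obtain ⟨g, hg⟩ := id hmet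
  have hB := MetricConnection.isParallelPairing_metricPairing hg hsym
  choose U h hpU hh using hT
  let 𝒰 : MetricConnection.OpenCover M := ⟨M, U, fun x ↦ ⟨x, hpU x⟩⟩
  obtain ⟨t, ht⟩ := MetricConnection.exists_cocycle (𝒰 := 𝒰) hB hh
  refine ⟨n, t.toH1, fun x ↦ (hh x).finrank (hpU x), fun σ ↦ ⟨?_, ?_⟩, fun x ↦ ⟨?_, ?_⟩⟩
  · rintro ⟨𝒰', h', t', hf, hp, ht', rfl⟩
    exact MetricConnection.sameClass_of_isTransition hB (fun α ↦ ⟨hf α, hp α⟩) ht' hh ht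
  · rintro rfl
    exact ⟨𝒰, h, t, fun α ↦ (hh α).isFrameOn, fun α ↦ (hh α).parallelOn, ht, rfl⟩
  · rw [MetricConnection.parallelMetricSpan_eq hmet x]
  · rw [← hreg.map_globalSections x]
    exact MetricConnection.finrank_globalSections hB (fun p ↦ ⟨U p, h p, hpU p, hh p⟩)
      (𝒰 := 𝒰) hh ht x
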